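/- Let $k$ be a field, $X$ a scheme over $k$, $x \in X(k)$, and $n \in \mathbb{N} \cup \{\infty\}$. Let $X_n$ be the $n$-th jet scheme of $X$, i.e. the $k$-scheme representing the functor $Y \mapsto \operatorname{Hom}_k(Y \times_k \operatorname{Spec} k[t]/(t^{n+1}), X)$ on $k$-schemes if $n \in \mathbb{N}$, and the arc space of $X$, i.e. the $k$-scheme representing $Y \mapsto \operatorname{Hom}_k(\varinjlim_m Y \times_k \operatorname{Spec} k[t]/(t^{m+1}), X) = \varprojlim_m \operatorname{Hom}_k(Y \times_k \operatorname{Spec} k[t]/(t^{m+1}), X)$, if $n = \infty$. Let $\alpha_x \in X_n(k)$ be the constant $n$-jet (constant arc if $n=\infty$) centered at $x$, i.e. the $k$-point of $X_n$ corresponding to the composition of the projection to $\operatorname{Spec} k$ with $x \colon \operatorname{Spec} k \to X$. For a $k$-scheme $Y$ and $y \in Y(k)$ let $\widehat{\mathcal{O}_{Y,y}} = \varprojlim_m \mathcal{O}_{Y,y}/\mathfrak{m}_y^m$ with its inverse limit topology, and let $\widehat{Y}_y = \operatorname{Spf} \widehat{\mathcal{O}_{Y,y}}$ be the formal neighborhood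 of $Y$ at $y$. It admits a smooth factor if $\widehat{Y}_y \cong \mathcal{Z} \times \operatorname{Spf} k[[z]]$ for a formal $k$-scheme $\mathcal{Z}$ (which is then affine), that is, if there are an admissible topological $k$-algebra $S$ and an isomorphism of topological $k$-algebras $\widehat{\mathcal{O}_{Y,y}} \cong S \mathbin{\widehat{\otimes}_k} k[[z]]$. If $k$ has characteristic $0$, then $\widehat{X}_x$ admits a smooth factor if and only if $\widehat{(X_n)}_{\alpha_x}$ admits a smooth factor. Moreover, over a field $k$ of any characteristic, if $\widehat{X}_x$ admits a smooth factor, then so does $\widehat{(X_n)}_{\alpha_x}$. -/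

import Mathlib

universe u

open CategoryTheory MonoidalCategory CartesianMonoidalCategory AlgebraicGeometry Opposite
open scoped TensorProduct PowerSeries

/-! ### Topological algebra -/

/-- The set of open ideals of a topological ring, ordered by inclusion. -/
abbrev OpenIdeals (S : Type u) [CommRing S] [TopologicalSpace S] : Type u :=
  {I : Ideal S // IsOpen (I : Set S)}

/-- Admissible rings: linearly topologized rings which have an ideal of definition (an open
ideal whose powers tend to zero) and are separated and complete. -/
structure IsAdmissibleRing (S : Type u) [CommRing S] [TopologicalSpace S] : Prop where
  isTopologicalRing : IsTopologicalRing S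
  isLinearTopology : IsLinearTopology S S
  exists_idealOfDefinition : ∃ I : Ideal S, IsOpen (I : Set S) ∧
    ∀ V ∈ nhds (0 : S), ∃ n : ℕ, ((I ^ n : Ideal S) : Set S) ⊆ V
  separated : T2Space S
  complete : @CompleteSpace S (IsTopologicalAddGroup.rightUniformSpace S)

section CompletedTensor

variable (k S T : Type u) [Field k] [CommRing S] [Algebra k S] [TopologicalSpace S]
  [CommRing T] [Algebra k T] [TopologicalSpace T]

/-- The completed tensor product `S ⊗̂_k T` of two linearly topologized algebras over a discrete
field `k`: the inverse limit of the algebras `S / I ⊗_k T / J`, where `I` and `J` run over the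
open ideals of `S` and `T`. -/
noncomputable def completedTensor :
    Subalgebra k (∀ p : OpenIdeals S × OpenIdeals T, (S ⧸ p.1.1) ⊗[k] (T ⧸ p.2.1)) where
  carrier := {a | ∀ (p q : OpenIdeals S × OpenIdeals T) (h : p ≤ q),
    Algebra.TensorProduct.map (Ideal.Quotient.factorₐ k (Subtype.coe_le_coe.mpr h.1))
      (Ideal.Quotient.factorₐ k (Subtype.coe_le_coe.mpr h.2)) (a p) = a q}
  mul_mem' ha hb p q h := by simp only [Pi.mul_apply, map_mul, ha p q h, hb p q h]
  add_mem' ha hb p q h := by simp only [Pi.add_apply, map_add, ha p q h, hb p q h]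
  algebraMap_mem' r p q h := by simp only [Pi.algebraMap_apply, AlgHom.commutes]

/-- The inverse limit topology on `S ⊗̂_k T`, each `S / I ⊗_k T / J` being discrete. -/
instance completedTensor.topologicalSpace : TopologicalSpace (completedTensor k S T) :=
  ⨅ p : OpenIdeals S × OpenIdeals T,
    TopologicalSpace.induced (fun a : completedTensor k S T => a.1 p) ⊥

end CompletedTensor

/-- The `(z)`-adic topology on `k⟦z⟧`, i.e. the topology of coefficientwise convergence for the
discrete topology on `k`. -/
instance powerSeriesTopology (k : Type u) [Field k] : TopologicalSpace k⟦X⟧ :=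
  letI : TopologicalSpace k := ⊥
  PowerSeries.WithPiTopology.instTopologicalSpace k

/-- For a topological `k`-algebra `R`: the affine formal `k`-scheme `Spf R` is isomorphic to a
product `Spf S × Spf k⟦z⟧` with `S` admissible. -/
def AdmitsSmoothFactor (k R : Type u) [Field k] [CommRing R] [Algebra k R]
    [TopologicalSpace R] : Prop :=
  ∃ (S : Type u) (_ : CommRing S) (_ : Algebra k S) (_ : TopologicalSpace S),
    IsAdmissibleRing S ∧ Nonempty (R ≃A[k] completedTensor k S k⟦X⟧)

/-! ### Formal neighborhoods -/

section FormalNeighborhood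

variable {k : Type u} [Field k]

/-- The local ring of a `k`-scheme is a `k`-algebra via the structure morphism. -/
noncomputable instance stalkAlgebra (X : Over (Spec (.of k))) (p : X.left) :
    Algebra k (X.left.presheaf.stalk p) :=
  (Spec.preimage (X.left.fromSpecStalk p ≫ X.hom)).hom.toAlgebra

/-- The completion of the local ring of `X` at `p` with respect to its maximal ideal. Its formal
spectrum is the formal neighborhood of `X` at `p`. -/
abbrev CompletedStalk (X : Over (Spec (.of k))) (p : X.left) : Type u :=
  AdicCompletion (IsLocalRing.maximalIdeal (X.left.presheaf.stalk p)) (X.left.presheaf.stalk p)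

/-- The inverse limit topology on the completed local ring (which is in general coarser than the
topology given by the powers of its maximal ideal). -/
noncomputable instance completedStalkTopology (X : Over (Spec (.of k))) (p : X.left) :
    TopologicalSpace (CompletedStalk X p) :=
  ⨅ m : ℕ, TopologicalSpace.induced (AdicCompletion.eval
    (IsLocalRing.maximalIdeal (X.left.presheaf.stalk p)) (X.left.presheaf.stalk p) m) ⊥

end FormalNeighborhood

/-! ### Jets and arcs -/

section Jets

attribute [local instance] CategoryTheory.Over.cartesianMonoidalCategory

/-- The truncated polynomial ring `k[t]/(t^(m+1))`. -/
abbrev TruncPoly (k : Type u) [Field k] (m : ℕ) : Type u :=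
  Polynomial k ⧸ Ideal.span {(Polynomial.X ^ (m + 1) : Polynomial k)}

variable (k : Type u) [Field k]

/-- The `k`-scheme `Spec k[t]/(t^(m+1))`. -/
noncomputable def fatPoint (m : ℕ) : Over (Spec (.of k)) :=
  Over.mk (Spec.map (CommRingCat.ofHom (algebraMap k (TruncPoly k m))))

/-- The truncation map `k[t]/(t^(m+1)) → k[t]/(t^(l+1))`, for `l ≤ m`. -/
noncomputable def truncPolyMap {l m : ℕ} (h : l ≤ m) : TruncPoly k m →ₐ[k] TruncPoly k l :=
  Ideal.Quotient.factorₐ k <| by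
    rw [Ideal.span_singleton_le_span_singleton]
    exact pow_dvd_pow _ (Nat.succ_le_succ h)

/-- The closed immersion `Spec k[t]/(t^(l+1)) → Spec k[t]/(t^(m+1))`, for `l ≤ m`. -/
noncomputable def fatPointMap {l m : ℕ} (h : l ≤ m) : fatPoint k l ⟶ fatPoint k m :=
  Over.homMk (Spec.map (CommRingCat.ofHom (truncPolyMap k h).toRingHom)) <| by
    simp only [fatPoint, Over.mk_left, Over.mk_hom, ← Spec.map_comp, ← CommRingCat.ofHom_comp]
    exact congrArg _ (congrArg _ (truncPolyMap k h).comp_algebraMap)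

variable {k}

/-- The `n`-th jet functor `Y ↦ Hom_k(Y ×_k Spec k[t]/(t^(n+1)), X)`. -/
noncomputable def jetFunctor (X : Over (Spec (.of k))) (n : ℕ) : (Over (Spec (.of k)))ᵒᵖ ⥤ Type u :=
  (tensorRight (fatPoint k n)).op ⋙ yoneda.obj X

/-- The arc functor `Y ↦ Hom_k(colim_m (Y ×_k Spec k[t]/(t^(m+1))), X)`, a morphism from the
(formal) colimit being a compatible system of morphisms. -/
noncomputable def arcFunctor (X : Over (Spec (.of k))) : (Over (Spec (.of k)))ᵒᵖ ⥤ Type u where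
  obj Y := {f : ∀ m : ℕ, Y.unop ⊗ fatPoint k m ⟶ X //
    ∀ (l m : ℕ) (h : l ≤ m), (Y.unop ◁ fatPointMap k h) ≫ f m = f l}
  map g := ↾fun f => ⟨fun m => (g.unop ▷ fatPoint k m) ≫ f.1 m, fun l m h => by
    change _ = (g.unop ▷ fatPoint k l) ≫ f.1 l
    rw [← f.2 l m h, whisker_exchange_assoc]⟩
  map_id Y := by
    ext f
    simp
  map_comp g g' := by
    ext f
    simp

/-- The functor of `n`-jets for `n : ℕ`, and of arcs for `n = ∞`. -/
noncomputable def jetArcFunctor (X : Over (Spec (.of k))) :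
    ℕ∞ → ((Over (Spec (.of k)))ᵒᵖ ⥤ Type u)
  | (n : ℕ) => jetFunctor X n
  | ⊤ => arcFunctor X

/-- The constant family of jets (resp. arcs) given by a `Y`-point `x` of `X`, i.e. the composite
of the projection `pr₁ : Y ×_k Spec k[t]/(t^(n+1)) → Y` with `x` (resp. the system of these). -/
noncomputable def constantJet {X Y : Over (Spec (.of k))} (x : Y ⟶ X) :
    ∀ n : ℕ∞, (jetArcFunctor X n).obj (op Y)
  | (n : ℕ) => (fst Y (fatPoint k n) ≫ x : Y ⊗ fatPoint k n ⟶ X)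
  | ⊤ => (⟨fun m => fst Y (fatPoint k m) ≫ x, fun l m h => by
      rw [whiskerLeft_fst_assoc]⟩ : (arcFunctor X).obj (op Y))

/-- `J` together with `h` is the `n`-th jet scheme `X_n` of `X` (the arc space if `n = ∞`) with
its universal jet: it represents the functor of `n`-jets. -/
abbrev IsJetScheme (X : Over (Spec (.of k))) (n : ℕ∞) (J : Over (Spec (.of k))) : Type (u + 1) :=
  (jetArcFunctor X n).RepresentableBy J

/-- The point of `X` underlying a `k`-rational point `Spec k ⟶ X`. -/
noncomputable def pointOf {X : Over (Spec (.of k))} (x : Over.mk (𝟙 (Spec (.of k))) ⟶ X) :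
    X.left :=
  x.left (IsLocalRing.closedPoint k)

/-- The constant `n`-jet (resp. arc) `α_x ∈ X_n(k)` centered at `x ∈ X(k)`. -/
noncomputable def IsJetScheme.constant {X J : Over (Spec (.of k))} {n : ℕ∞}
    (h : IsJetScheme X n J) (x : Over.mk (𝟙 (Spec (.of k))) ⟶ X) :
    Over.mk (𝟙 (Spec (.of k))) ⟶ J :=
  h.homEquiv.symm (constantJet x n)

end Jets

/-! The completed local ring `R` at a rational point, with the kernels `I n` of its projections, is
studied through its points: for a `k`-algebra `B` with a nilpotent ideal `𝔫`, the homomorphisms `R →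
B` that send `I 1` into `𝔫` and kill some `I M`. In this language a smooth factor is the same as an
action of the formal additive group on these points, natural in `(B, 𝔫)`, together with a coordinate
that translation by `s` increases by `s` (`SmoothAction`). Given a factor `k⟦z⟧`, translate in `z`.
Given an action, move every point along its orbit to the locus where the coordinate vanishes. By a
Yoneda argument this is a retraction `p` of `R`, and `R` is the completed tensor product of the
fixed algebra of `p` with `k⟦z⟧`: a point is recovered from its projection to the slice and its
coordinate (`SmoothAction.exists_left_inverse` for slices, `SmoothAction.admitsSmoothFactor`).
Powers of `I 1` need not agree with `I n`, since no finiteness is available on arc spaces; only `I 1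
^ n ≤ I n` is used.

The points over `(B, 𝔫)` of the formal neighborhood of the constant jet are the points of the formal
neighborhood of `x` over `B[t]/(t^(n+1))`, or `B⟦t⟧`, centered modulo the ideal of elements with
coefficients in `𝔫` (`jetCorrespondence`). Indeed, a jet reducing to the constant one modulo `𝔫` is
an infinitesimal deformation of it and factors through the local ring at `x`. An action near `x`
therefore gives one on jets: translate by `s` viewed as constant in `t`, and take the constant term
of the coordinate as the new coordinate (`SmoothAction.jets`). This proves the forward direction in
every characteristic.

Conversely, let an action on jets be given. Translate the constant jet over `R / I m` by the
generator `ε` of the dual numbers. The result is a homomorphism `a ↦ a + ε ∑ D_i(a) t^i`, and in the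
limit over `m` each `D_i` is a continuous derivation of `R`. The coordinate moves by `ε ≠ 0`, so
already over the residue field the tangent vector is nonzero and some `D_i(f)` is a unit
(`JetCorrespondence.exists_coeff_ne_zero`). A multiple `D` of `D_i` then satisfies `D f = 1`. In
characteristic zero `exp(sD)` is an action, with `f` minus its value at the origin as coordinate
(`nonempty_smoothAction_of_derivation`). Only this exponential uses the characteristic. -/

/-! ### Evaluation of power series at nilpotent elements -/

section NilpotentEvaluation

variable {A B : Type*} [CommRing A] [CommRing B] [Algebra A B]

/-- Evaluation of power series at an element `w` with `w ^ N = 0`. -/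
noncomputable def PowerSeries.aevalOfPowEqZero (w : B) (N : ℕ) (hw : w ^ N = 0) :
    A⟦X⟧ →ₐ[A] B :=
  AlgHom.ofLinearMap
    ((Polynomial.aeval w).toLinearMap ∘ₗ
      { toFun := PowerSeries.trunc N
        map_add' := fun f g => map_add _ f g
        map_smul' := fun a f => by
          ext i
          simp only [PowerSeries.coeff_trunc, Polynomial.coeff_smul, RingHom.id_apply]
          split_ifs <;> simp })
    (by
      rcases Nat.eq_zero_or_pos N with rfl | hN
      · have : Subsingleton B := subsingleton_of_zero_eq_one (by simpa using hw.symm)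
        exact Subsingleton.elim _ _
      · have : PowerSeries.trunc N (1 : A⟦X⟧) = 1 := by
          ext i
          simp only [PowerSeries.coeff_trunc, PowerSeries.coeff_one, Polynomial.coeff_one]
          grind
        simp [this])
    (by
      intro f g
      simp only [LinearMap.coe_comp, Function.comp_apply, LinearMap.coe_mk, AddHom.coe_mk,
        AlgHom.toLinearMap_apply]
      rw [← map_mul, ← sub_eq_zero, ← map_sub]
      -- Truncation is multiplicative only modulo `X ^ N`, which evaluation at `w` kills.
      obtain ⟨q, hq⟩ : (Polynomial.X ^ N : Polynomial A) ∣
          PowerSeries.trunc N (f * g) - PowerSeries.trunc N f * PowerSeries.trunc N g := by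
        rw [Polynomial.X_pow_dvd_iff]
        intro d hd
        rw [Polynomial.coeff_sub, PowerSeries.coeff_trunc, if_pos hd, PowerSeries.coeff_mul,
          Polynomial.coeff_mul, sub_eq_zero]
        refine Finset.sum_congr rfl fun x hx => ?_
        have := Finset.HasAntidiagonal.mem_antidiagonal.1 hx
        rw [PowerSeries.coeff_trunc, PowerSeries.coeff_trunc, if_pos (by omega),
          if_pos (by omega)]
      rw [hq, map_mul, map_pow, Polynomial.aeval_X, hw, zero_mul])

lemma PowerSeries.aevalOfPowEqZero_apply (w : B) (N : ℕ) (hw : w ^ N = 0) (f : A⟦X⟧) :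
    PowerSeries.aevalOfPowEqZero w N hw f =
      ∑ i ∈ Finset.range N, algebraMap A B (PowerSeries.coeff i f) * w ^ i := by
  change Polynomial.aeval w (PowerSeries.trunc N f) = _
  rw [Polynomial.aeval_def, PowerSeries.eval₂_trunc_eq_sum_range]

lemma PowerSeries.aevalOfPowEqZero_X (w : B) (N : ℕ) (hw : w ^ N = 0) :
    PowerSeries.aevalOfPowEqZero w N hw (PowerSeries.X : A⟦X⟧) = w := by
  rw [PowerSeries.aevalOfPowEqZero_apply]
  rcases lt_or_ge 1 N with hN | hN
  · rw [Finset.sum_eq_single_of_mem 1 (Finset.mem_range.2 hN)]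
    · simp
    · intro i _ hi
      simp [PowerSeries.coeff_X, hi]
  · have : w = 0 := by simpa using pow_eq_zero_of_le hN hw
    interval_cases N <;> simp [this]

lemma PowerSeries.aevalOfPowEqZero_eq_zero (w : B) (N : ℕ) (hw : w ^ N = 0) (f : A⟦X⟧)
    (hf : f ∈ Ideal.span {(PowerSeries.X : A⟦X⟧) ^ N}) :
    PowerSeries.aevalOfPowEqZero w N hw f = 0 := by
  obtain ⟨g, rfl⟩ := Ideal.mem_span_singleton'.1 hf
  rw [map_mul, map_pow, PowerSeries.aevalOfPowEqZero_X, hw, mul_zero]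

end NilpotentEvaluation

/-! ### Completed tensor products with `k⟦X⟧` -/

/-- Membership is the vanishing of finitely many coefficients, each an open condition because `k` is
discrete. -/
lemma isOpen_span_X_pow (k : Type u) [Field k] (N : ℕ) :
    IsOpen ((Ideal.span {(PowerSeries.X : k⟦X⟧) ^ N} : Ideal k⟦X⟧) : Set k⟦X⟧) := by
  let _ : TopologicalSpace k := ⊥
  have : DiscreteTopology k := ⟨rfl⟩
  have : ((Ideal.span {(PowerSeries.X : k⟦X⟧) ^ N} : Ideal k⟦X⟧) : Set k⟦X⟧) =
      ⋂ i ∈ Set.Iio N, (PowerSeries.coeff (R := k) i) ⁻¹' {0} := by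
    ext f
    simp [Ideal.mem_span_singleton, PowerSeries.X_pow_dvd_iff]
  rw [this]
  refine (Set.finite_Iio N).isOpen_biInter fun i _ => ?_
  exact (isOpen_discrete _).preimage (PowerSeries.WithPiTopology.continuous_coeff (R := k) i)

lemma exists_X_pow_mem (k : Type u) [Field k] (J : OpenIdeals k⟦X⟧) :
    ∃ N : ℕ, (PowerSeries.X : k⟦X⟧) ^ N ∈ J.1 := by
  let _ : TopologicalSpace k := ⊥
  have : DiscreteTopology k := ⟨rfl⟩
  have h := PowerSeries.WithPiTopology.isTopologicallyNilpotent_of_constantCoeff_zero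
    (R := k) (f := PowerSeries.X) PowerSeries.constantCoeff_X
  have h' := h.eventually (J.2.mem_nhds (zero_mem J.1))
  exact h'.exists

namespace completedTensor

variable (k S : Type u) [Field k] [CommRing S] [Algebra k S] [TopologicalSpace S]

/-- The projection of `S ⊗̂ k⟦X⟧` to `S / I ⊗ k⟦X⟧ / J`. -/
noncomputable def proj (p : OpenIdeals S × OpenIdeals k⟦X⟧) :
    completedTensor k S k⟦X⟧ →ₐ[k] (S ⧸ p.1.1) ⊗[k] (k⟦X⟧ ⧸ p.2.1) :=
  (Pi.evalAlgHom k (fun p : OpenIdeals S × OpenIdeals k⟦X⟧ =>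
    (S ⧸ p.1.1) ⊗[k] (k⟦X⟧ ⧸ p.2.1)) p).comp (completedTensor k S k⟦X⟧).val

/-- The canonical map `S → S ⊗̂ k⟦X⟧`. -/
noncomputable def inl : S →ₐ[k] completedTensor k S k⟦X⟧ :=
  AlgHom.codRestrict (AlgHom.pi fun p : OpenIdeals S × OpenIdeals k⟦X⟧ =>
    (Algebra.TensorProduct.includeLeft (R := k) (S := k) (A := S ⧸ p.1.1)
      (B := k⟦X⟧ ⧸ p.2.1)).comp (Ideal.Quotient.mkₐ k p.1.1)) _ (by
        intro s p q h
        simp)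

/-- The canonical map `k⟦X⟧ → S ⊗̂ k⟦X⟧`. -/
noncomputable def inr : k⟦X⟧ →ₐ[k] completedTensor k S k⟦X⟧ :=
  AlgHom.codRestrict (AlgHom.pi fun p : OpenIdeals S × OpenIdeals k⟦X⟧ =>
    (Algebra.TensorProduct.includeRight (R := k) (A := S ⧸ p.1.1)
      (B := k⟦X⟧ ⧸ p.2.1)).comp (Ideal.Quotient.mkₐ k p.2.1)) _ (by
        intro s p q h
        simp)

variable {k S}

@[simp]
lemma proj_inl (p : OpenIdeals S × OpenIdeals k⟦X⟧) (s : S) :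
    proj k S p (inl k S s) = Ideal.Quotient.mk _ s ⊗ₜ 1 := rfl

@[simp]
lemma proj_inr (p : OpenIdeals S × OpenIdeals k⟦X⟧) (f : k⟦X⟧) :
    proj k S p (inr k S f) = 1 ⊗ₜ Ideal.Quotient.mk _ f := rfl

lemma map_factor_proj {p q : OpenIdeals S × OpenIdeals k⟦X⟧} (h : p ≤ q)
    (a : completedTensor k S k⟦X⟧) :
    Algebra.TensorProduct.map (Ideal.Quotient.factorₐ k (Subtype.coe_le_coe.mpr h.1))
      (Ideal.Quotient.factorₐ k (Subtype.coe_le_coe.mpr h.2)) (proj k S p a) = proj k S q a :=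
  a.2 p q h

lemma proj_eq_zero_of_le {p q : OpenIdeals S × OpenIdeals k⟦X⟧} (h : p ≤ q)
    {a : completedTensor k S k⟦X⟧} (ha : proj k S p a = 0) : proj k S q a = 0 := by
  rw [← map_factor_proj h, ha, map_zero]

lemma ext_proj {a b : completedTensor k S k⟦X⟧} (h : ∀ p, proj k S p a = proj k S p b) : a = b :=
  Subtype.ext (funext h)

lemma nhds_zero : nhds (0 : completedTensor k S k⟦X⟧) =
    ⨅ p, Filter.principal {a | proj k S p a = 0} := by
  rw [nhds_iInf]
  refine iInf_congr fun p => ?_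
  rw [@nhds_induced _ _ ⊥, @nhds_discrete _ ⊥ (@DiscreteTopology.mk _ ⊥ rfl),
    ← Filter.principal_singleton, Filter.comap_principal]
  rfl

omit [Algebra k S] in
lemma exists_le_le (p q : OpenIdeals S × OpenIdeals k⟦X⟧) : ∃ r, r ≤ p ∧ r ≤ q :=
  ⟨(⟨p.1.1 ⊓ q.1.1, p.1.2.inter q.1.2⟩, ⟨p.2.1 ⊓ q.2.1, p.2.2.inter q.2.2⟩),
    ⟨fun _ h => h.1, fun _ h => h.1⟩, ⟨fun _ h => h.2, fun _ h => h.2⟩⟩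

/-- Pairs of open ideals can be intersected, so the kernels of the projections are directed and a
single one suffices. -/
lemma mem_nhds_zero (U : Set (completedTensor k S k⟦X⟧)) :
    U ∈ nhds 0 ↔ ∃ p, ∀ a, proj k S p a = 0 → a ∈ U := by
  have : Nonempty (OpenIdeals S × OpenIdeals k⟦X⟧) :=
    ⟨(⟨⊤, isOpen_univ⟩, ⟨⊤, isOpen_univ⟩)⟩
  rw [nhds_zero, Filter.mem_iInf_of_directed]
  · simp only [Filter.mem_principal]; rfl
  · intro p q
    obtain ⟨r, hp, hq⟩ := exists_le_le p q
    refine ⟨r, ?_, ?_⟩ <;> simp only [ge_iff_le, Filter.le_principal_iff, Filter.mem_principal]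
    exacts [fun a => proj_eq_zero_of_le hp, fun a => proj_eq_zero_of_le hq]

lemma _root_.Polynomial.coe_eq_aeval_X {k : Type*} [CommRing k] (P : Polynomial k) :
    (P : k⟦X⟧) = Polynomial.aeval (PowerSeries.X : k⟦X⟧) P := by
  induction P using Polynomial.induction_on' with
  | add p q hp hq => rw [Polynomial.coe_add, hp, hq, map_add]
  | monomial n a =>
    rw [Polynomial.coe_monomial, Polynomial.aeval_monomial, PowerSeries.X_pow_eq,
      ← Algebra.smul_def, ← map_smul, smul_eq_mul, mul_one]

/-- The subalgebra generated by `S` and `X` is dense. -/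
lemma exists_mem_adjoin_proj_eq (p : OpenIdeals S × OpenIdeals k⟦X⟧)
    (a : (S ⧸ p.1.1) ⊗[k] (k⟦X⟧ ⧸ p.2.1)) :
    ∃ b ∈ Algebra.adjoin k (Set.range (inl k S) ∪ {inr k S PowerSeries.X}), proj k S p b = a := by
  induction a using TensorProduct.induction_on with
  | zero => exact ⟨0, zero_mem _, map_zero _⟩
  | add a a' h h' =>
    obtain ⟨b, hb, rfl⟩ := h
    obtain ⟨b', hb', rfl⟩ := h'
    exact ⟨b + b', add_mem hb hb', map_add _ _ _⟩
  | tmul s f =>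
    obtain ⟨s, rfl⟩ := Ideal.Quotient.mk_surjective s
    obtain ⟨f, rfl⟩ := Ideal.Quotient.mk_surjective f
    obtain ⟨N, hN⟩ := exists_X_pow_mem k p.2
    -- The open ideal contains `X ^ N`, so modulo it a series may be replaced by a polynomial in
    -- `X`.
    have hf : Ideal.Quotient.mk p.2.1 f =
        Ideal.Quotient.mk p.2.1 (PowerSeries.trunc N f : k⟦X⟧) := by
      rw [Ideal.Quotient.eq]
      refine Ideal.mem_of_dvd _ ?_ hN
      rw [PowerSeries.X_pow_dvd_iff]
      intro m hm
      rw [map_sub, Polynomial.coeff_coe, PowerSeries.coeff_trunc, if_pos hm, sub_self]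
    refine ⟨inl k S s * inr k S (PowerSeries.trunc N f : k⟦X⟧), mul_mem ?_ ?_, ?_⟩
    · exact Algebra.subset_adjoin (Or.inl ⟨s, rfl⟩)
    · have : inr k S (PowerSeries.trunc N f : k⟦X⟧) =
          Polynomial.aeval (inr k S PowerSeries.X) (PowerSeries.trunc N f) := by
        rw [Polynomial.aeval_algHom_apply]
        rw [Polynomial.coe_eq_aeval_X]
      rw [this]
      refine Algebra.adjoin_mono (Set.subset_union_right) ?_
      exact Polynomial.aeval_mem_adjoin_singleton _ _
    · rw [map_mul, proj_inl, proj_inr, hf, Algebra.TensorProduct.tmul_mul_tmul, mul_one, one_mul]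

variable {B : Type*} [CommRing B] [Algebra k B]

/-- Continuous homomorphisms from `S ⊗̂ k⟦X⟧` to a discrete algebra are determined by their
restriction to `S` and their value at `X`. -/
lemma algHom_ext_of_factor {f g : completedTensor k S k⟦X⟧ →ₐ[k] B}
    {p q : OpenIdeals S × OpenIdeals k⟦X⟧} (hf : ∀ a, proj k S p a = 0 → f a = 0)
    (hg : ∀ a, proj k S q a = 0 → g a = 0) (hS : ∀ s, f (inl k S s) = g (inl k S s))
    (hX : f (inr k S PowerSeries.X) = g (inr k S PowerSeries.X)) : f = g := by
  ext a
  obtain ⟨r, hp, hq⟩ := exists_le_le p q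
  -- At a level `r` through which both maps factor, `a` is indistinguishable from an element of the
  -- dense subalgebra.
  obtain ⟨b, hb, hab⟩ := exists_mem_adjoin_proj_eq r (proj k S r a)
  have hz : proj k S r (a - b) = 0 := by rw [map_sub (proj k S r) a b, hab, sub_self]
  have h1 : f (a - b) = 0 := hf _ (proj_eq_zero_of_le hp hz)
  have h2 : g (a - b) = 0 := hg _ (proj_eq_zero_of_le hq hz)
  have h3 : f b = g b := by
    have : Algebra.adjoin k (Set.range (inl k S) ∪ {inr k S PowerSeries.X}) ≤
        AlgHom.equalizer f g := by
      rw [Algebra.adjoin_le_iff]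
      rintro _ (⟨s, rfl⟩ | rfl)
      exacts [hS s, hX]
    exact this hb
  rw [map_sub f a b, sub_eq_zero] at h1
  rw [map_sub g a b, sub_eq_zero] at h2
  rw [h1, h2, h3]

/-- Continuous homomorphisms from `S ⊗̂ k⟦X⟧` to a discrete algebra are given by a continuous
homomorphism on `S` and a nilpotent element. -/
lemma exists_lift (y : S →ₐ[k] B) (I : OpenIdeals S) (hy : ∀ s ∈ I.1, y s = 0) (w : B) (N : ℕ)
    (hw : w ^ N = 0) :
    ∃ g : (S ⧸ I.1) ⊗[k] (k⟦X⟧ ⧸ Ideal.span {(PowerSeries.X : k⟦X⟧) ^ N}) →ₐ[k] B,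
      (∀ s, g (Ideal.Quotient.mk _ s ⊗ₜ 1) = y s) ∧
      g (1 ⊗ₜ Ideal.Quotient.mk _ PowerSeries.X) = w := by
  refine ⟨Algebra.TensorProduct.lift (Ideal.Quotient.liftₐ I.1 y hy)
    (Ideal.Quotient.liftₐ _ (PowerSeries.aevalOfPowEqZero w N hw)
      (PowerSeries.aevalOfPowEqZero_eq_zero w N hw)) fun _ _ => Commute.all _ _, fun s => ?_, ?_⟩
  · rw [Algebra.TensorProduct.lift_tmul, map_one, mul_one]
    rfl
  · rw [Algebra.TensorProduct.lift_tmul, map_one, one_mul]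
    exact PowerSeries.aevalOfPowEqZero_X w N hw

end completedTensor

/-! ### Filtered algebras, their points, and smooth actions -/

section Points

/-- A separated and complete decreasing filtration of an augmented `k`-algebra, whose terms
contain the powers of the augmentation ideal `I 1`. -/
structure IsCompleteFiltration (k : Type*) [Field k] {R : Type*} [CommRing R] [Algebra k R]
    (I : ℕ → Ideal R) : Prop where
  antitone : Antitone I
  pow_le : ∀ n, I 1 ^ n ≤ I n
  separated : ∀ a, (∀ n, a ∈ I n) → a = 0
  complete : ∀ a : ℕ → R, (∀ n, a (n + 1) - a n ∈ I n) → ∃ b, ∀ n, b - a n ∈ I n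
  exists_const : ∀ a, ∃ c : k, a - algebraMap k R c ∈ I 1
  one_notMem : 1 ∉ I 1

variable {k : Type*} [Field k] {R : Type*} [CommRing R] [Algebra k R]

/-- The points of the formal spectrum of a filtered algebra with values in a `k`-algebra `B`,
which are centered at the origin modulo the ideal `𝔫`. -/
@[ext]
structure FormalPoint (k : Type*) [Field k] {R : Type*} [CommRing R] [Algebra k R]
    (I : ℕ → Ideal R) {B : Type*} [CommRing B] [Algebra k B] (𝔫 : Ideal B) where
  /-- The underlying homomorphism. -/
  hom : R →ₐ[k] B
  map_mem : ∀ a ∈ I 1, hom a ∈ 𝔫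
  exists_eq_zero : ∃ M, ∀ a ∈ I M, hom a = 0

variable {I : ℕ → Ideal R}

/-- Functoriality of formal points. -/
@[simps]
def FormalPoint.map {B B' : Type*} [CommRing B] [Algebra k B] [CommRing B'] [Algebra k B']
    {𝔫 : Ideal B} {𝔫' : Ideal B'} (x : FormalPoint k I 𝔫) (φ : B →ₐ[k] B')
    (hφ : ∀ b ∈ 𝔫, φ b ∈ 𝔫') : FormalPoint k I 𝔫' where
  hom := φ.comp x.hom
  map_mem a ha := hφ _ (x.map_mem a ha)
  exists_eq_zero := by
    obtain ⟨M, hM⟩ := x.exists_eq_zero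
    exact ⟨M, fun a ha => by rw [AlgHom.comp_apply, hM a ha, map_zero]⟩

/-- The tautological point with values in `R / I n`. -/
@[simps]
def FormalPoint.taut (k : Type*) [Field k] {R : Type*} [CommRing R] [Algebra k R]
    (I : ℕ → Ideal R) (n : ℕ) :
    FormalPoint k I ((I 1).map (Ideal.Quotient.mk (I n))) where
  hom := Ideal.Quotient.mkₐ k (I n)
  map_mem _ ha := Ideal.mem_map_of_mem _ ha
  exists_eq_zero := ⟨n, fun _ ha => Ideal.Quotient.eq_zero_iff_mem.2 ha⟩

/-- This makes `R / I n` with the image of `I 1` an allowed test pair, so that an action can be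
evaluated at the tautological points. -/
lemma IsCompleteFiltration.isNilpotent_map (hI : IsCompleteFiltration k I) (n : ℕ) :
    IsNilpotent ((I 1).map (Ideal.Quotient.mk (I n))) := by
  refine ⟨n, ?_⟩
  rw [← Ideal.map_pow, Ideal.zero_eq_bot, Ideal.map_eq_bot_iff_le_ker, Ideal.mk_ker]
  exact hI.pow_le n

/-- Every formal point is induced by a tautological one. -/
lemma FormalPoint.exists_eq_map_taut {B : Type*} [CommRing B] [Algebra k B] {𝔫 : Ideal B}
    (x : FormalPoint k I 𝔫) : ∃ (n : ℕ) (φ : R ⧸ I n →ₐ[k] B)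
      (hφ : ∀ b ∈ (I 1).map (Ideal.Quotient.mk (I n)), φ b ∈ 𝔫),
      x = (FormalPoint.taut k I n).map φ hφ := by
  obtain ⟨n, hn⟩ := x.exists_eq_zero
  refine ⟨n, Ideal.Quotient.liftₐ (I n) x.hom hn, fun b hb => ?_, ?_⟩
  · refine (Ideal.map_le_iff_le_comap (K := 𝔫.comap
      (Ideal.Quotient.liftₐ (I n) x.hom hn).toRingHom)).2 ?_ hb
    intro a ha
    exact x.map_mem a ha
  · ext a
    rfl

/-- A free action of the formal additive group on the formal spectrum of a filtered algebra,
together with an equivariant coordinate function. -/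
structure SmoothAction (k : Type u) [Field k] {R : Type u} [CommRing R] [Algebra k R]
    (I : ℕ → Ideal R) where
  /-- The action. -/
  act : ∀ {B : Type u} [CommRing B] [Algebra k B] {𝔫 : Ideal B}, IsNilpotent 𝔫 →
    FormalPoint k I 𝔫 → 𝔫 → FormalPoint k I 𝔫
  /-- The coordinate. -/
  coord : ∀ {B : Type u} [CommRing B] [Algebra k B] {𝔫 : Ideal B}, IsNilpotent 𝔫 →
    FormalPoint k I 𝔫 → 𝔫
  act_map : ∀ {B : Type u} [CommRing B] [Algebra k B] {𝔫 : Ideal B} (h : IsNilpotent 𝔫)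
    {B' : Type u} [CommRing B'] [Algebra k B'] {𝔫' : Ideal B'} (h' : IsNilpotent 𝔫')
    (φ : B →ₐ[k] B') (hφ : ∀ b ∈ 𝔫, φ b ∈ 𝔫') (x : FormalPoint k I 𝔫) (s : 𝔫),
    (act h x s).map φ hφ = act h' (x.map φ hφ) ⟨φ s, hφ s s.2⟩
  coord_map : ∀ {B : Type u} [CommRing B] [Algebra k B] {𝔫 : Ideal B} (h : IsNilpotent 𝔫)
    {B' : Type u} [CommRing B'] [Algebra k B'] {𝔫' : Ideal B'} (h' : IsNilpotent 𝔫')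
    (φ : B →ₐ[k] B') (hφ : ∀ b ∈ 𝔫, φ b ∈ 𝔫') (x : FormalPoint k I 𝔫),
    (coord h' (x.map φ hφ) : B') = φ (coord h x)
  act_zero : ∀ {B : Type u} [CommRing B] [Algebra k B] {𝔫 : Ideal B} (h : IsNilpotent 𝔫)
    (x : FormalPoint k I 𝔫), act h x 0 = x
  act_add : ∀ {B : Type u} [CommRing B] [Algebra k B] {𝔫 : Ideal B} (h : IsNilpotent 𝔫)
    (x : FormalPoint k I 𝔫) (s s' : 𝔫), act h (act h x s) s' = act h x (s + s')
  coord_act : ∀ {B : Type u} [CommRing B] [Algebra k B] {𝔫 : Ideal B} (h : IsNilpotent 𝔫)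
    (x : FormalPoint k I 𝔫) (s : 𝔫), coord h (act h x s) = coord h x + s

end Points

/-! ### The smooth action attached to a smooth factor -/

section OfSmoothFactor

variable {k R : Type u} [Field k] [CommRing R] [Algebra k R] {I : ℕ → Ideal R}
  [TopologicalSpace R] {S : Type u} [CommRing S] [Algebra k S] [TopologicalSpace S]

open completedTensor

lemma exists_proj_eq_zero (hb : (nhds (0 : R)).HasBasis (fun _ => True) fun n => (I n : Set R))
    (e : R ≃A[k] completedTensor k S k⟦X⟧) (M : ℕ) :
    ∃ p, ∀ a, proj k S p a = 0 → e.symm a ∈ I M := by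
  have h : e.symm ⁻¹' (I M : Set R) ∈ nhds (0 : completedTensor k S k⟦X⟧) := by
    refine e.symm.continuous.continuousAt.preimage_mem_nhds ?_
    rw [map_zero]
    exact hb.mem_of_mem trivial
  exact (mem_nhds_zero _).1 h

lemma exists_mem_proj_eq_zero
    (hb : (nhds (0 : R)).HasBasis (fun _ => True) fun n => (I n : Set R))
    (e : R ≃A[k] completedTensor k S k⟦X⟧) (p : OpenIdeals S × OpenIdeals k⟦X⟧) :
    ∃ M, ∀ a ∈ I M, proj k S p (e a) = 0 := by
  have h : e ⁻¹' {a | proj k S p a = 0} ∈ nhds (0 : R) := by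
    refine e.continuous.continuousAt.preimage_mem_nhds ?_
    rw [map_zero, mem_nhds_zero]
    exact ⟨p, fun a ha => ha⟩
  obtain ⟨M, -, hM⟩ := hb.mem_iff.1 h
  exact ⟨M, fun a ha => hM ha⟩

/-- Some power of the element lies in `I 1` because `X` is topologically nilpotent. Its residue in
the field `k` is then nilpotent, hence zero. -/
lemma symm_inr_X_mem (hI : IsCompleteFiltration k I)
    (hb : (nhds (0 : R)).HasBasis (fun _ => True) fun n => (I n : Set R))
    (e : R ≃A[k] completedTensor k S k⟦X⟧) : e.symm (inr k S PowerSeries.X) ∈ I 1 := by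
  obtain ⟨p, hp⟩ := exists_proj_eq_zero hb e 1
  obtain ⟨N, hN⟩ := exists_X_pow_mem k p.2
  have h1 : e.symm (inr k S PowerSeries.X) ^ N ∈ I 1 := by
    rw [← map_pow, ← map_pow]
    refine hp _ ?_
    rw [proj_inr, Ideal.Quotient.eq_zero_iff_mem.2 hN, TensorProduct.tmul_zero]
  obtain ⟨c, hc⟩ := hI.exists_const (e.symm (inr k S PowerSeries.X))
  have h2 : algebraMap k R c ^ N ∈ I 1 := by
    have := Ideal.mem_of_dvd _ (sub_dvd_pow_sub_pow (e.symm (inr k S PowerSeries.X))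
      (algebraMap k R c) N) hc
    simpa using sub_mem h1 this
  have h3 : c = 0 := by
    by_contra hc0
    refine hI.one_notMem ?_
    have := (I 1).mul_mem_left (algebraMap k R (c ^ N)⁻¹) h2
    rwa [← map_pow, ← map_mul, inv_mul_cancel₀ (pow_ne_zero _ hc0), map_one] at this
  simpa [h3] using hc

/-- A formal point kills some `I M`, so it is a continuous map to a discrete algebra, and density of
the subalgebra generated by `S` and `X` applies. -/
lemma FormalPoint.ext_of_equiv
    (hb : (nhds (0 : R)).HasBasis (fun _ => True) fun n => (I n : Set R))
    (e : R ≃A[k] completedTensor k S k⟦X⟧) {B : Type*} [CommRing B] [Algebra k B]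
    {𝔫 𝔫' : Ideal B} (x : FormalPoint k I 𝔫) (x' : FormalPoint k I 𝔫')
    (hS : ∀ s, x.hom (e.symm (inl k S s)) = x'.hom (e.symm (inl k S s)))
    (hX : x.hom (e.symm (inr k S PowerSeries.X)) = x'.hom (e.symm (inr k S PowerSeries.X))) :
    x.hom = x'.hom := by
  obtain ⟨M, hM⟩ := x.exists_eq_zero
  obtain ⟨M', hM'⟩ := x'.exists_eq_zero
  obtain ⟨p, hp⟩ := exists_proj_eq_zero hb e M
  obtain ⟨p', hp'⟩ := exists_proj_eq_zero hb e M'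
  have := algHom_ext_of_factor (f := x.hom.comp e.symm.toAlgEquiv.toAlgHom)
    (g := x'.hom.comp e.symm.toAlgEquiv.toAlgHom)
    (fun a ha => hM _ (hp a ha)) (fun a ha => hM' _ (hp' a ha)) hS hX
  ext a
  have h : x.hom (e.symm (e a)) = x'.hom (e.symm (e a)) := DFunLike.congr_fun this (e a)
  rwa [e.symm_apply_apply] at h

/-- The value at `X` can be prescribed freely among nilpotent elements. Both the old value and `s`
lie in the nilpotent ideal `𝔫`, so their sum is allowed. -/
lemma FormalPoint.exists_translate (hI : IsCompleteFiltration k I)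
    (hb : (nhds (0 : R)).HasBasis (fun _ => True) fun n => (I n : Set R))
    (e : R ≃A[k] completedTensor k S k⟦X⟧) {B : Type*} [CommRing B] [Algebra k B]
    {𝔫 : Ideal B} (h𝔫 : IsNilpotent 𝔫) (x : FormalPoint k I 𝔫) (s : 𝔫) :
    ∃ x' : FormalPoint k I 𝔫,
      (∀ s, x'.hom (e.symm (inl k S s)) = x.hom (e.symm (inl k S s))) ∧
      x'.hom (e.symm (inr k S PowerSeries.X)) =
        x.hom (e.symm (inr k S PowerSeries.X)) + s := by
  obtain ⟨M, hM⟩ := x.exists_eq_zero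
  obtain ⟨p, hp⟩ := exists_proj_eq_zero hb e M
  obtain ⟨N, hN⟩ := h𝔫
  have hw : (x.hom (e.symm (inr k S PowerSeries.X)) + s) ^ N = 0 := by
    have := Ideal.pow_mem_pow
      (add_mem (x.map_mem _ (symm_inr_X_mem hI hb e)) s.2) N
    rwa [hN] at this
  obtain ⟨g, hg, hgX⟩ := exists_lift
    ((x.hom.comp e.symm.toAlgEquiv.toAlgHom).comp (inl k S)) p.1
    (fun s hs => hM _ (hp _ (by
      refine (proj_inl p s).trans ?_
      rw [Ideal.Quotient.eq_zero_iff_mem.2 hs, TensorProduct.zero_tmul]))) _ N hw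
  -- The ideal of `S` is kept. That of `k⟦X⟧` is replaced by one adapted to the nilpotency of the
  -- new value.
  let q : OpenIdeals S × OpenIdeals k⟦X⟧ := (p.1, ⟨_, isOpen_span_X_pow k N⟩)
  let f : R →ₐ[k] B := (g.comp (proj k S q)).comp e.toAlgEquiv.toAlgHom
  obtain ⟨M', hM'⟩ := exists_mem_proj_eq_zero hb e q
  have hf : ∀ a ∈ I M', f a = 0 := fun a ha => by
    change g (proj k S q (e a)) = 0
    rw [hM' a ha, map_zero]
  have hfS : ∀ s, f (e.symm (inl k S s)) = x.hom (e.symm (inl k S s)) := fun s => by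
    change g (proj k S q (e _)) = _
    rw [e.apply_symm_apply]
    exact hg s
  have hfX : f (e.symm (inr k S PowerSeries.X)) =
      x.hom (e.symm (inr k S PowerSeries.X)) + s := by
    change g (proj k S q (e _)) = _
    rw [e.apply_symm_apply]
    exact hgX
  refine ⟨⟨f, fun a ha => ?_, M', hf⟩, hfS, hfX⟩
  -- Centering is checked modulo `𝔫`, where `s` vanishes and the two points agree on `S` and `X`.
  -- The ideal `⊤` imposes no condition, so `f` counts as a point before its centering is known.
  let f' : FormalPoint k I (⊤ : Ideal B) := ⟨f, fun _ _ => trivial, M', hf⟩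
  have h := FormalPoint.ext_of_equiv hb e (f'.map (𝔫' := ⊤) (Ideal.Quotient.mkₐ k 𝔫)
      fun _ _ => trivial)
    (x.map (𝔫' := ⊤) (Ideal.Quotient.mkₐ k 𝔫) fun _ _ => trivial)
    (fun s => congrArg (Ideal.Quotient.mk 𝔫) (hfS s)) (by
      refine (congrArg (Ideal.Quotient.mk 𝔫) hfX).trans ?_
      rw [map_add, Ideal.Quotient.eq_zero_iff_mem.2 s.2, add_zero]
      rfl)
  have h2 : Ideal.Quotient.mk 𝔫 (f a) = Ideal.Quotient.mk 𝔫 (x.hom a) := DFunLike.congr_fun h a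
  rw [Ideal.Quotient.eq_zero_iff_mem.2 (x.map_mem a ha), Ideal.Quotient.eq_zero_iff_mem] at h2
  exact h2

/-- The action by translations in the smooth factor. -/
theorem nonempty_smoothAction_of_admitsSmoothFactor (hI : IsCompleteFiltration k I)
    (hb : (nhds (0 : R)).HasBasis (fun _ => True) fun n => (I n : Set R))
    (h : AdmitsSmoothFactor k R) : Nonempty (SmoothAction k I) := by
  obtain ⟨S, _, _, _, -, ⟨e⟩⟩ := h
  -- Translates are unique by `FormalPoint.ext_of_equiv`, so each axiom is a comparison of values on
  -- `S` and at `X`.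
  refine ⟨{
    act := fun h x s => (x.exists_translate hI hb e h s).choose
    coord := fun h x => ⟨_, x.map_mem _ (symm_inr_X_mem hI hb e)⟩
    act_map := ?_
    coord_map := fun _ _ _ _ _ _ _ _ _ => rfl
    act_zero := ?_
    act_add := ?_
    coord_act := ?_ }⟩
  · intro B _ _ 𝔫 h B' _ _ 𝔫' h' φ hφ x s
    have h1 := (x.exists_translate hI hb e h s).choose_spec
    have h2 := ((x.map φ hφ).exists_translate hI hb e h' ⟨φ s, hφ s s.2⟩).choose_spec
    refine FormalPoint.ext (FormalPoint.ext_of_equiv hb e _ _ (fun t => ?_) ?_)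
    · rw [h2.1, FormalPoint.map_hom, AlgHom.comp_apply, h1.1]
      rfl
    · rw [h2.2, FormalPoint.map_hom, AlgHom.comp_apply, h1.2, map_add]
      rfl
  · intro B _ _ 𝔫 h x
    have h1 := (x.exists_translate hI hb e h 0).choose_spec
    refine FormalPoint.ext (FormalPoint.ext_of_equiv hb e _ _ h1.1 ?_)
    rw [h1.2, ZeroMemClass.coe_zero, add_zero]
  · intro B _ _ 𝔫 h x s s'
    have h1 := (x.exists_translate hI hb e h s).choose_spec
    have h2 := ((x.exists_translate hI hb e h s).choose.exists_translate hI hb e h s').choose_spec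
    have h3 := (x.exists_translate hI hb e h (s + s')).choose_spec
    refine FormalPoint.ext (FormalPoint.ext_of_equiv hb e _ _ (fun t => ?_) ?_)
    · rw [h2.1, h1.1, h3.1]
    · rw [h2.2, h1.2, h3.2, add_assoc]
      rfl
  · intro B _ _ 𝔫 h x s
    exact Subtype.ext (x.exists_translate hI hb e h s).choose_spec.2

end OfSmoothFactor

/-! ### The smooth factor attached to a smooth action -/

section FilteredRings

lemma Ideal.isOpen_of_mem_nhds_zero {T : Type*} [CommRing T] [TopologicalSpace T]
    [IsTopologicalRing T]
    (J : Ideal T) (hJ : (J : Set T) ∈ nhds 0) : IsOpen (J : Set T) :=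
  J.toAddSubgroup.isOpen_of_mem_nhds hJ

/-- A topological ring is complete if its topology is given by a filtration by ideals for which
compatible sequences have limits. -/
lemma completeSpace_of_filtration {T : Type*} [CommRing T] [TopologicalSpace T]
    [IsTopologicalRing T] (J : ℕ → Ideal T)
    (hb : (nhds (0 : T)).HasBasis (fun _ => True) fun n => (J n : Set T))
    (hJ : ∀ a : ℕ → T, (∀ n, a (n + 1) - a n ∈ J n) → ∃ b, ∀ n, b - a n ∈ J n) :
    @CompleteSpace T (IsTopologicalAddGroup.rightUniformSpace T) := by
  let _ := IsTopologicalAddGroup.rightUniformSpace T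
  have hU : (uniformity T).HasBasis (fun _ => True)
      fun n => {x : T × T | x.2 + -x.1 ∈ J n} := hb.comap fun x : T × T => x.2 + -x.1
  have : (uniformity T).IsCountablyGenerated := hU.isCountablyGenerated
  refine UniformSpace.complete_of_cauchySeq_tendsto fun u hu => ?_
  have h1 : ∀ n, ∃ N, ∀ i ≥ N, ∀ j ≥ N, u j - u i ∈ J n := fun n => by
    obtain ⟨N, hN⟩ := hU.cauchySeq_iff.1 hu n trivial
    exact ⟨N, fun i hi j hj => by simpa [sub_eq_add_neg] using hN i hi j hj⟩
  choose N hN using h1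
  -- Partial sums dominate `N` and are monotone, so `u (M n)` and `u (M (n + 1))` both lie beyond
  -- the index `N n`.
  let M : ℕ → ℕ := fun n => ∑ i ∈ Finset.range (n + 1), N i
  have hM : ∀ n, N n ≤ M n := fun n =>
    Finset.single_le_sum (f := N) (fun _ _ => Nat.zero_le _) (Finset.self_mem_range_succ n)
  have hM' : ∀ n, M n ≤ M (n + 1) := fun n => by
    change _ ≤ ∑ i ∈ Finset.range (n + 1 + 1), N i
    rw [Finset.sum_range_succ]
    exact Nat.le_add_right _ _
  obtain ⟨b, hb'⟩ := hJ (fun n => u (M n)) fun n =>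
    hN n _ (hM n) _ ((hM n).trans (hM' n))
  refine ⟨b, ?_⟩
  have h2 : Filter.Tendsto (fun i => u i - b) Filter.atTop (nhds 0) := by
    refine hb.tendsto_right_iff.2 fun n _ => ?_
    filter_upwards [Filter.eventually_ge_atTop (M n)] with i hi
    have := sub_mem (hN n (M n) (hM n) i ((hM n).trans hi)) (hb' n)
    simpa using this
  simpa using h2.add_const b

variable {k : Type*} [Field k] {R : Type*} [CommRing R] [Algebra k R] {I : ℕ → Ideal R}

/-- The transition maps of the inverse system of quotients. -/
abbrev IsCompleteFiltration.transition (hI : IsCompleteFiltration k I) (n : ℕ) :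
    R ⧸ I (n + 1) →ₐ[k] R ⧸ I n :=
  Ideal.Quotient.factorₐ k (hI.antitone n.le_succ)

lemma IsCompleteFiltration.transition_mem (hI : IsCompleteFiltration k I) (n : ℕ) :
    ∀ b ∈ (I 1).map (Ideal.Quotient.mk (I (n + 1))),
      hI.transition n b ∈ (I 1).map (Ideal.Quotient.mk (I n)) := by
  intro b hb
  refine (Ideal.map_le_iff_le_comap (K := ((I 1).map (Ideal.Quotient.mk (I n))).comap
    (hI.transition n).toRingHom)).2 ?_ hb
  exact fun a ha => Ideal.mem_map_of_mem _ ha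

lemma IsCompleteFiltration.ext_mk (hI : IsCompleteFiltration k I) {a b : R}
    (h : ∀ n, Ideal.Quotient.mk (I n) a = Ideal.Quotient.mk (I n) b) : a = b :=
  sub_eq_zero.1 (hI.separated _ fun n => Ideal.Quotient.eq.1 (h n))

/-- Completeness, applied to arbitrary lifts: together with separatedness it identifies `R` with the
inverse limit of the `R / I n`. -/
lemma IsCompleteFiltration.exists_mk_eq (hI : IsCompleteFiltration k I) (a : ∀ n, R ⧸ I n)
    (ha : ∀ n, hI.transition n (a (n + 1)) = a n) :
    ∃ b, ∀ n, Ideal.Quotient.mk (I n) b = a n := by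
  choose c hc using fun n => Ideal.Quotient.mk_surjective (a n)
  obtain ⟨b, hb⟩ := hI.complete c fun n => by
    rw [← Ideal.Quotient.eq, hc, ← ha, ← hc]
    rfl
  exact ⟨b, fun n => (Ideal.Quotient.eq.2 (hb n)).trans (hc n)⟩

lemma IsCompleteFiltration.exists_algHom_lift (hI : IsCompleteFiltration k I) {A : Type*}
    [CommRing A] [Algebra k A] (f : ∀ n, A →ₐ[k] R ⧸ I n)
    (hf : ∀ n, (hI.transition n).comp (f (n + 1)) = f n) :
    ∃ F : A →ₐ[k] R, ∀ n, (Ideal.Quotient.mkₐ k (I n)).comp F = f n := by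
  choose F hF using fun a => hI.exists_mk_eq (fun n => f n a)
    fun n => DFunLike.congr_fun (hf n) a
  refine ⟨{ toFun := F
            map_one' := hI.ext_mk fun n => by rw [hF, map_one, map_one]
            map_mul' := fun a b => hI.ext_mk fun n => by rw [hF, map_mul, map_mul, hF, hF]
            map_zero' := hI.ext_mk fun n => by rw [hF, map_zero, map_zero]
            map_add' := fun a b => hI.ext_mk fun n => by rw [hF, map_add, map_add, hF, hF]
            commutes' := fun c => hI.ext_mk fun n => by rw [hF, AlgHom.commutes]; rfl }, ?_⟩
  exact fun n => AlgHom.ext fun a => hF a n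

end FilteredRings

section OfSmoothAction

variable {k R : Type u} [Field k] [CommRing R] [Algebra k R] {I : ℕ → Ideal R}

lemma FormalPoint.taut_map_transition (hI : IsCompleteFiltration k I) (n : ℕ) :
    (FormalPoint.taut k I (n + 1)).map (hI.transition n) (hI.transition_mem n) =
      FormalPoint.taut k I n := by
  ext a
  rfl

/-- Yoneda: the coordinates of the tautological points are compatible and converge to `z`, and every
point is induced by a tautological one. At level one the coordinate lies in the image of `I 1` in `R
/ I 1`, which is zero. -/
lemma SmoothAction.exists_coord (hI : IsCompleteFiltration k I) (σ : SmoothAction k I) :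
    ∃ z ∈ I 1, ∀ {B : Type u} [CommRing B] [Algebra k B] {𝔫 : Ideal B} (h : IsNilpotent 𝔫)
      (x : FormalPoint k I 𝔫), (σ.coord h x : B) = x.hom z := by
  obtain ⟨z, hz⟩ := hI.exists_mk_eq
    (fun n => σ.coord (hI.isNilpotent_map n) (FormalPoint.taut k I n)) fun n => by
      rw [← σ.coord_map _ (hI.isNilpotent_map n) _ (hI.transition_mem n),
        FormalPoint.taut_map_transition]
  refine ⟨z, ?_, fun h x => ?_⟩
  · have h1 := (σ.coord (hI.isNilpotent_map 1) (FormalPoint.taut k I 1)).2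
    rw [← hz, Ideal.map_quotient_self] at h1
    exact Ideal.Quotient.eq_zero_iff_mem.1 h1
  · obtain ⟨n, φ, hφ, rfl⟩ := x.exists_eq_map_taut
    rw [σ.coord_map (hI.isNilpotent_map n) h, ← hz]
    rfl

/-- Yoneda again, for the natural transformation that moves each point along its orbit until its
coordinate is zero. -/
lemma SmoothAction.exists_retraction (hI : IsCompleteFiltration k I) (σ : SmoothAction k I) :
    ∃ p : R →ₐ[k] R, ∀ {B : Type u} [CommRing B] [Algebra k B] {𝔫 : Ideal B}
      (h : IsNilpotent 𝔫) (x : FormalPoint k I 𝔫),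
      (σ.act h x (-σ.coord h x)).hom = x.hom.comp p := by
  obtain ⟨p, hp⟩ := hI.exists_algHom_lift
    (fun n => (σ.act (hI.isNilpotent_map n) (FormalPoint.taut k I n)
      (-σ.coord (hI.isNilpotent_map n) (FormalPoint.taut k I n))).hom) fun n => by
      have := congrArg FormalPoint.hom (σ.act_map (hI.isNilpotent_map (n + 1))
        (hI.isNilpotent_map n) (hI.transition n) (hI.transition_mem n)
        (FormalPoint.taut k I (n + 1))
        (-σ.coord (hI.isNilpotent_map (n + 1)) (FormalPoint.taut k I (n + 1))))
      rw [FormalPoint.map_hom] at this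
      rw [this, FormalPoint.taut_map_transition]
      congr 2
      ext
      simp only [NegMemClass.coe_neg, map_neg]
      rw [← σ.coord_map _ (hI.isNilpotent_map n) _ (hI.transition_mem n),
        FormalPoint.taut_map_transition]
  refine ⟨p, fun {B} _ _ 𝔫 h x => ?_⟩
  obtain ⟨n, φ, hφ, rfl⟩ := x.exists_eq_map_taut
  have := congrArg FormalPoint.hom (σ.act_map (hI.isNilpotent_map n) h φ hφ
    (FormalPoint.taut k I n) (-σ.coord (hI.isNilpotent_map n) (FormalPoint.taut k I n)))
  rw [FormalPoint.map_hom, ← hp] at this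
  rw [FormalPoint.map_hom, AlgHom.comp_assoc]
  refine Eq.trans ?_ this.symm
  congr 2
  ext
  rw [NegMemClass.coe_neg, σ.coord_map (hI.isNilpotent_map n) h]
  simp only [NegMemClass.coe_neg, map_neg]

/-- A coordinate function and a retraction to its zero locus, as given by a smooth action. -/
structure SmoothAction.Slice (σ : SmoothAction k I) where
  /-- The coordinate function. -/
  z : R
  /-- The retraction. -/
  p : R →ₐ[k] R
  z_mem : z ∈ I 1
  coord_eq : ∀ {B : Type u} [CommRing B] [Algebra k B] {𝔫 : Ideal B} (h : IsNilpotent 𝔫)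
    (x : FormalPoint k I 𝔫), (σ.coord h x : B) = x.hom z
  act_neg : ∀ {B : Type u} [CommRing B] [Algebra k B] {𝔫 : Ideal B} (h : IsNilpotent 𝔫)
    (x : FormalPoint k I 𝔫), (σ.act h x (-σ.coord h x)).hom = x.hom.comp p

namespace SmoothAction.Slice

variable {σ : SmoothAction k I} (s : σ.Slice)

lemma p_mem (hI : IsCompleteFiltration k I) {a : R} (ha : a ∈ I 1) : s.p a ∈ I 1 := by
  have h := (σ.act (hI.isNilpotent_map 1) (FormalPoint.taut k I 1)
    (-σ.coord (hI.isNilpotent_map 1) (FormalPoint.taut k I 1))).map_mem a ha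
  rw [s.act_neg] at h
  have h' : Ideal.Quotient.mk (I 1) (s.p a) ∈ (I 1).map (Ideal.Quotient.mk (I 1)) := h
  rw [Ideal.map_quotient_self] at h'
  exact Ideal.Quotient.eq_zero_iff_mem.1 h'

/-- Continuity of the retraction: the moved tautological point is again a formal point, so it kills
some `I M`, where `M` may differ from `n`. -/
lemma exists_p_mem (hI : IsCompleteFiltration k I) (n : ℕ) : ∃ M, ∀ a ∈ I M, s.p a ∈ I n := by
  obtain ⟨M, hM⟩ := (σ.act (hI.isNilpotent_map n) (FormalPoint.taut k I n)
    (-σ.coord (hI.isNilpotent_map n) (FormalPoint.taut k I n))).exists_eq_zero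
  refine ⟨M, fun a ha => ?_⟩
  have := hM a ha
  rw [s.act_neg] at this
  exact Ideal.Quotient.eq_zero_iff_mem.1 this

lemma comp_p_eq_self {B : Type u} [CommRing B] [Algebra k B] {𝔫 : Ideal B} (h : IsNilpotent 𝔫)
    (x : FormalPoint k I 𝔫) (hx : x.hom s.z = 0) : x.hom.comp s.p = x.hom := by
  have : σ.coord h x = 0 := Subtype.ext ((s.coord_eq h x).trans hx)
  rw [← s.act_neg h, this, neg_zero, σ.act_zero]

lemma act_hom_z {B : Type u} [CommRing B] [Algebra k B] {𝔫 : Ideal B} (h : IsNilpotent 𝔫)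
    (x : FormalPoint k I 𝔫) (t : 𝔫) : (σ.act h x t).hom s.z = x.hom s.z + t := by
  rw [← s.coord_eq h, σ.coord_act, ← s.coord_eq h]
  rfl

lemma p_z (hI : IsCompleteFiltration k I) : s.p s.z = 0 := by
  refine hI.ext_mk fun n => ?_
  have h := s.act_hom_z (hI.isNilpotent_map n) (FormalPoint.taut k I n)
    (-σ.coord (hI.isNilpotent_map n) (FormalPoint.taut k I n))
  rw [s.act_neg, NegMemClass.coe_neg, s.coord_eq, add_neg_cancel] at h
  exact h.trans (map_zero _).symm

/-- A moved point has coordinate zero, and such points are not moved any further. -/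
lemma p_p (hI : IsCompleteFiltration k I) (a : R) : s.p (s.p a) = s.p a := by
  refine hI.ext_mk fun n => ?_
  have h := s.comp_p_eq_self (hI.isNilpotent_map n)
    (σ.act (hI.isNilpotent_map n) (FormalPoint.taut k I n)
    (-σ.coord (hI.isNilpotent_map n) (FormalPoint.taut k I n))) (by
      rw [s.act_neg, AlgHom.comp_apply, s.p_z hI, map_zero])
  rw [s.act_neg] at h
  exact DFunLike.congr_fun h a

/-- The image of the retraction, i.e. its algebra of fixed elements. -/
abbrev fixed : Subalgebra k R := AlgHom.equalizer s.p (AlgHom.id k R)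

lemma p_coe (a : s.fixed) : s.p a = a := a.2

/-- The retraction onto the fixed elements. -/
noncomputable def retract (hI : IsCompleteFiltration k I) : R →ₐ[k] s.fixed :=
  s.p.codRestrict _ fun a => s.p_p hI a

lemma fixed_hasBasis [TopologicalSpace R]
    (hb : (nhds (0 : R)).HasBasis (fun _ => True) fun n => (I n : Set R)) :
    (nhds (0 : s.fixed)).HasBasis (fun _ => True)
      fun n => ((I n).comap s.fixed.val : Ideal s.fixed) := by
  rw [nhds_subtype]
  exact hb.comap _

lemma fixed_complete (hI : IsCompleteFiltration k I) (a : ℕ → s.fixed)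
    (ha : ∀ n, a (n + 1) - a n ∈ (I n).comap s.fixed.val) :
    ∃ b, ∀ n, b - a n ∈ (I n).comap s.fixed.val := by
  obtain ⟨b, hb⟩ := hI.complete (fun n => (a n : R)) ha
  refine ⟨⟨b, ?_⟩, hb⟩
  change s.p b = b
  refine sub_eq_zero.1 (hI.separated _ fun n => ?_)
  -- At level `max M n` the approximation error and its image under `p` both lie in `I n`, so the
  -- limit `b` is fixed by `p`.
  obtain ⟨M, hM⟩ := s.exists_p_mem hI n
  have h1 : b - a (max M n) ∈ I (max M n) := hb _
  have h2 := hM _ (hI.antitone (le_max_left _ _) h1)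
  have h3 := hI.antitone (le_max_right _ _) h1
  rw [map_sub, s.p_coe] at h2
  simpa using sub_mem h2 h3

instance isTopologicalRing_fixed [TopologicalSpace R] [IsTopologicalRing R] :
    IsTopologicalRing s.fixed :=
  inferInstanceAs (IsTopologicalRing s.fixed.toSubring)

/-- The trace of `I 1` is an ideal of definition: its powers tend to zero by `I 1 ^ n ≤ I n`, and
admissibility does not ask them to be open. -/
lemma isAdmissibleRing_fixed [TopologicalSpace R] [IsTopologicalRing R]
    (hI : IsCompleteFiltration k I)
    (hb : (nhds (0 : R)).HasBasis (fun _ => True) fun n => (I n : Set R)) :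
    IsAdmissibleRing s.fixed where
  isTopologicalRing := inferInstance
  isLinearTopology := IsLinearTopology.mk_of_hasBasis _ (s.fixed_hasBasis hb)
  exists_idealOfDefinition := by
    refine ⟨(I 1).comap s.fixed.val,
      Ideal.isOpen_of_mem_nhds_zero _ ((s.fixed_hasBasis hb).mem_of_mem trivial), fun V hV => ?_⟩
    obtain ⟨n, -, hn⟩ := (s.fixed_hasBasis hb).mem_iff.1 hV
    exact ⟨n, fun a ha => hn ((Ideal.comap_mono (hI.pow_le n)) (Ideal.le_comap_pow _ _ ha))⟩
  separated := by
    have : T2Space R := by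
      refine IsTopologicalAddGroup.t2Space_of_zero_sep fun a ha => ?_
      by_contra! h
      exact ha (hI.separated a fun n => h _ (hb.mem_of_mem trivial))
    infer_instance
  complete := completeSpace_of_filtration _ (s.fixed_hasBasis hb) (s.fixed_complete hI)

end SmoothAction.Slice

end OfSmoothAction

/-! ### The product decomposition defined by a slice -/

section SmoothFactor

open completedTensor

variable {k R : Type u} [Field k] [CommRing R] [Algebra k R] {I : ℕ → Ideal R}

lemma SmoothAction.nonempty_slice (hI : IsCompleteFiltration k I) (σ : SmoothAction k I) :
    Nonempty σ.Slice := by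
  obtain ⟨z, hz, hz'⟩ := σ.exists_coord hI
  obtain ⟨p, hp⟩ := σ.exists_retraction hI
  exact ⟨⟨z, p, hz, hz', hp⟩⟩

namespace SmoothAction.Slice

variable {σ : SmoothAction k I} (s : σ.Slice)

/-- The ideal of `S / U ⊗ k⟦X⟧ / V` generated by the augmentation ideal of `S` and `X`. -/
noncomputable def tensorIdeal [TopologicalSpace R] (q : OpenIdeals s.fixed × OpenIdeals k⟦X⟧) :
    Ideal ((s.fixed ⧸ q.1.1) ⊗[k] (k⟦X⟧ ⧸ q.2.1)) :=
  ((I 1).comap s.fixed.val).map ((Algebra.TensorProduct.includeLeft (R := k) (S := k)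
    (A := s.fixed ⧸ q.1.1) (B := k⟦X⟧ ⧸ q.2.1)).comp (Ideal.Quotient.mkₐ k q.1.1)) ⊔
  Ideal.span {1 ⊗ₜ Ideal.Quotient.mk q.2.1 PowerSeries.X}

lemma retract_coe (hI : IsCompleteFiltration k I) (a : s.fixed) : s.retract hI a = a :=
  Subtype.ext a.2

variable [TopologicalSpace R]

lemma tmul_mem_tensorIdeal (q : OpenIdeals s.fixed × OpenIdeals k⟦X⟧) (a : s.fixed)
    (ha : (a : R) ∈ I 1) : Ideal.Quotient.mk q.1.1 a ⊗ₜ 1 ∈ s.tensorIdeal q :=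
  Ideal.mem_sup_left (Ideal.mem_map_of_mem ((Algebra.TensorProduct.includeLeft (R := k) (S := k)
    (A := s.fixed ⧸ q.1.1) (B := k⟦X⟧ ⧸ q.2.1)).comp (Ideal.Quotient.mkₐ k q.1.1))
    (show a ∈ (I 1).comap s.fixed.val from ha))

lemma X_mem_tensorIdeal (q : OpenIdeals s.fixed × OpenIdeals k⟦X⟧) :
    1 ⊗ₜ Ideal.Quotient.mk q.2.1 PowerSeries.X ∈ s.tensorIdeal q :=
  Ideal.mem_sup_right (Ideal.mem_span_singleton_self _)

lemma tensorIdeal_le (q : OpenIdeals s.fixed × OpenIdeals k⟦X⟧) {B : Type*} [CommRing B]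
    [Algebra k B] (𝔫 : Ideal B) (φ : (s.fixed ⧸ q.1.1) ⊗[k] (k⟦X⟧ ⧸ q.2.1) →ₐ[k] B)
    (h1 : ∀ a : s.fixed, (a : R) ∈ I 1 → φ (Ideal.Quotient.mk q.1.1 a ⊗ₜ 1) ∈ 𝔫)
    (h2 : φ (1 ⊗ₜ Ideal.Quotient.mk q.2.1 PowerSeries.X) ∈ 𝔫) :
    ∀ b ∈ s.tensorIdeal q, φ b ∈ 𝔫 := by
  suffices s.tensorIdeal q ≤ 𝔫.comap φ from fun b hb => this hb
  refine sup_le ?_ ((Ideal.span_singleton_le_iff_mem _).2 h2)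
  rw [Ideal.map_le_iff_le_comap]
  exact fun a ha => h1 a ha

variable (hI : IsCompleteFiltration k I)
  (hb : (nhds (0 : R)).HasBasis (fun _ => True) fun n => (I n : Set R))
include hI hb

/-- A sum of two nilpotent ideals: powers of the augmentation ideal of `S` eventually enter the open
ideal `U`, and powers of `X` enter `V`. -/
lemma isNilpotent_tensorIdeal (q : OpenIdeals s.fixed × OpenIdeals k⟦X⟧) :
    IsNilpotent (s.tensorIdeal q) := by
  refine Commute.isNilpotent_add (R := Ideal _) (mul_comm _ _) ?_ ?_
  · obtain ⟨n, -, hn⟩ := (s.fixed_hasBasis hb).mem_iff.1 (q.1.2.mem_nhds (zero_mem _))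
    refine ⟨n, ?_⟩
    rw [← Ideal.map_pow, Ideal.zero_eq_bot, Ideal.map_eq_bot_iff_le_ker]
    intro a ha
    have : a ∈ q.1.1 := hn (Ideal.comap_mono (hI.pow_le n) (Ideal.le_comap_pow _ _ ha))
    change Ideal.Quotient.mk q.1.1 a ⊗ₜ 1 = 0
    rw [Ideal.Quotient.eq_zero_iff_mem.2 this, TensorProduct.zero_tmul]
  · obtain ⟨N, hN⟩ := exists_X_pow_mem k q.2
    refine ⟨N, ?_⟩
    rw [Ideal.span_singleton_pow, Algebra.TensorProduct.tmul_pow, ← map_pow,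
      Ideal.Quotient.eq_zero_iff_mem.2 hN, TensorProduct.tmul_zero, Ideal.zero_eq_bot,
      Ideal.span_singleton_eq_bot]

/-- The point of `R` with values in `S / U ⊗ k⟦X⟧ / V` induced by the retraction onto `S`. -/
noncomputable def tensorPoint (q : OpenIdeals s.fixed × OpenIdeals k⟦X⟧) :
    FormalPoint k I (s.tensorIdeal q) where
  hom := ((Algebra.TensorProduct.includeLeft (R := k) (S := k)
    (A := s.fixed ⧸ q.1.1) (B := k⟦X⟧ ⧸ q.2.1)).comp (Ideal.Quotient.mkₐ k q.1.1)).comp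
      (s.retract hI)
  map_mem a ha := s.tmul_mem_tensorIdeal q _ (s.p_mem hI ha)
  exists_eq_zero := by
    obtain ⟨n, -, hn⟩ := (s.fixed_hasBasis hb).mem_iff.1 (q.1.2.mem_nhds (zero_mem _))
    obtain ⟨M, hM⟩ := s.exists_p_mem hI n
    refine ⟨M, fun a ha => ?_⟩
    have : s.retract hI a ∈ q.1.1 := hn (show s.p a ∈ I n from hM a ha)
    change Ideal.Quotient.mk q.1.1 (s.retract hI a) ⊗ₜ 1 = 0
    rw [Ideal.Quotient.eq_zero_iff_mem.2 this, TensorProduct.zero_tmul]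

lemma tensorPoint_hom (q : OpenIdeals s.fixed × OpenIdeals k⟦X⟧) (a : R) :
    (s.tensorPoint hI hb q).hom a = Ideal.Quotient.mk q.1.1 (s.retract hI a) ⊗ₜ 1 := rfl

/-- The point of `R` with values in `S / U ⊗ k⟦X⟧ / V` whose coordinate is `X`. -/
noncomputable def genericPoint (q : OpenIdeals s.fixed × OpenIdeals k⟦X⟧) :
    FormalPoint k I (s.tensorIdeal q) :=
  σ.act (s.isNilpotent_tensorIdeal hI hb q) (s.tensorPoint hI hb q)
    ⟨_, s.X_mem_tensorIdeal q⟩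

lemma tensorPoint_z (q : OpenIdeals s.fixed × OpenIdeals k⟦X⟧) :
    (s.tensorPoint hI hb q).hom s.z = 0 := by
  have : s.retract hI s.z = 0 := Subtype.ext (s.p_z hI)
  rw [tensorPoint_hom, this, map_zero, TensorProduct.zero_tmul]

lemma genericPoint_z (q : OpenIdeals s.fixed × OpenIdeals k⟦X⟧) :
    (s.genericPoint hI hb q).hom s.z = 1 ⊗ₜ Ideal.Quotient.mk q.2.1 PowerSeries.X := by
  rw [genericPoint, s.act_hom_z, tensorPoint_z, zero_add]

/-- Moving the generic point back by its coordinate `X` returns the point it came from. The same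
motion is composition with `p`, which does nothing to fixed elements. -/
lemma genericPoint_coe (q : OpenIdeals s.fixed × OpenIdeals k⟦X⟧) (a : s.fixed) :
    (s.genericPoint hI hb q).hom a = Ideal.Quotient.mk q.1.1 a ⊗ₜ 1 := by
  have h := s.act_neg (s.isNilpotent_tensorIdeal hI hb q) (s.genericPoint hI hb q)
  have hc : -σ.coord (s.isNilpotent_tensorIdeal hI hb q) (s.genericPoint hI hb q) =
      -⟨_, s.X_mem_tensorIdeal q⟩ := by
    congr 1
    exact Subtype.ext ((s.coord_eq _ _).trans (s.genericPoint_z hI hb q))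
  rw [hc, genericPoint, σ.act_add, add_neg_cancel, σ.act_zero] at h
  have h' := DFunLike.congr_fun h (a : R)
  rw [AlgHom.comp_apply, s.p_coe, tensorPoint_hom, s.retract_coe hI] at h'
  exact h'.symm

lemma genericPoint_map {q q' : OpenIdeals s.fixed × OpenIdeals k⟦X⟧} (h : q ≤ q') (a : R) :
    Algebra.TensorProduct.map (Ideal.Quotient.factorₐ k (Subtype.coe_le_coe.mpr h.1))
      (Ideal.Quotient.factorₐ k (Subtype.coe_le_coe.mpr h.2)) ((s.genericPoint hI hb q).hom a) =
      (s.genericPoint hI hb q').hom a := by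
  have hφ := s.tensorIdeal_le q (s.tensorIdeal q') (Algebra.TensorProduct.map
    (Ideal.Quotient.factorₐ k (Subtype.coe_le_coe.mpr h.1))
    (Ideal.Quotient.factorₐ k (Subtype.coe_le_coe.mpr h.2)))
    (fun a ha => s.tmul_mem_tensorIdeal q' a ha) (s.X_mem_tensorIdeal q')
  have := congrArg FormalPoint.hom (σ.act_map (s.isNilpotent_tensorIdeal hI hb q)
    (s.isNilpotent_tensorIdeal hI hb q') _ hφ (s.tensorPoint hI hb q)
    ⟨_, s.X_mem_tensorIdeal q⟩)
  exact DFunLike.congr_fun this a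

/-- The homomorphism `R → S ⊗̂ k⟦X⟧`. -/
noncomputable def toTensor : R →ₐ[k] completedTensor k s.fixed k⟦X⟧ :=
  AlgHom.codRestrict (AlgHom.pi fun q => (s.genericPoint hI hb q).hom) _
    fun a _ _ h => s.genericPoint_map hI hb h a

lemma proj_toTensor (q : OpenIdeals s.fixed × OpenIdeals k⟦X⟧) (a : R) :
    proj k s.fixed q (s.toTensor hI hb a) = (s.genericPoint hI hb q).hom a := rfl

variable [IsTopologicalRing R]

/-- Geometrically, `g` sends a point to the pair of its projection to the slice and its coordinate.
Pulling the generic point back along `g` moves the tautological point to the slice and then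
translates it by `z`; the two motions cancel. -/
lemma exists_left_inverse (n : ℕ) : ∃ (q : OpenIdeals s.fixed × OpenIdeals k⟦X⟧)
    (g : (s.fixed ⧸ q.1.1) ⊗[k] (k⟦X⟧ ⧸ q.2.1) →ₐ[k] R ⧸ I n),
    (∀ a : s.fixed, g (Ideal.Quotient.mk _ a ⊗ₜ 1) = Ideal.Quotient.mk (I n) a) ∧
    g (1 ⊗ₜ Ideal.Quotient.mk _ PowerSeries.X) = Ideal.Quotient.mk (I n) s.z ∧
    ∀ a, g ((s.genericPoint hI hb q).hom a) = Ideal.Quotient.mk (I n) a := by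
  have hz : Ideal.Quotient.mk (I n) s.z ^ n = 0 := by
    rw [← map_pow, Ideal.Quotient.eq_zero_iff_mem]
    exact hI.pow_le n (Ideal.pow_mem_pow s.z_mem n)
  obtain ⟨g, hg, hgX⟩ := exists_lift ((Ideal.Quotient.mkₐ k (I n)).comp s.fixed.val)
    ⟨(I n).comap s.fixed.val,
      Ideal.isOpen_of_mem_nhds_zero _ ((s.fixed_hasBasis hb).mem_of_mem trivial)⟩
    (fun a ha => Ideal.Quotient.eq_zero_iff_mem.2 ha) _ n hz
  refine ⟨(⟨(I n).comap s.fixed.val, _⟩, ⟨_, isOpen_span_X_pow k n⟩), g, hg, hgX, fun a => ?_⟩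
  set q : OpenIdeals s.fixed × OpenIdeals k⟦X⟧ :=
    (⟨(I n).comap s.fixed.val, _⟩, ⟨_, isOpen_span_X_pow k n⟩)
  have hφ := s.tensorIdeal_le q ((I 1).map (Ideal.Quotient.mk (I n))) g
    (fun a ha => by
      rw [hg a]
      exact Ideal.mem_map_of_mem _ ha)
    (by
      rw [hgX]
      exact Ideal.mem_map_of_mem _ s.z_mem)
  have h1 := congrArg FormalPoint.hom (σ.act_map (s.isNilpotent_tensorIdeal hI hb q)
    (hI.isNilpotent_map n) g hφ (s.tensorPoint hI hb q) ⟨_, s.X_mem_tensorIdeal q⟩)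
  have h2 : (s.tensorPoint hI hb q).map g hφ = σ.act (hI.isNilpotent_map n)
      (FormalPoint.taut k I n) (-σ.coord (hI.isNilpotent_map n) (FormalPoint.taut k I n)) := by
    ext a
    rw [s.act_neg]
    exact hg _
  have h3 : (⟨g (1 ⊗ₜ Ideal.Quotient.mk q.2.1 PowerSeries.X), hφ _ (s.X_mem_tensorIdeal q)⟩ :
      (I 1).map (Ideal.Quotient.mk (I n))) =
      σ.coord (hI.isNilpotent_map n) (FormalPoint.taut k I n) :=
    Subtype.ext (hgX.trans (s.coord_eq (hI.isNilpotent_map n) (FormalPoint.taut k I n)).symm)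
  rw [h2, h3, σ.act_add, neg_add_cancel, σ.act_zero] at h1
  exact DFunLike.congr_fun h1 a

lemma toTensor_injective : Function.Injective (s.toTensor hI hb) := by
  intro a b h
  refine hI.ext_mk fun n => ?_
  obtain ⟨q, g, -, -, hg⟩ := s.exists_left_inverse hI hb n
  rw [← hg, ← hg, ← proj_toTensor, h, proj_toTensor]

/-- The one-sided inverses at the various levels agree on `S` and `X`, hence are compatible, and by
completeness they assign to `c` an element of `R`. -/
lemma toTensor_surjective : Function.Surjective (s.toTensor hI hb) := by
  intro c
  choose q g hgS hgX hg using s.exists_left_inverse hI hb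
  have hcompat : ∀ n, (hI.transition n).comp ((g (n + 1)).comp (proj k s.fixed (q (n + 1)))) =
      (g n).comp (proj k s.fixed (q n)) := fun n => by
    refine algHom_ext_of_factor (p := q (n + 1)) (q := q n) (fun a ha => ?_) (fun a ha => ?_)
      (fun a => ?_) ?_
    · simp only [AlgHom.comp_apply, ha, map_zero]
    · simp only [AlgHom.comp_apply, ha, map_zero]
    · simp only [AlgHom.comp_apply, proj_inl, hgS]
      rfl
    · simp only [AlgHom.comp_apply, proj_inr, hgX]
      rfl
  obtain ⟨a, ha⟩ := hI.exists_mk_eq (fun n => g n (proj k s.fixed (q n) c))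
    fun n => DFunLike.congr_fun (hcompat n) c
  refine ⟨a, ext_proj fun r => ?_⟩
  -- To compare at level `r`, the generic point is factored through some `R / I n`. There the
  -- composite of `φ` with the one-sided inverse is the projection, since both agree on `S` and `X`.
  obtain ⟨n, φ, hφ, hr⟩ := (s.genericPoint hI hb r).exists_eq_map_taut
  have hr' : ∀ b, (s.genericPoint hI hb r).hom b = φ (Ideal.Quotient.mk (I n) b) :=
    fun b => DFunLike.congr_fun (congrArg FormalPoint.hom hr) b
  rw [proj_toTensor, hr', ha]
  have : φ.comp ((g n).comp (proj k s.fixed (q n))) = proj k s.fixed r := by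
    refine algHom_ext_of_factor (p := q n) (q := r) (fun a ha => ?_) (fun a ha => ha)
      (fun a => ?_) ?_
    · simp only [AlgHom.comp_apply, ha, map_zero]
    · simp only [AlgHom.comp_apply, proj_inl, hgS]
      rw [← hr', genericPoint_coe]
    · simp only [AlgHom.comp_apply, proj_inr, hgX]
      rw [← hr', genericPoint_z]
  exact DFunLike.congr_fun this c

lemma continuous_toTensor : Continuous (s.toTensor hI hb) := by
  refine continuous_iInf_rng.2 fun q => continuous_induced_rng.2 ?_
  let _ : TopologicalSpace ((s.fixed ⧸ q.1.1) ⊗[k] (k⟦X⟧ ⧸ q.2.1)) := ⊥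
  refine (IsLocallyConstant.iff_eventually_eq _).2 (fun a => ?_) |>.continuous
  obtain ⟨M, hM⟩ := (s.genericPoint hI hb q).exists_eq_zero
  have h : Filter.Tendsto (fun b => b - a) (nhds a) (nhds 0) := by
    simpa using (continuous_id.sub continuous_const).tendsto (x := a) (f := fun b => b - a)
  filter_upwards [h.eventually (hb.mem_of_mem (i := M) trivial)] with b hba
  have := hM _ hba
  rw [map_sub, sub_eq_zero] at this
  exact this

/-- The one-sided inverse modulo `I n` depends on a single projection, so elements with equal
projection have preimages that differ by `I n`. -/
lemma isOpenMap_toTensor : IsOpenMap (s.toTensor hI hb) := by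
  intro U hU
  rw [isOpen_iff_mem_nhds]
  rintro _ ⟨a, ha, rfl⟩
  have h : Filter.Tendsto (fun b => b + a) (nhds 0) (nhds a) := by
    simpa using (continuous_id.add continuous_const).tendsto (x := (0 : R)) (f := fun b => b + a)
  obtain ⟨n, -, hn⟩ := hb.mem_iff.1 (h (hU.mem_nhds ha))
  obtain ⟨q, g, -, -, hg⟩ := s.exists_left_inverse hI hb n
  have hV : IsOpen {c | proj k s.fixed q c = proj k s.fixed q (s.toTensor hI hb a)} := by
    let _ : TopologicalSpace ((s.fixed ⧸ q.1.1) ⊗[k] (k⟦X⟧ ⧸ q.2.1)) := ⊥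
    have : DiscreteTopology ((s.fixed ⧸ q.1.1) ⊗[k] (k⟦X⟧ ⧸ q.2.1)) := ⟨rfl⟩
    have : Continuous (proj k s.fixed q) :=
      continuous_iInf_dom (i := q) continuous_induced_dom
    exact (isOpen_discrete {proj k s.fixed q (s.toTensor hI hb a)}).preimage this
  refine Filter.mem_of_superset (hV.mem_nhds rfl) fun c hc => ?_
  obtain ⟨b, rfl⟩ := s.toTensor_surjective hI hb c
  refine ⟨b, ?_, rfl⟩
  have : b - a ∈ I n := by
    rw [← Ideal.Quotient.eq, ← hg, ← hg, ← proj_toTensor, ← proj_toTensor]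
    exact congrArg g hc
  simpa using hn this

end SmoothAction.Slice

/-- A smooth action yields a smooth factor. -/
theorem SmoothAction.admitsSmoothFactor [TopologicalSpace R] [IsTopologicalRing R]
    (hI : IsCompleteFiltration k I)
    (hb : (nhds (0 : R)).HasBasis (fun _ => True) fun n => (I n : Set R))
    (σ : SmoothAction k I) : AdmitsSmoothFactor k R := by
  obtain ⟨s⟩ := σ.nonempty_slice hI
  let e := AlgEquiv.ofBijective (s.toTensor hI hb)
    ⟨s.toTensor_injective hI hb, s.toTensor_surjective hI hb⟩
  refine ⟨s.fixed, inferInstance, inferInstance, inferInstance, s.isAdmissibleRing_fixed hI hb,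
    ⟨{ e with
        continuous_toFun := s.continuous_toTensor hI hb
        continuous_invFun := ?_ }⟩⟩
  exact (Equiv.continuous_symm_iff e.toEquiv).2 (s.isOpenMap_toTensor hI hb)

end SmoothFactor

/-! ### Truncated power series rings -/

section JetRing

lemma Finset.le_of_mem_antidiagonal_left {n : ℕ} {p : ℕ × ℕ}
    (hp : p ∈ Finset.HasAntidiagonal.antidiagonal n) : p.1 ≤ n := by
  have := Finset.HasAntidiagonal.mem_antidiagonal.1 hp
  omega

lemma Finset.le_of_mem_antidiagonal_right {n : ℕ} {p : ℕ × ℕ}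
    (hp : p ∈ Finset.HasAntidiagonal.antidiagonal n) : p.2 ≤ n := by
  have := Finset.HasAntidiagonal.mem_antidiagonal.1 hp
  omega

/-- The power series whose coefficients of index at most `n` vanish. -/
def jetIdeal (n : ℕ∞) (B : Type*) [CommRing B] : Ideal B⟦X⟧ where
  carrier := {f | ∀ i : ℕ, (i : ℕ∞) ≤ n → PowerSeries.coeff i f = 0}
  add_mem' hf hg i hi := by rw [map_add, hf i hi, hg i hi, add_zero]
  zero_mem' i _ := map_zero _
  smul_mem' f g hg i hi := by
    rw [smul_eq_mul, PowerSeries.coeff_mul]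
    refine Finset.sum_eq_zero fun p hp => ?_
    rw [hg p.2 (le_trans (by exact_mod_cast Finset.le_of_mem_antidiagonal_right hp) hi), mul_zero]

/-- The ring `B[t]/(t^(n+1))`, resp. `B⟦t⟧` if `n = ∞`. -/
def JetRing (n : ℕ∞) (B : Type*) [CommRing B] : Type _ := B⟦X⟧ ⧸ jetIdeal n B

namespace JetRing

noncomputable instance (n : ℕ∞) (B : Type*) [CommRing B] : CommRing (JetRing n B) :=
  inferInstanceAs (CommRing (B⟦X⟧ ⧸ jetIdeal n B))

noncomputable instance (n : ℕ∞) (k B : Type*) [CommRing k] [CommRing B] [Algebra k B] :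
    Algebra k (JetRing n B) :=
  inferInstanceAs (Algebra k (B⟦X⟧ ⧸ jetIdeal n B))

variable {n : ℕ∞} {k B B' B'' : Type*} [CommRing k] [CommRing B] [CommRing B'] [CommRing B'']
  [Algebra k B] [Algebra k B'] [Algebra k B'']

variable (n k B) in
/-- The quotient map. -/
noncomputable def mk : B⟦X⟧ →ₐ[k] JetRing n B := Ideal.Quotient.mkₐ k (jetIdeal n B)

variable (n k B) in
lemma mk_surjective : Function.Surjective (mk n k B) := Ideal.Quotient.mk_surjective

lemma mk_eq_mk {f g : B⟦X⟧} : mk n k B f = mk n k B g ↔ f - g ∈ jetIdeal n B :=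
  Ideal.Quotient.eq

/-- The coefficients of an element of `B[t]/(t^(n+1))`. -/
noncomputable def coeff (i : ℕ) (x : JetRing n B) : B :=
  PowerSeries.coeff i (Function.surjInv (mk_surjective n B B) x)

-- Beyond index `n` a coefficient depends on the chosen lift, which is why the bound `i ≤ n`
-- accompanies all statements about coefficients.
variable (k) in
lemma coeff_mk {i : ℕ} (hi : (i : ℕ∞) ≤ n) (f : B⟦X⟧) :
    coeff i (mk n k B f) = PowerSeries.coeff i f := by
  have h : Function.surjInv (mk_surjective n B B) (mk n k B f) - f ∈ jetIdeal n B := by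
    rw [← mk_eq_mk (k := B)]
    exact Function.surjInv_eq _ _
  have := h i hi
  rwa [map_sub, sub_eq_zero] at this

lemma ext {x y : JetRing n B} (h : ∀ i : ℕ, (i : ℕ∞) ≤ n → coeff i x = coeff i y) : x = y := by
  obtain ⟨f, rfl⟩ := mk_surjective n B B x
  obtain ⟨g, rfl⟩ := mk_surjective n B B y
  refine mk_eq_mk.2 fun i hi => ?_
  have := h i hi
  rw [coeff_mk B hi, coeff_mk B hi] at this
  rw [map_sub, this, sub_self]

lemma coeff_add {i : ℕ} (hi : (i : ℕ∞) ≤ n) (x y : JetRing n B) :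
    coeff i (x + y) = coeff i x + coeff i y := by
  obtain ⟨f, rfl⟩ := mk_surjective n B B x
  obtain ⟨g, rfl⟩ := mk_surjective n B B y
  rw [← map_add, coeff_mk B hi, coeff_mk B hi, coeff_mk B hi, map_add]

lemma coeff_zero {i : ℕ} (hi : (i : ℕ∞) ≤ n) : coeff i (0 : JetRing n B) = 0 := by
  rw [← map_zero (mk n B B), coeff_mk B hi, map_zero]

lemma coeff_smul {i : ℕ} (hi : (i : ℕ∞) ≤ n) (c : k) (x : JetRing n B) :
    coeff i (c • x) = c • coeff i x := by
  obtain ⟨f, rfl⟩ := mk_surjective n k B x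
  rw [← map_smul, coeff_mk k hi, coeff_mk k hi]
  rfl

lemma coeff_mul {i : ℕ} (hi : (i : ℕ∞) ≤ n) (x y : JetRing n B) :
    coeff i (x * y) =
      ∑ p ∈ Finset.HasAntidiagonal.antidiagonal i, coeff p.1 x * coeff p.2 y := by
  obtain ⟨f, rfl⟩ := mk_surjective n B B x
  obtain ⟨g, rfl⟩ := mk_surjective n B B y
  rw [← map_mul, coeff_mk B hi, PowerSeries.coeff_mul]
  refine Finset.sum_congr rfl fun p hp => ?_
  rw [coeff_mk B (le_trans (by exact_mod_cast Finset.le_of_mem_antidiagonal_left hp) hi),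
    coeff_mk B (le_trans (by exact_mod_cast Finset.le_of_mem_antidiagonal_right hp) hi)]

/-- Every sequence of coefficients is realized. -/
lemma exists_coeff_eq (n : ℕ∞) (c : ℕ → B) :
    ∃ x : JetRing n B, ∀ i : ℕ, (i : ℕ∞) ≤ n → coeff i x = c i :=
  ⟨mk n B B (PowerSeries.mk c), fun i hi => by rw [coeff_mk B hi, PowerSeries.coeff_mk]⟩

variable (n k B) in
/-- The constants. -/
noncomputable def const : B →ₐ[k] JetRing n B :=
  (mk n k B).comp ((Algebra.ofId B B⟦X⟧).restrictScalars k)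

lemma coeff_const {i : ℕ} (hi : (i : ℕ∞) ≤ n) (b : B) :
    coeff i (const n k B b) = if i = 0 then b else 0 :=
  (coeff_mk k hi _).trans (PowerSeries.coeff_C _ _)

variable (k) in
/-- Homomorphisms out of `B[t]/(t^(n+1))`. -/
noncomputable def lift {A : Type*} [CommRing A] [Algebra k A] (φ : B⟦X⟧ →ₐ[k] A)
    (hφ : ∀ f ∈ jetIdeal n B, φ f = 0) : JetRing n B →ₐ[k] A :=
  Ideal.Quotient.liftₐ (jetIdeal n B) φ hφ

lemma lift_mk {A : Type*} [CommRing A] [Algebra k A] (φ : B⟦X⟧ →ₐ[k] A)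
    (hφ : ∀ f ∈ jetIdeal n B, φ f = 0) (f : B⟦X⟧) : lift k φ hφ (mk n k B f) = φ f := rfl

variable (n k B) in
/-- The constant coefficient. -/
noncomputable def constCoeff : JetRing n B →ₐ[k] B :=
  lift k
    { (PowerSeries.constantCoeff (R := B)) with
      commutes' := fun c => by
        simp [PowerSeries.algebraMap_apply] } fun f hf => by
    simpa using hf 0 (by simp)

lemma constCoeff_apply (x : JetRing n B) : constCoeff n k B x = coeff 0 x := by
  obtain ⟨f, rfl⟩ := mk_surjective n k B x
  rw [coeff_mk k (by simp), PowerSeries.coeff_zero_eq_constantCoeff]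
  rfl

lemma constCoeff_const (b : B) : constCoeff n k B (const n k B b) = b := by
  rw [constCoeff_apply, coeff_const (by simp), if_pos rfl]

variable (n) in
/-- Functoriality in the coefficients. -/
noncomputable def map (φ : B →ₐ[k] B') : JetRing n B →ₐ[k] JetRing n B' :=
  lift k ((mk n k B').comp (PowerSeries.mapAlgHom φ)) fun f hf => by
    refine ext fun i hi => ?_
    rw [AlgHom.comp_apply, coeff_mk k hi, coeff_zero hi]
    change PowerSeries.coeff i (PowerSeries.map φ.toRingHom f) = 0
    rw [PowerSeries.coeff_map, hf i hi, map_zero]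

lemma map_mk (φ : B →ₐ[k] B') (f : B⟦X⟧) :
    map n φ (mk n k B f) = mk n k B' (PowerSeries.map φ.toRingHom f) := rfl

lemma coeff_map {i : ℕ} (hi : (i : ℕ∞) ≤ n) (φ : B →ₐ[k] B') (x : JetRing n B) :
    coeff i (map n φ x) = φ (coeff i x) := by
  obtain ⟨f, rfl⟩ := mk_surjective n k B x
  rw [map_mk, coeff_mk k hi, coeff_mk k hi]
  rfl

lemma map_const (φ : B →ₐ[k] B') (b : B) : map n φ (const n k B b) = const n k B' (φ b) := by
  refine ext fun i hi => ?_
  rw [coeff_map hi, coeff_const hi, coeff_const hi]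
  split_ifs <;> simp

lemma constCoeff_map (φ : B →ₐ[k] B') (x : JetRing n B) :
    constCoeff n k B' (map n φ x) = φ (constCoeff n k B x) := by
  rw [constCoeff_apply, constCoeff_apply, coeff_map (by simp)]

lemma map_surjective {φ : B →ₐ[k] B'} (hφ : Function.Surjective φ) :
    Function.Surjective (map n φ) := by
  intro y
  choose c hc using fun i => hφ (coeff i y)
  obtain ⟨x, hx⟩ := exists_coeff_eq n c
  exact ⟨x, ext fun i hi => by rw [coeff_map hi, hx i hi, hc]⟩

variable (n) in
/-- The elements with coefficients in an ideal. -/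
def coeffIdeal (𝔫 : Ideal B) : Ideal (JetRing n B) where
  carrier := {x | ∀ i : ℕ, (i : ℕ∞) ≤ n → coeff i x ∈ 𝔫}
  add_mem' hx hy i hi := by
    rw [coeff_add hi]
    exact add_mem (hx i hi) (hy i hi)
  zero_mem' i hi := by
    rw [coeff_zero hi]
    exact zero_mem _
  smul_mem' x y hy i hi := by
    rw [smul_eq_mul, coeff_mul hi]
    refine sum_mem fun p hp => 𝔫.mul_mem_left _ (hy _ ?_)
    exact le_trans (by exact_mod_cast Finset.le_of_mem_antidiagonal_right hp) hi

lemma coeffIdeal_mul_le (𝔫 𝔫' : Ideal B) :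
    coeffIdeal n 𝔫 * coeffIdeal n 𝔫' ≤ coeffIdeal n (𝔫 * 𝔫') := by
  refine Ideal.mul_le.2 fun x hx y hy i hi => ?_
  rw [coeff_mul hi]
  refine sum_mem fun p hp => Ideal.mul_mem_mul (hx _ ?_) (hy _ ?_)
  · exact le_trans (by exact_mod_cast Finset.le_of_mem_antidiagonal_left hp) hi
  · exact le_trans (by exact_mod_cast Finset.le_of_mem_antidiagonal_right hp) hi

lemma coeffIdeal_pow_le (𝔫 : Ideal B) (N : ℕ) : coeffIdeal n 𝔫 ^ N ≤ coeffIdeal n (𝔫 ^ N) := by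
  induction N with
  | zero => exact fun x _ i _ => by simp
  | succ N ih =>
    rw [pow_succ (coeffIdeal n 𝔫), pow_succ 𝔫]
    exact (Ideal.mul_mono_left ih).trans (coeffIdeal_mul_le _ _)

/-- A single exponent serves all coefficients at once, so this also holds for `n = ∞`. Nilpotency of
the ideal, not just of its elements, is essential there. -/
lemma isNilpotent_coeffIdeal {𝔫 : Ideal B} (h : IsNilpotent 𝔫) :
    IsNilpotent (coeffIdeal n 𝔫) := by
  obtain ⟨N, hN⟩ := h
  refine ⟨N, le_bot_iff.1 fun x hx => ?_⟩
  have := coeffIdeal_pow_le _ _ hx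
  rw [hN] at this
  exact ext fun i hi => (this i hi).trans (coeff_zero hi).symm

lemma map_mem_coeffIdeal {𝔫 : Ideal B} {𝔫' : Ideal B'} {φ : B →ₐ[k] B'}
    (hφ : ∀ b ∈ 𝔫, φ b ∈ 𝔫') : ∀ x ∈ coeffIdeal n 𝔫, map n φ x ∈ coeffIdeal n 𝔫' := by
  intro x hx i hi
  rw [coeff_map hi]
  exact hφ _ (hx i hi)

lemma const_mem_coeffIdeal {𝔫 : Ideal B} {b : B} (hb : b ∈ 𝔫) :
    const n k B b ∈ coeffIdeal n 𝔫 := by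
  intro i hi
  rw [coeff_const hi]
  split_ifs
  exacts [hb, zero_mem _]

lemma constCoeff_mem {𝔫 : Ideal B} {x : JetRing n B} (hx : x ∈ coeffIdeal n 𝔫) :
    constCoeff n k B x ∈ 𝔫 := by
  rw [constCoeff_apply]
  exact hx 0 (by simp)

end JetRing

end JetRing

/-! ### Transfer of smooth actions to jets -/

/-- A description of the points of a filtered algebra as the jets in another one. -/
structure JetCorrespondence (k : Type u) [Field k] {R R' : Type u} [CommRing R] [Algebra k R]
    [CommRing R'] [Algebra k R'] (n : ℕ∞) (I : ℕ → Ideal R) (I' : ℕ → Ideal R') where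
  /-- The correspondence on points. -/
  equiv : ∀ {B : Type u} [CommRing B] [Algebra k B] {𝔫 : Ideal B}, IsNilpotent 𝔫 →
    (FormalPoint k I' 𝔫 ≃ FormalPoint k I (JetRing.coeffIdeal n 𝔫))
  equiv_map : ∀ {B : Type u} [CommRing B] [Algebra k B] {𝔫 : Ideal B} (h : IsNilpotent 𝔫)
    {B' : Type u} [CommRing B'] [Algebra k B'] {𝔫' : Ideal B'} (h' : IsNilpotent 𝔫')
    (φ : B →ₐ[k] B') (hφ : ∀ b ∈ 𝔫, φ b ∈ 𝔫') (x : FormalPoint k I' 𝔫),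
    (equiv h x).map (JetRing.map n φ) (JetRing.map_mem_coeffIdeal hφ) = equiv h' (x.map φ hφ)

section Transfer

variable {k : Type u} [Field k] {R R' : Type u} [CommRing R] [Algebra k R]
    [CommRing R'] [Algebra k R'] {n : ℕ∞} {I : ℕ → Ideal R} {I' : ℕ → Ideal R'}

open JetRing

lemma JetCorrespondence.equiv_symm_map (Θ : JetCorrespondence k n I I') {B : Type u} [CommRing B]
    [Algebra k B] {𝔫 : Ideal B} (h : IsNilpotent 𝔫) {B' : Type u} [CommRing B'] [Algebra k B']
    {𝔫' : Ideal B'} (h' : IsNilpotent 𝔫') (φ : B →ₐ[k] B') (hφ : ∀ b ∈ 𝔫, φ b ∈ 𝔫')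
    (x : FormalPoint k I (coeffIdeal n 𝔫)) :
    ((Θ.equiv h).symm x).map φ hφ =
      (Θ.equiv h').symm (x.map (JetRing.map n φ) (map_mem_coeffIdeal hφ)) := by
  rw [Equiv.eq_symm_apply, ← Θ.equiv_map h h', Equiv.apply_symm_apply]

/-- Constant translations act on jets. -/
noncomputable def SmoothAction.jets (σ : SmoothAction k I) (Θ : JetCorrespondence k n I I') :
    SmoothAction k I' where
  act h x s := (Θ.equiv h).symm (σ.act (isNilpotent_coeffIdeal h) (Θ.equiv h x)
    ⟨const n k _ s, const_mem_coeffIdeal s.2⟩)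
  -- Keeping only the constant term preserves equivariance: a translation by the constant jet `s`
  -- changes it by exactly `s`.
  coord h x := ⟨constCoeff n k _ (σ.coord (isNilpotent_coeffIdeal h) (Θ.equiv h x) : JetRing n _),
    constCoeff_mem (σ.coord _ _).2⟩
  act_map h _ _ _ _ h' φ hφ x s := by
    rw [Θ.equiv_symm_map h h', σ.act_map (isNilpotent_coeffIdeal h) (isNilpotent_coeffIdeal h')
      (JetRing.map n φ) (map_mem_coeffIdeal hφ), Θ.equiv_map h h' φ hφ]
    congr 3
    exact map_const _ _
  coord_map h _ _ _ _ h' φ hφ x := by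
    simp only
    rw [← Θ.equiv_map h h', σ.coord_map (isNilpotent_coeffIdeal h), constCoeff_map]
  act_zero h x := by
    rw [Equiv.symm_apply_eq]
    refine Eq.trans ?_ (σ.act_zero (isNilpotent_coeffIdeal h) _)
    congr 1
    exact Subtype.ext (map_zero _)
  act_add h x s s' := by
    rw [Equiv.apply_symm_apply, σ.act_add]
    congr 2
    exact Subtype.ext (map_add _ _ _).symm
  coord_act h x s := by
    refine Subtype.ext ?_
    simp only [Equiv.apply_symm_apply, σ.coord_act]
    simp [constCoeff_const]

end Transfer

/-! ### Smooth actions from derivations in characteristic zero -/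

section Exponential

/-- The square of side `N` lies in the triangle of antidiagonals below `2 * N`, and terms outside
the square vanish. -/
lemma Finset.sum_range_sum_range_eq_sum_antidiagonal {M : Type*} [AddCommMonoid M] (N : ℕ)
    (F : ℕ → ℕ → M) (hF : ∀ i j, N ≤ i ∨ N ≤ j → F i j = 0) :
    ∑ i ∈ Finset.range N, ∑ j ∈ Finset.range N, F i j =
      ∑ m ∈ Finset.range (2 * N), ∑ p ∈ Finset.HasAntidiagonal.antidiagonal m, F p.1 p.2 := by
  rw [← Finset.sum_product', Finset.sum_sigma']
  refine Finset.sum_of_injOn (fun p => ⟨p.1 + p.2, p⟩) ?_ ?_ ?_ ?_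
  · rintro p - q - h
    simp only [Sigma.mk.injEq] at h
    exact eq_of_heq h.2
  · rintro p hp
    simp only [Finset.coe_product, Finset.coe_range, Set.mem_prod, Set.mem_Iio] at hp
    simp only [Finset.mem_coe, Finset.mem_sigma, Finset.mem_range,
      Finset.HasAntidiagonal.mem_antidiagonal, and_true]
    omega
  · rintro ⟨m, p⟩ hp h
    simp only [Finset.mem_sigma, Finset.mem_range,
      Finset.HasAntidiagonal.mem_antidiagonal] at hp
    refine hF _ _ ?_
    by_contra! hlt
    refine h ⟨p, by simpa using hlt, ?_⟩
    obtain ⟨-, rfl⟩ := hp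
    rfl
  · intro p _
    rfl

variable {k R : Type*} [Field k] [CommRing R] [Algebra k R] (D : Derivation k R R)

/-- The divided powers of a derivation. -/
noncomputable def Derivation.dividedPow (i : ℕ) : R →ₗ[k] R :=
  ((i.factorial : k)⁻¹) • ((D : R →ₗ[k] R) ^ i)

lemma Derivation.dividedPow_zero (a : R) : D.dividedPow 0 a = a := by
  simp [Derivation.dividedPow]

lemma Derivation.dividedPow_algebraMap (c : k) (i : ℕ) :
    D.dividedPow i (algebraMap k R c) = if i = 0 then algebraMap k R c else 0 := by
  rcases i with _ | i
  · simp [Derivation.dividedPow_zero]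
  · simp [Derivation.dividedPow, pow_succ]

/-- Iterates of a continuous map are continuous; the sum of finitely many moduli of continuity
bounds each of them. -/
lemma Derivation.exists_dividedPow_mem {I : ℕ → Ideal R} (hI : Antitone I)
    (hD : ∀ n, ∃ M, ∀ a ∈ I M, D a ∈ I n) (N n : ℕ) :
    ∃ M, ∀ a ∈ I M, ∀ i < N, D.dividedPow i a ∈ I n := by
  have h : ∀ i n, ∃ M, ∀ a ∈ I M, ((D : R →ₗ[k] R) ^ i) a ∈ I n := fun i => by
    induction i with
    | zero => exact fun n => ⟨n, fun a ha => ha⟩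
    | succ i ih =>
      intro n
      obtain ⟨M, hM⟩ := ih n
      obtain ⟨M', hM'⟩ := hD M
      refine ⟨M', fun a ha => ?_⟩
      rw [pow_succ, Module.End.mul_apply]
      exact hM _ (hM' a ha)
  choose M hM using fun i => h i n
  refine ⟨∑ i ∈ Finset.range N, M i, fun a ha i hi => ?_⟩
  have : M i ≤ ∑ i ∈ Finset.range N, M i :=
    Finset.single_le_sum (fun _ _ => Nat.zero_le _) (Finset.mem_range.2 hi)
  rw [Derivation.dividedPow, LinearMap.smul_apply, Algebra.smul_def]
  exact Ideal.mul_mem_left _ _ (hM i a (hI this ha))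

variable [CharZero k]

lemma Derivation.succ_smul_dividedPow (i : ℕ) (a : R) :
    ((i + 1 : ℕ) : k) • D.dividedPow (i + 1) a = D (D.dividedPow i a) := by
  have h : ((i + 1 : ℕ) : k) ≠ 0 := by exact_mod_cast i.succ_ne_zero
  simp only [Derivation.dividedPow, LinearMap.smul_apply, pow_succ', Module.End.mul_apply,
    smul_smul, Nat.factorial_succ, Nat.cast_mul, mul_inv]
  rw [← mul_assoc, mul_inv_cancel₀ h, one_mul]
  exact (D.map_smul _ _).symm

/-- This is what makes the exponential multiplicative. The induction step is multiplied by the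
invertible scalar `i + 1`, which splits as `p.1 + p.2` on the antidiagonal and so matches the two
terms of the Leibniz rule. -/
lemma Derivation.dividedPow_mul (i : ℕ) (a b : R) : D.dividedPow i (a * b) =
    ∑ p ∈ Finset.HasAntidiagonal.antidiagonal i, D.dividedPow p.1 a * D.dividedPow p.2 b := by
  induction i with
  | zero => simp [Derivation.dividedPow_zero]
  | succ i ih =>
    have h : ((i + 1 : ℕ) : k) ≠ 0 := by exact_mod_cast i.succ_ne_zero
    refine (smul_right_injective R h) ?_
    simp only
    rw [D.succ_smul_dividedPow, ih, map_sum, Finset.smul_sum]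
    simp only [Derivation.leibniz, ← D.succ_smul_dividedPow, smul_eq_mul]
    have h1 : ∀ p ∈ Finset.HasAntidiagonal.antidiagonal (i + 1),
        ((i + 1 : ℕ) : k) • (D.dividedPow p.1 a * D.dividedPow p.2 b) =
        ((p.1 : ℕ) : k) • (D.dividedPow p.1 a * D.dividedPow p.2 b) +
        ((p.2 : ℕ) : k) • (D.dividedPow p.1 a * D.dividedPow p.2 b) := fun p hp => by
      rw [← add_smul, ← Nat.cast_add, Finset.HasAntidiagonal.mem_antidiagonal.1 hp]
    rw [Finset.sum_congr rfl h1, Finset.sum_add_distrib, Finset.sum_add_distrib, add_comm]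
    congr 1
    · rw [Finset.Nat.antidiagonal_succ, Finset.sum_cons]
      simp [mul_comm]
    · rw [Finset.Nat.antidiagonal_succ', Finset.sum_cons]
      simp

lemma Derivation.dividedPow_dividedPow (i j : ℕ) (a : R) :
    D.dividedPow i (D.dividedPow j a) = ((i + j).choose i : k) • D.dividedPow (i + j) a := by
  simp only [Derivation.dividedPow, LinearMap.smul_apply, _root_.map_smul, smul_smul]
  rw [← Module.End.mul_apply, ← pow_add]
  congr 1
  have h1 : (i.factorial : k) ≠ 0 := by exact_mod_cast i.factorial_ne_zero
  have h2 : (j.factorial : k) ≠ 0 := by exact_mod_cast j.factorial_ne_zero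
  have h3 : ((i + j).factorial : k) ≠ 0 := by exact_mod_cast (i + j).factorial_ne_zero
  have h4 : (((i + j).choose i * i.factorial * j.factorial : ℕ) : k) = (i + j).factorial := by
    simpa using congrArg (Nat.cast (R := k))
      (Nat.choose_mul_factorial_mul_factorial (Nat.le_add_right i j))
  push_cast at h4
  field_simp
  rw [← h4]
  ring

/-- The exponential of a derivation. -/
noncomputable def Derivation.expSeries : R →ₐ[k] R⟦X⟧ where
  toFun a := PowerSeries.mk fun i => D.dividedPow i a
  map_one' := by
    ext i
    rw [PowerSeries.coeff_mk, ← map_one (algebraMap k R), D.dividedPow_algebraMap,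
      PowerSeries.coeff_one, map_one]
  map_mul' a b := by
    ext i
    rw [PowerSeries.coeff_mk, D.dividedPow_mul, PowerSeries.coeff_mul]
    simp only [PowerSeries.coeff_mk]
  map_zero' := by
    ext i
    rw [PowerSeries.coeff_mk, map_zero, map_zero]
  map_add' a b := by
    ext i
    simp only [PowerSeries.coeff_mk, map_add]
  commutes' c := by
    ext i
    rw [PowerSeries.coeff_mk, D.dividedPow_algebraMap, PowerSeries.algebraMap_apply,
      PowerSeries.coeff_C]

/-- The flow of a derivation. -/
noncomputable def Derivation.flow {B : Type*} [CommRing B] [Algebra k B] (x : R →ₐ[k] B) (s : B)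
    (N : ℕ) (hs : s ^ N = 0) : R →ₐ[k] B :=
  (((PowerSeries.aevalOfPowEqZero (A := B) s N hs).restrictScalars k).comp
    (PowerSeries.mapAlgHom x)).comp D.expSeries

lemma Derivation.flow_apply {B : Type*} [CommRing B] [Algebra k B] (x : R →ₐ[k] B) (s : B)
    (N : ℕ) (hs : s ^ N = 0) (a : R) :
    D.flow x s N hs a = ∑ i ∈ Finset.range N, x (D.dividedPow i a) * s ^ i := by
  change PowerSeries.aevalOfPowEqZero s N hs (PowerSeries.map x.toRingHom (D.expSeries a)) = _
  rw [PowerSeries.aevalOfPowEqZero_apply]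
  refine Finset.sum_congr rfl fun i _ => ?_
  rw [PowerSeries.coeff_map]
  change x (PowerSeries.coeff i (PowerSeries.mk fun i => D.dividedPow i a)) * _ = _
  rw [PowerSeries.coeff_mk]

/-- The exponent only cuts off terms of the exponential series that vanish anyway. Nilpotency
exponents come from arbitrary choices, so they have to be interchangeable. -/
lemma Derivation.flow_apply_of_le {B : Type*} [CommRing B] [Algebra k B] (x : R →ₐ[k] B) (s : B)
    {N M : ℕ} (hs : s ^ N = 0) (hs' : s ^ M = 0) (a : R) :
    D.flow x s N hs a = D.flow x s M hs' a := by
  wlog h : N ≤ M generalizing N M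
  · exact (this hs' hs (le_of_not_ge h)).symm
  rw [D.flow_apply, D.flow_apply]
  refine Finset.sum_subset (Finset.range_mono h) fun i _ hi => ?_
  rw [pow_eq_zero_of_le (by simpa using hi) hs, mul_zero]

/-- The identity `exp(sD) exp(tD) = exp((s+t)D)`, from the binomial theorem and the composition rule
for divided powers. -/
lemma Derivation.flow_flow {B : Type*} [CommRing B] [Algebra k B] (x : R →ₐ[k] B) (s t : B)
    (N : ℕ) (hs : s ^ N = 0) (ht : t ^ N = 0) (hst : (s + t) ^ (2 * N) = 0) (a : R) :
    D.flow (D.flow x s N hs) t N ht a = D.flow x (s + t) (2 * N) hst a := by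
  rw [D.flow_apply]
  simp only [D.flow_apply, Finset.sum_mul]
  rw [Finset.sum_comm, Finset.sum_range_sum_range_eq_sum_antidiagonal]
  · refine Finset.sum_congr rfl fun m _ => ?_
    rw [(Commute.all s t).add_pow', Finset.mul_sum]
    refine Finset.sum_congr rfl fun p hp => ?_
    have hp' := Finset.HasAntidiagonal.mem_antidiagonal.1 hp
    rw [D.dividedPow_dividedPow, hp', _root_.map_smul, Nat.cast_smul_eq_nsmul]
    simp only [nsmul_eq_mul]
    ring
  · rintro i j (h | h)
    · rw [pow_eq_zero_of_le h hs, mul_zero, zero_mul]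
    · rw [pow_eq_zero_of_le h ht, mul_zero]

end Exponential

/-! ### Integrating a derivation to an action -/

section ActionOfDerivation

variable {k R : Type u} [Field k] [CommRing R] [Algebra k R] (D : Derivation k R R) [CharZero k]
  {I : ℕ → Ideal R}

/-- The flow of a continuous derivation acts on formal points. -/
noncomputable def FormalPoint.flow (hI : Antitone I)
    (hD : ∀ n, ∃ M, ∀ a ∈ I M, D a ∈ I n)
    {B : Type*} [CommRing B] [Algebra k B] {𝔫 : Ideal B} (x : FormalPoint k I 𝔫) (s : 𝔫) (N : ℕ)
    (hs : (s : B) ^ N = 0) : FormalPoint k I 𝔫 where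
  hom := D.flow x.hom s N hs
  map_mem a ha := by
    rw [D.flow_apply]
    refine sum_mem fun i _ => ?_
    rcases i with _ | i
    · rw [D.dividedPow_zero, pow_zero, mul_one]
      exact x.map_mem a ha
    · exact Ideal.mul_mem_left _ _ (Ideal.pow_mem_of_mem _ s.2 _ i.succ_pos)
  exists_eq_zero := by
    obtain ⟨M, hM⟩ := x.exists_eq_zero
    obtain ⟨M', hM'⟩ := D.exists_dividedPow_mem hI hD N M
    refine ⟨M', fun a ha => ?_⟩
    rw [D.flow_apply]
    refine Finset.sum_eq_zero fun i hi => ?_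
    rw [hM _ (hM' a ha i (Finset.mem_range.1 hi)), zero_mul]

lemma pow_choose_eq_zero {B : Type*} [CommRing B] {𝔫 : Ideal B} (h : IsNilpotent 𝔫) (s : 𝔫) :
    (s : B) ^ h.choose = 0 := by
  have := Ideal.pow_mem_pow s.2 h.choose
  rwa [h.choose_spec] at this

/-- A continuous derivation taking the value `1` integrates to a smooth action. -/
theorem nonempty_smoothAction_of_derivation (hI : IsCompleteFiltration k I)
    (hD : ∀ n, ∃ M, ∀ a ∈ I M, D a ∈ I n) (f : R) (hf : D f = 1) :
    Nonempty (SmoothAction k I) := by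
  -- Subtracting the value of `f` at the origin does not change its derivative.
  obtain ⟨z, hz, hDz⟩ : ∃ z ∈ I 1, D z = 1 := by
    obtain ⟨c, hc⟩ := hI.exists_const f
    exact ⟨_, hc, by rw [map_sub, hf, D.map_algebraMap, sub_zero]⟩
  refine ⟨{
    act := fun h x s => x.flow D hI.antitone hD s h.choose (pow_choose_eq_zero h s)
    coord := fun h x => ⟨x.hom z, x.map_mem z hz⟩
    act_map := ?_
    coord_map := fun _ _ _ _ _ _ _ _ _ => rfl
    act_zero := ?_
    act_add := ?_
    coord_act := ?_ }⟩
  · intro B _ _ 𝔫 h B' _ _ 𝔫' h' φ hφ x s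
    ext a
    have hs : φ s ^ h.choose = 0 := by rw [← map_pow, pow_choose_eq_zero h s, map_zero]
    refine Eq.trans ?_ (D.flow_apply_of_le _ _ hs _ a)
    change φ (D.flow _ _ _ (pow_choose_eq_zero h s) a) = _
    rw [D.flow_apply, D.flow_apply, map_sum]
    simp
  · intro B _ _ 𝔫 h x
    ext a
    refine (D.flow_apply_of_le _ _ (M := 1) _ (by simp) a).trans ?_
    simp [D.flow_apply, D.dividedPow_zero]
  · intro B _ _ 𝔫 h x s s'
    ext a
    refine (D.flow_flow x.hom s s' _ (pow_choose_eq_zero h s) (pow_choose_eq_zero h s') ?_ a).trans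
      (D.flow_apply_of_le _ _ _ _ a)
    exact pow_eq_zero_of_le (Nat.le_mul_of_pos_left _ two_pos) (pow_choose_eq_zero h (s + s'))
  · intro B _ _ 𝔫 h x s
    refine Subtype.ext ?_
    have h2 : ∀ i, D.dividedPow (i + 2) z = 0 := fun i => by
      simp [Derivation.dividedPow, pow_succ, hDz]
    have h1 : D.dividedPow 1 z = 1 := by simp [Derivation.dividedPow, hDz]
    -- Raising the exponent by two lets the first two terms be split off; the others vanish because
    -- `D (D z) = 0`, leaving `z + s`.
    have hs : (s : B) ^ (h.choose + 2) = 0 :=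
      pow_eq_zero_of_le (Nat.le_add_right _ _) (pow_choose_eq_zero h s)
    refine (D.flow_apply_of_le _ _ _ hs z).trans ?_
    rw [D.flow_apply, Finset.sum_range_succ', Finset.sum_range_succ']
    simp only [zero_add, h1, add_assoc, Nat.reduceAdd, h2]
    simp [D.dividedPow_zero, add_comm]

end ActionOfDerivation

/-! ### Descent of smooth actions from jets in characteristic zero -/

section Descent

open JetRing

/-- The power killing `𝔫` lands in the ideal of dual numbers without constant term, whose square is
zero. Unlike the ideal of elements with coefficients in `𝔫`, this one always contains the generator
`ε`. -/
lemma isNilpotent_comap_constCoeff {k B : Type*} [CommRing k] [CommRing B] [Algebra k B]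
    {𝔫 : Ideal B} (h : IsNilpotent 𝔫) :
    IsNilpotent (𝔫.comap (constCoeff 1 k B)) := by
  obtain ⟨N, hN⟩ := h
  have h1 : (𝔫.comap (constCoeff 1 k B)) ^ N ≤ RingHom.ker (constCoeff 1 k B) := by
    refine (Ideal.le_comap_pow _ _).trans ?_
    rw [hN]
    exact le_rfl
  have h2 : RingHom.ker (constCoeff 1 k B) ^ 2 = ⊥ := by
    rw [pow_two, eq_bot_iff, Ideal.mul_le]
    intro x hx y hy
    rw [RingHom.mem_ker, constCoeff_apply] at hx hy
    refine JetRing.ext fun i hi => ?_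
    have hi' : i ≤ 1 := by exact_mod_cast hi
    rw [JetRing.coeff_mul hi, JetRing.coeff_zero hi]
    interval_cases i <;> simp [Finset.Nat.antidiagonal_succ, hx, hy]
  refine ⟨N * 2, ?_⟩
  rw [pow_mul, Ideal.zero_eq_bot, ← le_bot_iff, ← h2]
  exact Ideal.pow_right_mono h1 2

/-- Scaled by its residue, `u` becomes `1 - v` with `v ∈ I 1`. The geometric series in `v` converges
because `v ^ n ∈ I n`. -/
lemma IsCompleteFiltration.exists_mul_eq_one {k R : Type*} [Field k] [CommRing R] [Algebra k R]
    {I : ℕ → Ideal R} (hI : IsCompleteFiltration k I) {u : R} (hu : u ∉ I 1) :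
    ∃ w, w * u = 1 := by
  obtain ⟨c, hc⟩ := hI.exists_const u
  have hc0 : c ≠ 0 := by
    rintro rfl
    exact hu (by simpa using hc)
  have hcu : algebraMap k R c⁻¹ * algebraMap k R c = 1 := by
    rw [← map_mul, inv_mul_cancel₀ hc0, map_one]
  set v : R := 1 - algebraMap k R c⁻¹ * u with hv
  have hvI : v ∈ I 1 := by
    have : v = -(algebraMap k R c⁻¹ * (u - algebraMap k R c)) := by
      rw [mul_sub, hcu, hv]
      ring
    rw [this]
    exact neg_mem (Ideal.mul_mem_left _ _ hc)
  obtain ⟨w, hw⟩ := hI.complete (fun n => ∑ i ∈ Finset.range n, v ^ i) fun n => by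
    rw [Finset.sum_range_succ, add_sub_cancel_left]
    exact hI.pow_le n (Ideal.pow_mem_pow hvI n)
  refine ⟨w * algebraMap k R c⁻¹, sub_eq_zero.1 (hI.separated _ fun n => ?_)⟩
  have h1 : (∑ i ∈ Finset.range n, v ^ i) * (1 - v) = 1 - v ^ n := geom_sum_mul_neg v n
  have h2 : w * algebraMap k R c⁻¹ * u - 1 =
      (w - ∑ i ∈ Finset.range n, v ^ i) * (1 - v) - v ^ n := by
    rw [sub_mul, h1, hv]
    ring
  rw [h2]
  exact sub_mem (Ideal.mul_mem_right _ _ (hw n)) (hI.pow_le n (Ideal.pow_mem_pow hvI n))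

variable {k : Type u} [Field k] {R R' : Type u} [CommRing R] [Algebra k R]
    [CommRing R'] [Algebra k R'] {n : ℕ∞} {I : ℕ → Ideal R} {I' : ℕ → Ideal R'}
    (hI : IsCompleteFiltration k I) (Θ : JetCorrespondence k n I I') (σ : SmoothAction k I')

/-- The ideal of the dual numbers over `R / I m` of elements whose constant coefficient is in
the augmentation ideal. -/
noncomputable abbrev dualIdeal (k : Type u) [Field k] {R : Type u} [CommRing R] [Algebra k R]
    (I : ℕ → Ideal R) (m : ℕ) : Ideal (JetRing 1 (R ⧸ I m)) :=
  ((I 1).map (Ideal.Quotient.mk (I m))).comap (constCoeff 1 k (R ⧸ I m))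

/-- The generator of the dual numbers. -/
noncomputable def dualGen (k B : Type*) [CommRing k] [CommRing B] [Algebra k B] : JetRing 1 B :=
  JetRing.mk 1 k B PowerSeries.X

lemma coeff_dualGen (k B : Type*) [CommRing k] [CommRing B] [Algebra k B] {i : ℕ} (hi : i ≤ 1) :
    coeff i (dualGen k B) = if i = 1 then 1 else 0 :=
  (coeff_mk k (by exact_mod_cast hi) _).trans (PowerSeries.coeff_X _)

lemma dualGen_mem (m : ℕ) : dualGen k (R ⧸ I m) ∈ dualIdeal k I m := by
  rw [Ideal.mem_comap, constCoeff_apply, coeff_dualGen k _ zero_le_one]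
  simp

lemma map_dualGen {k B B' : Type*} [CommRing k] [CommRing B] [Algebra k B] [CommRing B']
    [Algebra k B'] (φ : B →ₐ[k] B') : JetRing.map 1 φ (dualGen k B) = dualGen k B' := by
  refine JetRing.ext fun i hi => ?_
  have hi' : i ≤ 1 := by exact_mod_cast hi
  rw [coeff_map hi, coeff_dualGen k _ hi', coeff_dualGen k _ hi']
  split_ifs <;> simp

lemma const_mem_dualIdeal (m : ℕ) : ∀ b ∈ (I 1).map (Ideal.Quotient.mk (I m)),
    const 1 k (R ⧸ I m) b ∈ dualIdeal k I m := by
  intro b hb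
  rwa [Ideal.mem_comap, constCoeff_const]

namespace JetCorrespondence

/-- The constant jet over `R / I m`. -/
noncomputable def constPoint (m : ℕ) : FormalPoint k I' ((I 1).map (Ideal.Quotient.mk (I m))) :=
  (Θ.equiv (hI.isNilpotent_map m)).symm ((FormalPoint.taut k I m).map (const n k _)
    fun _ hb => const_mem_coeffIdeal hb)

lemma map_constPoint (m : ℕ) :
    (Θ.constPoint hI (m + 1)).map (hI.transition m) (hI.transition_mem m) = Θ.constPoint hI m := by
  rw [constPoint, Θ.equiv_symm_map _ (hI.isNilpotent_map m)]
  congr 1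
  ext a
  exact map_const _ _

/-- The tangent vector at the constant jet over `R / I m` defined by a smooth action. -/
noncomputable def tangentPoint (m : ℕ) : FormalPoint k I' (dualIdeal k I m) :=
  σ.act (isNilpotent_comap_constCoeff (hI.isNilpotent_map m))
    ((Θ.constPoint hI m).map (const 1 k _) (const_mem_dualIdeal m)) ⟨_, dualGen_mem m⟩

lemma transition_mem_dualIdeal (m : ℕ) : ∀ b ∈ dualIdeal k I (m + 1),
    JetRing.map 1 (hI.transition m) b ∈ dualIdeal k I m := by
  intro b hb
  rw [Ideal.mem_comap, constCoeff_map]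
  exact hI.transition_mem m _ hb

lemma map_tangentPoint (m : ℕ) : (Θ.tangentPoint hI σ (m + 1)).map
    (JetRing.map 1 (hI.transition m)) (transition_mem_dualIdeal hI m) = Θ.tangentPoint hI σ m := by
  rw [tangentPoint, σ.act_map _ (isNilpotent_comap_constCoeff (hI.isNilpotent_map m)), tangentPoint]
  congr 1
  · rw [← Θ.map_constPoint hI m]
    ext a
    exact map_const _ _
  · exact Subtype.ext (map_dualGen _)

lemma constCoeff_mem_of_mem_dualIdeal (m : ℕ) : ∀ b ∈ dualIdeal k I m,
    constCoeff 1 k (R ⧸ I m) b ∈ (I 1).map (Ideal.Quotient.mk (I m)) := fun _ hb => hb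

lemma map_constCoeff_tangentPoint (m : ℕ) : (Θ.tangentPoint hI σ m).map
    (constCoeff 1 k _) (constCoeff_mem_of_mem_dualIdeal m) = Θ.constPoint hI m := by
  rw [tangentPoint, σ.act_map _ (hI.isNilpotent_map m)]
  refine Eq.trans ?_ (σ.act_zero (hI.isNilpotent_map m) _)
  congr 1
  refine Subtype.ext ?_
  change constCoeff 1 k _ (dualGen k _) = 0
  rw [constCoeff_apply, coeff_dualGen k _ zero_le_one]
  simp

/-- The jet over the dual numbers of `R / I m` given by the tangent vector. -/
noncomputable def tangentJet (m : ℕ) : FormalPoint k I (coeffIdeal n (dualIdeal k I m)) :=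
  Θ.equiv (isNilpotent_comap_constCoeff (hI.isNilpotent_map m)) (Θ.tangentPoint hI σ m)

variable {i : ℕ}

/-- Setting `ε = 0` makes the translation trivial and leaves the constant jet. The tangent jet thus
has the form `a ↦ a + ε ∑ D_i(a) t^i`. -/
lemma coeff_zero_coeff_tangentJet (hi : (i : ℕ∞) ≤ n) (m : ℕ) (a : R) :
    coeff 0 (coeff i ((Θ.tangentJet hI σ m).hom a)) =
      if i = 0 then Ideal.Quotient.mk (I m) a else 0 := by
  have h := Θ.equiv_map (isNilpotent_comap_constCoeff (hI.isNilpotent_map m))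
    (hI.isNilpotent_map m) (constCoeff 1 k _) (constCoeff_mem_of_mem_dualIdeal m)
    (Θ.tangentPoint hI σ m)
  rw [map_constCoeff_tangentPoint, constPoint, Equiv.apply_symm_apply] at h
  have h' := congrArg (coeff i) (DFunLike.congr_fun (congrArg FormalPoint.hom h) a)
  refine Eq.trans ?_ (h'.trans ?_)
  · rw [FormalPoint.map_hom, AlgHom.comp_apply, coeff_map hi, constCoeff_apply]
    rfl
  · rw [FormalPoint.map_hom, AlgHom.comp_apply, coeff_const hi]
    rfl

/-- Comparison of the coefficients of `ε t^i` in a product of two expressions `a + ε ∑ D_j(a) t^j`,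
with `ε² = 0`. -/
lemma coeff_one_coeff_mul (hi : (i : ℕ∞) ≤ n) (m : ℕ) (a b : R) :
    coeff 1 (coeff i ((Θ.tangentJet hI σ m).hom (a * b))) =
      Ideal.Quotient.mk (I m) a * coeff 1 (coeff i ((Θ.tangentJet hI σ m).hom b)) +
      Ideal.Quotient.mk (I m) b * coeff 1 (coeff i ((Θ.tangentJet hI σ m).hom a)) := by
  have hle : ∀ j ≤ i, (j : ℕ∞) ≤ n := fun j hj => le_trans (by exact_mod_cast hj) hi
  have hsum : ∀ (s : Finset (ℕ × ℕ)) (F : ℕ × ℕ → JetRing 1 (R ⧸ I m)),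
      coeff 1 (∑ p ∈ s, F p) = ∑ p ∈ s, coeff 1 (F p) := fun s F => by
    induction s using Finset.cons_induction with
    | empty => exact JetRing.coeff_zero (by simp)
    | cons p s hp ih =>
      rw [Finset.sum_cons, Finset.sum_cons, JetRing.coeff_add (by simp), ih]
  rw [map_mul, JetRing.coeff_mul hi, hsum]
  -- The parts free of `ε` are constant in `t`, so only the two ends of the antidiagonal contribute.
  have hterm : ∀ p ∈ Finset.HasAntidiagonal.antidiagonal i,
      coeff 1 (coeff p.1 ((Θ.tangentJet hI σ m).hom a) *
        coeff p.2 ((Θ.tangentJet hI σ m).hom b)) =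
      (if p.1 = 0 then Ideal.Quotient.mk (I m) a *
        coeff 1 (coeff p.2 ((Θ.tangentJet hI σ m).hom b)) else 0) +
      (if p.2 = 0 then Ideal.Quotient.mk (I m) b *
        coeff 1 (coeff p.1 ((Θ.tangentJet hI σ m).hom a)) else 0) := fun p hp => by
    rw [JetRing.coeff_mul (by simp)]
    simp only [Finset.Nat.antidiagonal_succ, Finset.Nat.antidiagonal_zero, Finset.map_singleton,
      Finset.sum_cons, Finset.sum_singleton, Function.Embedding.prodMap,
      Function.Embedding.coeFn_mk,
      Prod.map, Function.Embedding.refl_apply, Nat.succ_eq_add_one, zero_add]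
    rw [Θ.coeff_zero_coeff_tangentJet hI σ (hle _ (Finset.le_of_mem_antidiagonal_left hp)),
      Θ.coeff_zero_coeff_tangentJet hI σ (hle _ (Finset.le_of_mem_antidiagonal_right hp))]
    split_ifs <;> ring
  rw [Finset.sum_congr rfl hterm, Finset.sum_add_distrib]
  congr 1
  · rw [Finset.sum_eq_single_of_mem (0, i) (by simp)]
    · simp
    · intro p hp hne
      refine if_neg fun h => hne ?_
      have := Finset.HasAntidiagonal.mem_antidiagonal.1 hp
      exact Prod.ext h (by simpa [h] using this)
  · rw [Finset.sum_eq_single_of_mem (i, 0) (by simp)]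
    · simp
    · intro p hp hne
      refine if_neg fun h => hne ?_
      have := Finset.HasAntidiagonal.mem_antidiagonal.1 hp
      exact Prod.ext (by simpa [h] using this) h

lemma transition_coeff_one_coeff (hi : (i : ℕ∞) ≤ n) (m : ℕ) (a : R) :
    hI.transition m (coeff 1 (coeff i ((Θ.tangentJet hI σ (m + 1)).hom a))) =
      coeff 1 (coeff i ((Θ.tangentJet hI σ m).hom a)) := by
  have h := Θ.equiv_map (isNilpotent_comap_constCoeff (hI.isNilpotent_map (m + 1)))
    (isNilpotent_comap_constCoeff (hI.isNilpotent_map m)) (JetRing.map 1 (hI.transition m))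
    (transition_mem_dualIdeal hI m) (Θ.tangentPoint hI σ (m + 1))
  rw [map_tangentPoint] at h
  have h' := congrArg (fun x => coeff 1 (coeff i x))
    (DFunLike.congr_fun (congrArg FormalPoint.hom h) a)
  refine Eq.trans ?_ h'
  simp only [FormalPoint.map_hom, AlgHom.comp_apply]
  rw [coeff_map hi, coeff_map (by simp)]
  rfl

/-- The coefficients of `ε t^i` over the different `R / I m` are compatible and glue by
completeness. -/
lemma exists_derivation (hi : (i : ℕ∞) ≤ n) : ∃ D : Derivation k R R, ∀ m a,
    Ideal.Quotient.mk (I m) (D a) = coeff 1 (coeff i ((Θ.tangentJet hI σ m).hom a)) := by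
  choose D hD using fun a => hI.exists_mk_eq
    (fun m => coeff 1 (coeff i ((Θ.tangentJet hI σ m).hom a)))
    fun m => Θ.transition_coeff_one_coeff hI σ hi m a
  refine ⟨Derivation.mk'
    { toFun := D
      map_add' := fun a b => hI.ext_mk fun m => ?_
      map_smul' := fun c a => hI.ext_mk fun m => ?_ } fun a b => hI.ext_mk fun m => ?_,
    fun m a => hD a m⟩
  · rw [map_add (Ideal.Quotient.mk (I m)), hD, hD, hD, map_add, JetRing.coeff_add hi,
      JetRing.coeff_add (by simp)]
  · have : Ideal.Quotient.mk (I m) (c • D a) = c • Ideal.Quotient.mk (I m) (D a) := rfl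
    rw [RingHom.id_apply, this, hD, hD, map_smul, JetRing.coeff_smul hi,
      JetRing.coeff_smul (by simp)]
  · simp only [LinearMap.coe_mk, AddHom.coe_mk, smul_eq_mul]
    rw [map_add, map_mul, map_mul, hD, hD, hD]
    exact Θ.coeff_one_coeff_mul hI σ hi m a b

/-- Otherwise translation by `ε` would fix the constant jet over the residue ring `R / I 1`,
although it increases the coordinate by `ε ≠ 0`. -/
lemma exists_coeff_ne_zero : ∃ i : ℕ, (i : ℕ∞) ≤ n ∧ ∃ a,
    coeff 1 (coeff i ((Θ.tangentJet hI σ 1).hom a)) ≠ 0 := by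
  by_contra! h
  have h1 : Θ.tangentPoint hI σ 1 =
      (Θ.constPoint hI 1).map (const 1 k _) (const_mem_dualIdeal 1) := by
    have hn := isNilpotent_comap_constCoeff (k := k) (hI.isNilpotent_map 1)
    refine (Θ.equiv hn).injective ?_
    rw [← Θ.equiv_map (hI.isNilpotent_map 1) hn, constPoint, Equiv.apply_symm_apply]
    ext a
    refine JetRing.ext fun i hi => JetRing.ext fun j hj => ?_
    have hj' : j ≤ 1 := by exact_mod_cast hj
    simp only [FormalPoint.map_hom, AlgHom.comp_apply]
    rw [coeff_map hi, coeff_const hi, coeff_const hj]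
    interval_cases j
    · exact Θ.coeff_zero_coeff_tangentJet hI σ hi 1 a
    · rw [if_neg one_ne_zero]
      exact h i hi a
  have h2 := congrArg (σ.coord (isNilpotent_comap_constCoeff (hI.isNilpotent_map 1))) h1
  rw [tangentPoint, σ.coord_act, add_eq_left] at h2
  have h3 : dualGen k (R ⧸ I 1) = 0 := congrArg Subtype.val h2
  have h4 := congrArg (coeff 1) h3
  rw [coeff_dualGen k _ le_rfl, if_pos rfl, JetRing.coeff_zero (by simp)] at h4
  have h5 : Ideal.Quotient.mk (I 1) 1 = 0 := h4
  exact hI.one_notMem (Ideal.Quotient.eq_zero_iff_mem.1 h5)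

/-- In characteristic zero a smooth action on jets induces a smooth action on the base. -/
theorem nonempty_smoothAction [CharZero k] (hI : IsCompleteFiltration k I)
    (Θ : JetCorrespondence k n I I') (σ : SmoothAction k I') : Nonempty (SmoothAction k I) := by
  obtain ⟨i, hi, f, hf⟩ := Θ.exists_coeff_ne_zero hI σ
  obtain ⟨D, hD⟩ := Θ.exists_derivation hI σ hi
  have hDf : D f ∉ I 1 := fun h => hf ((hD 1 f).symm.trans (Ideal.Quotient.eq_zero_iff_mem.2 h))
  obtain ⟨w, hw⟩ := hI.exists_mul_eq_one hDf
  refine nonempty_smoothAction_of_derivation (w • D) hI (fun m => ?_) f hw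
  -- Continuity of `D`: its reduction modulo `I m` is read off from a formal point, which kills some
  -- `I M`.
  obtain ⟨M, hM⟩ := (Θ.tangentJet hI σ m).exists_eq_zero
  refine ⟨M, fun a ha => Ideal.mul_mem_left _ w (Ideal.Quotient.eq_zero_iff_mem.1 ?_)⟩
  refine (hD m a).trans ?_
  rw [hM a ha, JetRing.coeff_zero hi, JetRing.coeff_zero (by simp)]

end JetCorrespondence

end Descent

/-! ### Adic completions -/

section AdicFiltration

namespace AdicFiltration

open AdicCompletion (evalₐ evalₐ_mk evalₐ_of ext_evalₐ mk mk_surjective AdicCauchySequence)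

variable {O : Type*} [CommRing O] (𝔪 : Ideal O)

/-- The kernels of the projections from the adic completion. -/
noncomputable def filtration (n : ℕ) : Ideal (AdicCompletion 𝔪 O) := RingHom.ker (evalₐ 𝔪 n)

variable {𝔪}

lemma mem_filtration_iff_eval {n : ℕ} (a b : AdicCompletion 𝔪 O) :
    b - a ∈ filtration 𝔪 n ↔ AdicCompletion.eval 𝔪 O n b = AdicCompletion.eval 𝔪 O n a := by
  have h : (𝔪 ^ n • ⊤ : Ideal O) = 𝔪 ^ n := by ext x; simp
  change evalₐ 𝔪 n (b - a) = 0 ↔ _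
  rw [map_sub, sub_eq_zero]
  exact (Ideal.quotientEquivAlgOfEq O h).injective.eq_iff

lemma mem_filtration {n : ℕ} {a : AdicCompletion 𝔪 O} :
    a ∈ filtration 𝔪 n ↔ evalₐ 𝔪 n a = 0 := Iff.rfl

lemma evalₐ_eq_mk_of_le {m n : ℕ} (h : m ≤ n) {a : AdicCompletion 𝔪 O} {o : O}
    (ha : evalₐ 𝔪 n a = Ideal.Quotient.mk _ o) : evalₐ 𝔪 m a = Ideal.Quotient.mk _ o := by
  obtain ⟨x, rfl⟩ := mk_surjective 𝔪 O a
  rw [evalₐ_mk, Ideal.Quotient.eq] at ha ⊢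
  have h1 : x.val m - x.val n ∈ 𝔪 ^ m := by
    simpa using SModEq.sub_mem.1 (x.2 h)
  have := add_mem h1 (Ideal.pow_le_pow_right h ha)
  simpa using this

lemma sub_algebraMap_mem_filtration_iff {n : ℕ} {a : AdicCompletion 𝔪 O} {o : O} :
    a - algebraMap O _ o ∈ filtration 𝔪 n ↔ evalₐ 𝔪 n a = Ideal.Quotient.mk _ o := by
  rw [mem_filtration, map_sub, sub_eq_zero]
  exact Iff.rfl

lemma exists_sub_algebraMap_mem_filtration (n : ℕ) (a : AdicCompletion 𝔪 O) :
    ∃ o, a - algebraMap O _ o ∈ filtration 𝔪 n := by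
  obtain ⟨o, ho⟩ := Ideal.Quotient.mk_surjective (evalₐ 𝔪 n a)
  exact ⟨o, sub_algebraMap_mem_filtration_iff.2 ho.symm⟩

lemma filtration_antitone : Antitone (filtration 𝔪) := by
  intro m n h a ha
  have := evalₐ_eq_mk_of_le h (o := 0) (a := a) (by rw [map_zero]; exact ha)
  rwa [map_zero] at this

lemma mem_of_evalₐ_eq_mk {n : ℕ} (hn : n ≠ 0) {a : AdicCompletion 𝔪 O} (ha : a ∈ filtration 𝔪 1)
    {o : O} (ho : evalₐ 𝔪 n a = Ideal.Quotient.mk _ o) : o ∈ 𝔪 := by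
  have := evalₐ_eq_mk_of_le (Nat.one_le_iff_ne_zero.2 hn) ho
  rw [mem_filtration.1 ha, eq_comm, Ideal.Quotient.eq_zero_iff_mem, pow_one] at this
  exact this

/-- At a level `n ≠ 0`, elements of the first step are represented by elements of `𝔪`, so their
`n`-fold products vanish in `O / 𝔪 ^ n`. Level zero carries no information and is treated apart. -/
lemma filtration_pow_le (n : ℕ) : filtration 𝔪 1 ^ n ≤ filtration 𝔪 n := by
  rcases eq_or_ne n 0 with rfl | hn
  · intro a _
    have : Subsingleton (O ⧸ 𝔪 ^ 0) := Ideal.Quotient.subsingleton_iff.2 (by simp)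
    exact Subsingleton.elim (evalₐ 𝔪 0 a) 0
  · have h : filtration 𝔪 1 ≤ (𝔪.map (Ideal.Quotient.mk (𝔪 ^ n))).comap (evalₐ 𝔪 n) := by
      intro a ha
      obtain ⟨o, ho⟩ := Ideal.Quotient.mk_surjective (evalₐ 𝔪 n a)
      rw [Ideal.mem_comap, ← ho]
      exact Ideal.mem_map_of_mem _ (mem_of_evalₐ_eq_mk hn ha ho.symm)
    refine (Ideal.pow_right_mono h n).trans ((Ideal.le_comap_pow _ _).trans ?_)
    rw [← Ideal.map_pow, Ideal.map_quotient_self]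
    exact le_rfl

variable {k : Type*} [Field k] [Algebra k O]

lemma algebraMap_algebraMap (c : k) :
    algebraMap O (AdicCompletion 𝔪 O) (algebraMap k O c) = algebraMap k _ c := by
  rw [AdicCompletion.algebraMap_apply, AdicCompletion.algebraMap_apply]
  rfl

lemma isCompleteFiltration (h1 : 1 ∉ 𝔪) (hk : ∀ a : O, ∃ c : k, a - algebraMap k O c ∈ 𝔪) :
    IsCompleteFiltration k (filtration 𝔪) where
  antitone := filtration_antitone
  pow_le := filtration_pow_le
  separated a ha := ext_evalₐ fun n => (ha n).trans (map_zero _).symm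
  complete a ha := by
    -- Approximating each `a n` modulo its own step by an element of `O` gives a Cauchy sequence,
    -- whose class is the limit.
    choose o ho using fun n => exists_sub_algebraMap_mem_filtration n (a n)
    have h : ∀ n, o n ≡ o (n + 1) [SMOD (𝔪 ^ n • ⊤ : Submodule O O)] := fun n => by
      rw [SModEq.sub_mem]
      have h1 : a n - algebraMap O _ (o (n + 1)) ∈ filtration 𝔪 n := by
        have := sub_mem (filtration_antitone n.le_succ (ho (n + 1))) (ha n)
        rwa [sub_right_comm, sub_sub_cancel] at this
      have h2 := (sub_algebraMap_mem_filtration_iff.1 (ho n)).symm.trans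
        (sub_algebraMap_mem_filtration_iff.1 h1)
      simpa using Ideal.Quotient.eq.1 h2
    refine ⟨mk 𝔪 O (AdicCauchySequence.mk 𝔪 O o h), fun n => ?_⟩
    rw [mem_filtration, map_sub, sub_eq_zero, evalₐ_mk,
      sub_algebraMap_mem_filtration_iff.1 (ho n)]
    rfl
  exists_const a := by
    obtain ⟨o, ho⟩ := exists_sub_algebraMap_mem_filtration 1 a
    obtain ⟨c, hc⟩ := hk o
    refine ⟨c, ?_⟩
    have : algebraMap O (AdicCompletion 𝔪 O) (o - algebraMap k O c) ∈ filtration 𝔪 1 := by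
      rw [mem_filtration, AlgHom.commutes]
      exact Ideal.Quotient.eq_zero_iff_mem.2 (by rwa [pow_one])
    have h := add_mem ho this
    rwa [map_sub, sub_add_sub_cancel, algebraMap_algebraMap] at h
  one_notMem h := by
    rw [mem_filtration, map_one, ← map_one (Ideal.Quotient.mk (𝔪 ^ 1)),
      Ideal.Quotient.eq_zero_iff_mem, pow_one] at h
    exact h1 h

variable (k 𝔪) in
/-- The completion map. -/
noncomputable def ofAlgHom : O →ₐ[k] AdicCompletion 𝔪 O :=
  AlgHom.mk (algebraMap O (AdicCompletion 𝔪 O)) fun c => algebraMap_algebraMap c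

lemma evalₐ_ofAlgHom (n : ℕ) (o : O) : evalₐ 𝔪 n (ofAlgHom 𝔪 k o) = Ideal.Quotient.mk _ o :=
  evalₐ_of 𝔪 n o

lemma exists_sub_ofAlgHom_mem_filtration (n : ℕ) (a : AdicCompletion 𝔪 O) :
    ∃ o, a - ofAlgHom 𝔪 k o ∈ filtration 𝔪 n :=
  exists_sub_algebraMap_mem_filtration n a

lemma ofAlgHom_mem {o : O} (ho : o ∈ 𝔪) : ofAlgHom 𝔪 k o ∈ filtration 𝔪 1 := by
  rw [mem_filtration, evalₐ_ofAlgHom, Ideal.Quotient.eq_zero_iff_mem, pow_one]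
  exact ho

/-- The formal points of the completion are the local homomorphisms. -/
noncomputable def formalPointEquiv {B : Type*} [CommRing B] [Algebra k B] {𝔫 : Ideal B}
    (h𝔫 : IsNilpotent 𝔫) :
    FormalPoint k (filtration 𝔪) 𝔫 ≃ {f : O →ₐ[k] B // ∀ a ∈ 𝔪, f a ∈ 𝔫} :=
  Equiv.ofBijective
    (fun x => ⟨x.hom.comp (ofAlgHom 𝔪 k), fun a ha => x.map_mem _ (ofAlgHom_mem (k := k) ha)⟩) <| by
    constructor
    · intro x y hxy
      have hxy' : ∀ o, x.hom (ofAlgHom 𝔪 k o) = y.hom (ofAlgHom 𝔪 k o) := fun o =>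
        DFunLike.congr_fun (congrArg Subtype.val hxy) o
      obtain ⟨M, hM⟩ := x.exists_eq_zero
      obtain ⟨M', hM'⟩ := y.exists_eq_zero
      ext a
      -- Both points kill a common step, modulo which `a` comes from `O`.
      obtain ⟨o, ho⟩ := exists_sub_ofAlgHom_mem_filtration (k := k) (max M M') a
      have h1 := hM _ (filtration_antitone (le_max_left _ _) ho)
      have h2 := hM' _ (filtration_antitone (le_max_right _ _) ho)
      rw [map_sub, sub_eq_zero] at h1 h2
      rw [h1, h2, hxy']
    · rintro ⟨f, hf⟩
      obtain ⟨N, hN⟩ := h𝔫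
      -- The exponent `N + 1` instead of `N` ensures a nonzero level, at which membership in the
      -- first step is still visible.
      have hfN : ∀ a ∈ 𝔪 ^ (N + 1), f a = 0 := fun a ha => by
        have h1 : 𝔪 ≤ 𝔫.comap f := hf
        have h2 := (Ideal.pow_right_mono h1 (N + 1)).trans (Ideal.le_comap_pow _ _) ha
        have h3 : 𝔫 ^ (N + 1) = ⊥ := by rw [pow_succ, hN, zero_mul]; rfl
        rw [h3] at h2
        exact h2
      let F : AdicCompletion 𝔪 O →ₐ[k] B :=
        { ((Ideal.Quotient.liftₐ (𝔪 ^ (N + 1)) f hfN).toRingHom.comp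
            (evalₐ 𝔪 (N + 1)).toRingHom) with
          commutes' := fun c => by
            refine Eq.trans ?_ (f.commutes c)
            change Ideal.Quotient.liftₐ (𝔪 ^ (N + 1)) f hfN (evalₐ 𝔪 (N + 1) (algebraMap k _ c)) = _
            rw [← algebraMap_algebraMap, AlgHom.commutes]
            rfl }
      refine ⟨⟨F, fun a ha => ?_, N + 1, fun a ha => ?_⟩, ?_⟩
      · obtain ⟨o, ho⟩ := Ideal.Quotient.mk_surjective (evalₐ 𝔪 (N + 1) a)
        change Ideal.Quotient.liftₐ (𝔪 ^ (N + 1)) f hfN (evalₐ 𝔪 (N + 1) a) ∈ 𝔫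
        rw [← ho]
        exact hf o (mem_of_evalₐ_eq_mk N.succ_ne_zero ha ho.symm)
      · change Ideal.Quotient.liftₐ (𝔪 ^ (N + 1)) f hfN (evalₐ 𝔪 (N + 1) a) = 0
        rw [mem_filtration.1 ha, map_zero]
      · refine Subtype.ext (AlgHom.ext fun o => ?_)
        change Ideal.Quotient.liftₐ (𝔪 ^ (N + 1)) f hfN
          (evalₐ 𝔪 (N + 1) (ofAlgHom 𝔪 k o)) = f o
        rw [evalₐ_ofAlgHom]
        rfl

lemma formalPointEquiv_apply {B : Type*} [CommRing B] [Algebra k B] {𝔫 : Ideal B}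
    (h𝔫 : IsNilpotent 𝔫) (x : FormalPoint k (filtration 𝔪) 𝔫) :
    (formalPointEquiv h𝔫 x).1 = x.hom.comp (ofAlgHom 𝔪 k) := rfl

end AdicFiltration

variable {k : Type u} [Field k] (X : Over (Spec (.of k))) (p : X.left)

open AdicFiltration in
lemma CompletedStalk.hasBasis_nhds (a : CompletedStalk X p) :
    (nhds a).HasBasis (fun _ => True)
      fun n => {b | b - a ∈ filtration (IsLocalRing.maximalIdeal (X.left.presheaf.stalk p)) n} := by
  have h : nhds a = ⨅ n, Filter.principal
      {b | b - a ∈ filtration (IsLocalRing.maximalIdeal (X.left.presheaf.stalk p)) n} := by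
    rw [nhds_iInf]
    refine iInf_congr fun n => ?_
    rw [@nhds_induced _ _ ⊥, @nhds_discrete _ ⊥ (@DiscreteTopology.mk _ ⊥ rfl),
      ← Filter.principal_singleton, Filter.comap_principal]
    congr 1
    ext b
    exact (mem_filtration_iff_eval _ _).symm
  rw [h]
  refine Filter.hasBasis_iInf_principal fun m n => ⟨max m n, ?_, ?_⟩
  · exact fun b hb => filtration_antitone (le_max_left m n) hb
  · exact fun b hb => filtration_antitone (le_max_right m n) hb

lemma CompletedStalk.isTopologicalRing : IsTopologicalRing (CompletedStalk X p) where
  continuous_add := by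
    refine continuous_iff_continuousAt.2 fun ⟨a, b⟩ => ?_
    refine ((hasBasis_nhds X p a).prod_nhds (hasBasis_nhds X p b)).tendsto_iff
      (hasBasis_nhds X p (a + b)) |>.2 fun n _ => ⟨(n, n), ⟨trivial, trivial⟩, ?_⟩
    rintro ⟨a', b'⟩ ⟨ha, hb⟩
    rw [Set.mem_ofPred_eq] at ha hb
    have := add_mem ha hb
    rwa [sub_add_sub_comm] at this
  continuous_mul := by
    refine continuous_iff_continuousAt.2 fun ⟨a, b⟩ => ?_
    refine ((hasBasis_nhds X p a).prod_nhds (hasBasis_nhds X p b)).tendsto_iff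
      (hasBasis_nhds X p (a * b)) |>.2 fun n _ => ⟨(n, n), ⟨trivial, trivial⟩, ?_⟩
    rintro ⟨a', b'⟩ ⟨ha, hb⟩
    rw [Set.mem_ofPred_eq] at ha hb
    have := add_mem (Ideal.mul_mem_left _ a' hb) (Ideal.mul_mem_right b _ ha)
    rwa [mul_sub, sub_mul, sub_add_sub_cancel] at this
  continuous_neg := by
    refine continuous_iff_continuousAt.2 fun a => ?_
    refine (hasBasis_nhds X p a).tendsto_iff (hasBasis_nhds X p (-a)) |>.2
      fun n _ => ⟨n, trivial, fun b hb => ?_⟩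
    rw [Set.mem_ofPred_eq] at hb
    have := neg_mem hb
    rwa [neg_sub, ← neg_sub_neg] at this

end AdicFiltration

/-! ### Affine points of schemes over a field -/

section AffinePoints

variable {k : Type u} [Field k]

/-- The spectrum of a `k`-algebra as a `k`-scheme. -/
noncomputable def SpecOver (k B : Type u) [Field k] [CommRing B] [Algebra k B] :
    Over (Spec (.of k)) :=
  Over.mk (Spec.map (CommRingCat.ofHom (algebraMap k B)))

variable {B B' B'' : Type u} [CommRing B] [Algebra k B] [CommRing B'] [Algebra k B']
  [CommRing B''] [Algebra k B'']

/-- The morphism of spectra given by a homomorphism of algebras. -/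
noncomputable def SpecOver.map (φ : B →ₐ[k] B') : SpecOver k B' ⟶ SpecOver k B :=
  Over.homMk (Spec.map (CommRingCat.ofHom φ.toRingHom)) <| by
    simp only [SpecOver, Over.mk_left, Over.mk_hom, ← Spec.map_comp, ← CommRingCat.ofHom_comp]
    exact congrArg _ (congrArg _ φ.comp_algebraMap)

lemma SpecOver.map_comp (φ : B →ₐ[k] B') (ψ : B' →ₐ[k] B'') :
    SpecOver.map (ψ.comp φ) = SpecOver.map ψ ≫ SpecOver.map φ := by
  ext1
  exact Spec.map_comp (CommRingCat.ofHom φ.toRingHom) (CommRingCat.ofHom ψ.toRingHom)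

variable {X : Over (Spec (.of k))}

lemma Spec_map_algebraMap_stalk (p : X.left) :
    Spec.map (CommRingCat.ofHom (algebraMap k (X.left.presheaf.stalk p))) =
      X.left.fromSpecStalk p ≫ X.hom :=
  Spec.map_preimage (X.left.fromSpecStalk p ≫ X.hom)

/-- The morphism to `X` given by a homomorphism from a local ring of `X`. -/
noncomputable def SpecOver.toHom (p : X.left) (f : X.left.presheaf.stalk p →ₐ[k] B) :
    SpecOver k B ⟶ X :=
  Over.homMk (Spec.map (CommRingCat.ofHom f.toRingHom) ≫ X.left.fromSpecStalk p) <| by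
    simp only [SpecOver, Over.mk_left, Over.mk_hom]
    rw [Category.assoc, ← Spec_map_algebraMap_stalk, ← Spec.map_comp, ← CommRingCat.ofHom_comp]
    exact congrArg _ (congrArg _ f.comp_algebraMap)

lemma SpecOver.map_toHom (p : X.left) (f : X.left.presheaf.stalk p →ₐ[k] B) (φ : B →ₐ[k] B') :
    SpecOver.map φ ≫ SpecOver.toHom p f = SpecOver.toHom p (φ.comp f) := by
  ext1
  change Spec.map (CommRingCat.ofHom φ.toRingHom) ≫ Spec.map (CommRingCat.ofHom f.toRingHom) ≫ _ =
    Spec.map (CommRingCat.ofHom f.toRingHom ≫ CommRingCat.ofHom φ.toRingHom) ≫ _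
  rw [Spec.map_comp, Category.assoc]

lemma SpecOver.toHom_injective (p : X.left) :
    Function.Injective (SpecOver.toHom p : (X.left.presheaf.stalk p →ₐ[k] B) → _) := by
  intro f g h
  have h1 : Spec.map (CommRingCat.ofHom f.toRingHom) ≫ X.left.fromSpecStalk p =
    Spec.map (CommRingCat.ofHom g.toRingHom) ≫ X.left.fromSpecStalk p := congrArg Over.Hom.left h
  have h2 := Spec.map_injective ((cancel_mono _).1 h1)
  exact AlgHom.ext fun a => congrArg (fun φ => φ.hom a) h2

variable (x : Over.mk (𝟙 (Spec (.of k))) ⟶ X)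

/-- The constant morphism with value a rational point. -/
noncomputable def constMap (T : Over (Spec (.of k))) : T ⟶ X := Over.mkIdTerminal.from T ≫ x

lemma comp_constMap {T T' : Over (Spec (.of k))} (f : T ⟶ T') :
    f ≫ constMap x T' = constMap x T := by
  rw [constMap, constMap, ← Category.assoc]
  congr 1
  exact Over.mkIdTerminal.hom_ext _ _

/-- Evaluation of germs at a rational point, as a morphism. -/
noncomputable def stalkEvalHom : X.left.presheaf.stalk (pointOf x) ⟶ .of k :=
  Scheme.stalkClosedPointTo (R := .of k) x.left

lemma Spec_map_stalkEvalHom :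
    Spec.map (stalkEvalHom x) ≫ X.left.fromSpecStalk (pointOf x) = x.left :=
  Scheme.Spec_stalkClosedPointTo_fromSpecStalk (R := .of k) x.left

instance isLocalHom_stalkEvalHom : IsLocalHom (stalkEvalHom x).hom :=
  Scheme.isLocalHom_stalkClosedPointTo (R := .of k) (f := x.left)

/-- Evaluation of germs at a rational point. -/
noncomputable def stalkEval : X.left.presheaf.stalk (pointOf x) →ₐ[k] k :=
  { (stalkEvalHom x).hom with
    commutes' := fun c => by
      have h : Spec.map (CommRingCat.ofHom (algebraMap k (X.left.presheaf.stalk (pointOf x))) ≫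
          stalkEvalHom x) = Spec.map (𝟙 _) := by
        rw [Spec.map_comp, Spec_map_algebraMap_stalk, ← Category.assoc, Spec_map_stalkEvalHom,
          Spec.map_id]
        exact Over.w x
      exact congrArg (fun φ => φ.hom c) (Spec.map_injective h) }

lemma mem_maximalIdeal_stalk_iff (a : X.left.presheaf.stalk (pointOf x)) :
    a ∈ IsLocalRing.maximalIdeal (X.left.presheaf.stalk (pointOf x)) ↔ stalkEval x a = 0 := by
  rw [IsLocalRing.mem_maximalIdeal, mem_nonunits_iff, ← not_iff_not, not_not]
  change _ ↔ stalkEval x a ≠ 0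
  rw [← isUnit_iff_ne_zero]
  exact (isUnit_map_iff (stalkEvalHom x).hom a).symm

lemma exists_sub_algebraMap_mem_maximalIdeal_stalk (a : X.left.presheaf.stalk (pointOf x)) :
    ∃ c : k, a - algebraMap k _ c ∈
      IsLocalRing.maximalIdeal (X.left.presheaf.stalk (pointOf x)) :=
  ⟨stalkEval x a, by
    rw [mem_maximalIdeal_stalk_iff, map_sub, AlgHom.commutes]
    exact sub_self _⟩

lemma constMap_specOver :
    constMap x (SpecOver k B) = SpecOver.toHom (pointOf x) ((Algebra.ofId k B).comp
      (stalkEval x)) := by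
  ext1
  change (Over.mkIdTerminal.from (SpecOver k B)).left ≫ x.left =
    Spec.map (stalkEvalHom x ≫ CommRingCat.ofHom (algebraMap k B)) ≫ _
  rw [Spec.map_comp, Category.assoc, Spec_map_stalkEvalHom]
  congr 1
  exact (Category.comp_id _).symm.trans (Over.w (Over.mkIdTerminal.from (SpecOver k B)))

/-- At a rational point every germ is a constant plus an element of the maximal ideal, so a
homomorphism killing this ideal is evaluation at the point. -/
lemma toHom_eq_constMap_iff (f : X.left.presheaf.stalk (pointOf x) →ₐ[k] B) :
    SpecOver.toHom (pointOf x) f = constMap x _ ↔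
      ∀ a ∈ IsLocalRing.maximalIdeal (X.left.presheaf.stalk (pointOf x)), f a = 0 := by
  rw [constMap_specOver, (SpecOver.toHom_injective _).eq_iff]
  constructor
  · rintro rfl a ha
    rw [AlgHom.comp_apply, (mem_maximalIdeal_stalk_iff x a).1 ha, map_zero]
  · intro h
    refine AlgHom.ext fun a => ?_
    obtain ⟨c, hc⟩ := exists_sub_algebraMap_mem_maximalIdeal_stalk x a
    have h1 := h _ hc
    rw [map_sub, sub_eq_zero, AlgHom.commutes] at h1
    rw [mem_maximalIdeal_stalk_iff, map_sub, sub_eq_zero, AlgHom.commutes] at hc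
    rw [h1, AlgHom.comp_apply, hc]
    exact (AlgHom.commutes _ _).symm

/-- A morphism from an affine scheme which maps everything to one point factors through the
local ring. -/
lemma exists_specMap_comp_fromSpecStalk_eq {Y : Scheme.{u}} (p : Y) {A : CommRingCat.{u}}
    (g : Spec A ⟶ Y) (hg : ∀ q, g q = p) :
    ∃ χ : Y.presheaf.stalk p ⟶ A, Spec.map χ ≫ Y.fromSpecStalk p = g := by
  obtain ⟨U, hU, hpU, -⟩ := exists_isAffineOpen_mem_and_subset (x := p) (U := ⊤) trivial
  have hr : Set.range g ⊆ Set.range hU.fromSpec := by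
    rw [hU.range_fromSpec]
    rintro _ ⟨q, rfl⟩
    rw [hg q]
    exact hpU
  obtain ⟨ψ, hψ⟩ := Spec.map_surjective (IsOpenImmersion.lift hU.fromSpec g hr)
  have hψg : Spec.map ψ ≫ hU.fromSpec = g := by rw [hψ, IsOpenImmersion.lift_fac]
  let _ := Y.presheaf.algebra_section_stalk ⟨p, hpU⟩
  have hloc := hU.isLocalization_stalk ⟨p, hpU⟩
  -- A maximal ideal of `A` containing the image of `s` is a point of `Spec A`, so it maps to `p`,
  -- and then `s` would lie in the prime of `p`.
  have hunit : ∀ s : (hU.primeIdealOf ⟨p, hpU⟩).asIdeal.primeCompl, IsUnit (ψ.hom s) := by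
    rintro ⟨s, hs⟩
    by_contra hu
    obtain ⟨M, hM, hsM⟩ := exists_max_ideal_of_mem_nonunits hu
    let q : Spec A := ⟨M, hM.isPrime⟩
    have hq : Spec.map ψ q = hU.primeIdealOf ⟨p, hpU⟩ := by
      apply hU.fromSpec.isOpenEmbedding.injective
      rw [hU.fromSpec_primeIdealOf, ← Scheme.Hom.comp_apply, hψg, hg]
    have hsq : s ∈ (Spec.map ψ q).asIdeal := hsM
    rw [hq] at hsq
    exact hs hsq
  obtain ⟨χ, hχ⟩ : ∃ χ : Y.presheaf.stalk p ⟶ A, Y.presheaf.germ U p hpU ≫ χ = ψ :=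
    ⟨CommRingCat.ofHom (IsLocalization.lift (S := Y.presheaf.stalk (⟨p, hpU⟩ : U).1) hunit),
      CommRingCat.hom_ext (RingHom.ext fun s =>
        IsLocalization.lift_eq (S := Y.presheaf.stalk (⟨p, hpU⟩ : U).1) hunit s)⟩
  refine ⟨χ, ?_⟩
  rw [← hU.fromSpecStalk_eq_fromSpecStalk hpU, IsAffineOpen.fromSpecStalk, ← Category.assoc,
    ← Spec.map_comp, hχ, hψg]

/-- A nilpotent kernel does not change the underlying space, so `g` sends every point to the base
point and factors through its local ring. -/
lemma exists_toHom_eq {φ : B →ₐ[k] B'} (hφ : Function.Surjective φ)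
    (hker : IsNilpotent (RingHom.ker φ)) (g : SpecOver k B ⟶ X)
    (hg : SpecOver.map φ ≫ g = constMap x _) :
    ∃ f : X.left.presheaf.stalk (pointOf x) →ₐ[k] B, SpecOver.toHom (pointOf x) f = g ∧
      ∀ a ∈ IsLocalRing.maximalIdeal (X.left.presheaf.stalk (pointOf x)), φ (f a) = 0 := by
  have hpt : ∀ q, g.left q = pointOf x := by
    intro q
    have hq : q ∈ Set.range (Spec.map (CommRingCat.ofHom φ.toRingHom)) := by
      change q ∈ Set.range (PrimeSpectrum.comap φ.toRingHom)
      rw [range_comap_of_surjective _ _ hφ]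
      intro a ha
      obtain ⟨N, hN⟩ := hker
      have : a ^ N ∈ RingHom.ker φ ^ N := Ideal.pow_mem_pow ha N
      rw [hN] at this
      have h0 : a ^ N = 0 := this
      exact q.2.mem_of_pow_mem N (h0 ▸ zero_mem _)
    obtain ⟨q', rfl⟩ := hq
    have h1 : Spec.map (CommRingCat.ofHom φ.toRingHom) ≫ g.left =
        (Over.mkIdTerminal.from (SpecOver k B')).left ≫ x.left := congrArg Over.Hom.left hg
    refine (congrArg (fun f : Spec (.of B') ⟶ X.left => f q') h1).trans ?_
    exact congrArg x.left (Subsingleton.elim (α := PrimeSpectrum k) _ _)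
  obtain ⟨χ, hχ⟩ := exists_specMap_comp_fromSpecStalk_eq (pointOf x) (A := .of B) g.left hpt
  let f : X.left.presheaf.stalk (pointOf x) →ₐ[k] B :=
    { χ.hom with
      commutes' := fun c => by
        have h : Spec.map (CommRingCat.ofHom (algebraMap k (X.left.presheaf.stalk (pointOf x))) ≫
            χ) = Spec.map (CommRingCat.ofHom (algebraMap k B)) := by
          rw [Spec.map_comp, Spec_map_algebraMap_stalk, ← Category.assoc, hχ]
          exact Over.w g
        exact congrArg (fun φ => φ.hom c) (Spec.map_injective h) }
  have hf : SpecOver.toHom (pointOf x) f = g := by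
    ext1
    exact hχ
  refine ⟨f, hf, ?_⟩
  rw [← hf, SpecOver.map_toHom, toHom_eq_constMap_iff] at hg
  exact hg

end AffinePoints

/-! ### Components of jets and arcs -/

section JetComponents

attribute [local instance] CategoryTheory.Over.cartesianMonoidalCategory

variable {k : Type u} [Field k] {X Y Y' : Over (Spec (.of k))}

lemma truncPolyMap_mk {l m : ℕ} (h : l ≤ m) (p : Polynomial k) :
    truncPolyMap k h (Ideal.Quotient.mk _ p) = Ideal.Quotient.mk _ p := rfl

lemma truncPolyMap_comp {l m N : ℕ} (h : l ≤ m) (h' : m ≤ N) :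
    (truncPolyMap k h).comp (truncPolyMap k h') = truncPolyMap k (h.trans h') := by
  refine AlgHom.ext fun t => ?_
  obtain ⟨p, rfl⟩ := Ideal.Quotient.mk_surjective t
  rw [AlgHom.comp_apply, truncPolyMap_mk, truncPolyMap_mk, truncPolyMap_mk]

lemma fatPointMap_refl (m : ℕ) : fatPointMap k (le_refl m) = 𝟙 _ := by
  ext1
  have h : truncPolyMap k (le_refl m) = AlgHom.id k _ := by
    refine AlgHom.ext fun t => ?_
    obtain ⟨p, rfl⟩ := Ideal.Quotient.mk_surjective t
    rw [truncPolyMap_mk, AlgHom.id_apply]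
  change Spec.map (CommRingCat.ofHom (truncPolyMap k (le_refl m)).toRingHom) = 𝟙 _
  rw [h]
  exact Spec.map_id _

lemma fatPointMap_comp {l m N : ℕ} (h : l ≤ m) (h' : m ≤ N) :
    fatPointMap k h ≫ fatPointMap k h' = fatPointMap k (h.trans h') := by
  have h1 := SpecOver.map_comp (truncPolyMap k h') (truncPolyMap k h)
  rw [truncPolyMap_comp] at h1
  exact h1.symm

/-- The `m`-jets underlying an `n`-jet, for `m ≤ n`. -/
noncomputable def jetComponent : ∀ {n : ℕ∞} (_ : (jetArcFunctor X n).obj (op Y)) (m : ℕ),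
    (m : ℕ∞) ≤ n → (Y ⊗ fatPoint k m ⟶ X)
  | (_ : ℕ), γ, m, hm =>
    (Y ◁ fatPointMap k (show m ≤ _ by exact_mod_cast hm)) ≫ (show Y ⊗ fatPoint k _ ⟶ X from γ)
  | ⊤, γ, m, _ => (show (arcFunctor X).obj (op Y) from γ).1 m

lemma jetComponent_map {n : ℕ∞} (f : Y' ⟶ Y) (γ : (jetArcFunctor X n).obj (op Y)) (m : ℕ)
    (hm : (m : ℕ∞) ≤ n) :
    jetComponent ((jetArcFunctor X n).map f.op γ) m hm =
      (f ▷ fatPoint k m) ≫ jetComponent γ m hm := by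
  cases n with
  | top => rfl
  | coe N => exact (whisker_exchange_assoc f _ _)

lemma whiskerLeft_fatPointMap_jetComponent {n : ℕ∞} (γ : (jetArcFunctor X n).obj (op Y))
    {l m : ℕ} (h : l ≤ m) (hm : (m : ℕ∞) ≤ n) :
    (Y ◁ fatPointMap k h) ≫ jetComponent γ m hm =
      jetComponent γ l (le_trans (by exact_mod_cast h) hm) := by
  cases n with
  | top => exact (show (arcFunctor X).obj (op Y) from γ).2 l m h
  | coe N =>
    refine (whiskerLeft_comp_assoc _ _ _ _).symm.trans ?_
    rw [fatPointMap_comp]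
    rfl

/-- For finite `n` the top component is the jet itself; for arcs the components are the data. Jets
and arcs can thus both be handled as compatible systems of `m`-jets with `m ≤ n`. -/
lemma jetComponent_ext {n : ℕ∞} {γ γ' : (jetArcFunctor X n).obj (op Y)}
    (h : ∀ m hm, jetComponent γ m hm = jetComponent γ' m hm) : γ = γ' := by
  cases n with
  | top => exact Subtype.ext (funext fun m => h m le_top)
  | coe N =>
    have h1 := h N le_rfl
    have h2 : ∀ γ : (jetArcFunctor X N).obj (op Y),
        jetComponent γ N le_rfl = (show Y ⊗ fatPoint k N ⟶ X from γ) := fun γ => by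
      refine Eq.trans ?_ (Category.id_comp _)
      change _ ≫ _ = _ ≫ _
      rw [fatPointMap_refl, whiskerLeft_id]
    exact (h2 γ).symm.trans (h1.trans (h2 γ'))

lemma exists_jetComponent_eq (n : ℕ∞) (f : ∀ m : ℕ, (m : ℕ∞) ≤ n → (Y ⊗ fatPoint k m ⟶ X))
    (hf : ∀ (l m : ℕ) (h : l ≤ m) (hm : (m : ℕ∞) ≤ n),
      (Y ◁ fatPointMap k h) ≫ f m hm = f l (le_trans (by exact_mod_cast h) hm)) :
    ∃ γ : (jetArcFunctor X n).obj (op Y), ∀ m hm, jetComponent γ m hm = f m hm := by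
  cases n with
  | top =>
    exact ⟨(⟨fun m => f m le_top, fun l m h => hf l m h le_top⟩ : (arcFunctor X).obj (op Y)),
      fun m hm => rfl⟩
  | coe N => exact ⟨f N le_rfl, fun m hm => hf m N (by exact_mod_cast hm) le_rfl⟩

lemma jetComponent_constantJet (n : ℕ∞) (x : Y ⟶ X) (m : ℕ) (hm : (m : ℕ∞) ≤ n) :
    jetComponent (constantJet x n) m hm = fst Y (fatPoint k m) ≫ x := by
  cases n with
  | top => rfl
  | coe N => exact whiskerLeft_fst_assoc _ _ _

variable {J : Over (Spec (.of k))} {n : ℕ∞}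

lemma jetComponent_homEquiv_constMap (h : IsJetScheme X n J)
    (x : Over.mk (𝟙 (Spec (.of k))) ⟶ X) (m : ℕ) (hm : (m : ℕ∞) ≤ n) :
    jetComponent (h.homEquiv (constMap (h.constant x) Y)) m hm = constMap x _ := by
  rw [constMap, h.homEquiv_comp, jetComponent_map]
  change _ ≫ jetComponent (h.homEquiv (h.homEquiv.symm _)) m hm = _
  rw [Equiv.apply_symm_apply, jetComponent_constantJet, ← Category.assoc, constMap]
  congr 1
  exact Over.mkIdTerminal.hom_ext _ _

end JetComponents

/-! ### Products with fat points -/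

section FatPoints

attribute [local instance] CategoryTheory.Over.cartesianMonoidalCategory

namespace JetRing

variable (m : ℕ) (k B : Type u) [Field k] [CommRing B] [Algebra k B]

/-- The inclusion of the truncated polynomials with coefficients in the ground field. -/
noncomputable def ofTruncPoly : TruncPoly k m →ₐ[k] JetRing m B :=
  Ideal.Quotient.liftₐ _ (Polynomial.aeval (mk m k B PowerSeries.X)) <| by
    intro p hp
    obtain ⟨q, rfl⟩ := Ideal.mem_span_singleton.1 hp
    rw [map_mul, map_pow, Polynomial.aeval_X, ← map_pow]
    have : mk m k B (PowerSeries.X ^ (m + 1)) = 0 := by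
      refine ext fun i hi => ?_
      have : i ≤ m := by exact_mod_cast hi
      rw [coeff_mk k hi, coeff_zero hi, PowerSeries.coeff_X_pow, if_neg (by omega)]
    rw [this, zero_mul]

lemma ofTruncPoly_mk_X :
    ofTruncPoly m k B (Ideal.Quotient.mk _ Polynomial.X) = mk m k B PowerSeries.X :=
  Polynomial.aeval_X _

/-- Truncated polynomials with coefficients in `B`. -/
noncomputable def ofTensor : B ⊗[k] TruncPoly k m →ₐ[k] JetRing m B :=
  Algebra.TensorProduct.productMap (const m k B) (ofTruncPoly m k B)

variable {m} in
lemma coeff_ofTensor_tmul_X_pow {i : ℕ} (hi : (i : ℕ∞) ≤ m) (b : B) (j : ℕ) :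
    coeff i (ofTensor m k B (b ⊗ₜ Ideal.Quotient.mk _ (Polynomial.X ^ j))) =
      if i = j then b else 0 := by
  rw [ofTensor, Algebra.TensorProduct.productMap_apply_tmul, map_pow, map_pow, ofTruncPoly_mk_X,
    ← map_pow]
  change coeff i (mk m k B (PowerSeries.C b) * _) = _
  rw [← map_mul, coeff_mk k hi, PowerSeries.coeff_C_mul, PowerSeries.coeff_X_pow]
  simp

/-- The tensor product is spanned over `B` by the powers of `t` below `m + 1`; the inverse `ψ` reads
off coefficients, and only its additivity is needed. -/
lemma ofTensor_bijective : Function.Bijective (ofTensor m k B) := by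
  let ψ : JetRing m B → B ⊗[k] TruncPoly k m := fun x =>
    ∑ i ∈ Finset.range (m + 1), coeff i x ⊗ₜ Ideal.Quotient.mk _ (Polynomial.X ^ i)
  have hle : ∀ i ∈ Finset.range (m + 1), (i : ℕ∞) ≤ m := fun i hi => by
    exact_mod_cast Nat.lt_succ_iff.1 (Finset.mem_range.1 hi)
  have hψ_add : ∀ x y, ψ (x + y) = ψ x + ψ y := fun x y => by
    rw [← Finset.sum_add_distrib]
    refine Finset.sum_congr rfl fun i hi => ?_
    rw [coeff_add (hle i hi), TensorProduct.add_tmul]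
  have hψ_zero : ψ 0 = 0 := Finset.sum_eq_zero fun i hi => by
    rw [coeff_zero (hle i hi), TensorProduct.zero_tmul]
  refine ⟨Function.LeftInverse.injective (g := ψ) fun z => ?_, fun x => ?_⟩
  · induction z using TensorProduct.induction_on with
    | zero => rw [map_zero, hψ_zero]
    | add z z' hz hz' => rw [map_add, hψ_add, hz, hz']
    | tmul b t =>
      obtain ⟨p, rfl⟩ := Ideal.Quotient.mk_surjective t
      induction p using Polynomial.induction_on' with
      | add p q hp hq => rw [map_add, TensorProduct.tmul_add, map_add, hψ_add, hp, hq]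
      | monomial j c =>
        have h1 : b ⊗ₜ[k] (Ideal.Quotient.mk (Ideal.span {(Polynomial.X ^ (m + 1) : Polynomial k)})
            (Polynomial.monomial j c)) = (c • b) ⊗ₜ[k] Ideal.Quotient.mk _ (Polynomial.X ^ j) := by
          rw [← Polynomial.smul_X_eq_monomial, TensorProduct.smul_tmul]
          rfl
        rw [h1]
        have h2 : ∀ i ∈ Finset.range (m + 1),
            coeff i (ofTensor m k B ((c • b) ⊗ₜ Ideal.Quotient.mk _ (Polynomial.X ^ j))) ⊗ₜ[k]
              Ideal.Quotient.mk (Ideal.span {(Polynomial.X ^ (m + 1) : Polynomial k)})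
                (Polynomial.X ^ i) = if i = j then
              (c • b) ⊗ₜ[k] Ideal.Quotient.mk _ (Polynomial.X ^ j) else 0 := fun i hi => by
          rw [coeff_ofTensor_tmul_X_pow k B (hle i hi)]
          split_ifs with h
          · rw [h]
          · rw [TensorProduct.zero_tmul]
        refine (Finset.sum_congr rfl h2).trans ?_
        rw [Finset.sum_ite_eq']
        split_ifs with hj
        · rfl
        · have : Ideal.Quotient.mk (Ideal.span {(Polynomial.X ^ (m + 1) : Polynomial k)})
              (Polynomial.X ^ j) = 0 := by
            rw [Ideal.Quotient.eq_zero_iff_mem, Ideal.mem_span_singleton]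
            exact pow_dvd_pow _ (by simpa using hj)
          rw [this, TensorProduct.tmul_zero]
  · refine ⟨ψ x, ext fun i hi => ?_⟩
    have h1 : ∀ s ⊆ Finset.range (m + 1), coeff i (ofTensor m k B (∑ j ∈ s,
        coeff j x ⊗ₜ[k] Ideal.Quotient.mk _ (Polynomial.X ^ j))) =
          ∑ j ∈ s, if i = j then coeff j x else 0 := by
      intro s _
      induction s using Finset.cons_induction with
      | empty => rw [Finset.sum_empty, Finset.sum_empty, map_zero, coeff_zero hi]
      | cons a s ha ih =>
        rw [Finset.sum_cons, Finset.sum_cons, map_add, coeff_add hi,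
          coeff_ofTensor_tmul_X_pow k B hi, ih (by grind)]
    rw [h1 _ subset_rfl, Finset.sum_ite_eq, if_pos]
    have : i ≤ m := by exact_mod_cast hi
    exact Finset.mem_range.2 (by omega)

end JetRing

variable {k : Type u} [Field k] {A B C : Type u} [CommRing B] [Algebra k B] [CommRing C]
  [Algebra k C] [CommRing A] [Algebra k A]

/-- The fibre product of affine schemes is the spectrum of the tensor product, and the comparison
becomes the spectrum of the given bijection. -/
lemma isIso_lift_specOver_map (f : B →ₐ[k] A) (g : C →ₐ[k] A)
    (h : Function.Bijective (Algebra.TensorProduct.productMap f g)) :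
    IsIso (lift (SpecOver.map f) (SpecOver.map g)) := by
  let e : B ⊗[k] C ≃+* A := RingEquiv.ofBijective (Algebra.TensorProduct.productMap f g) h
  have h1 : (lift (SpecOver.map f) (SpecOver.map g)).left =
      Spec.map e.toCommRingCatIso.hom ≫ (pullbackSpecIso k B C).inv := by
    apply Limits.pullback.hom_ext
    · refine (congrArg Over.Hom.left (lift_fst (SpecOver.map f) (SpecOver.map g))).trans ?_
      refine Eq.trans ?_ (Category.assoc _ _ _).symm
      refine Eq.trans ?_ (congrArg (Spec.map e.toCommRingCatIso.hom ≫ ·)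
          (pullbackSpecIso_inv_fst k B C).symm)
      refine Eq.trans ?_ (Spec.map_comp _ _)
      refine congrArg Spec.map (CommRingCat.hom_ext (RingHom.ext fun b => ?_))
      exact (Algebra.TensorProduct.productMap_left_apply _ _ b).symm
    · refine (congrArg Over.Hom.left (lift_snd (SpecOver.map f) (SpecOver.map g))).trans ?_
      refine Eq.trans ?_ (Category.assoc _ _ _).symm
      refine Eq.trans ?_ (congrArg (Spec.map e.toCommRingCatIso.hom ≫ ·)
          (pullbackSpecIso_inv_snd k B C).symm)
      refine Eq.trans ?_ (Spec.map_comp _ _)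
      refine congrArg Spec.map (CommRingCat.hom_ext (RingHom.ext fun b => ?_))
      exact (Algebra.TensorProduct.productMap_right_apply _ _ b).symm
  have h2 : IsIso ((Over.forget _).map (lift (SpecOver.map f) (SpecOver.map g))) := by
    rw [Over.forget_map, h1]
    have : IsIso (Spec.map e.toCommRingCatIso.hom) :=
      Functor.map_isIso Scheme.Spec e.toCommRingCatIso.hom.op
    exact IsIso.comp_isIso' this (pullbackSpecIso k B C).isIso_inv
  exact isIso_of_reflects_iso _ (Over.forget _)

variable (B) (m : ℕ)

/-- The comparison of the spectrum of `B[t]/(t^(m+1))` with the product. -/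
noncomputable def specJetRingToProd : SpecOver k (JetRing m B) ⟶ SpecOver k B ⊗ fatPoint k m :=
  lift (SpecOver.map (JetRing.const m k B)) (SpecOver.map (JetRing.ofTruncPoly m k B))

lemma specJetRingToProd_fst :
    specJetRingToProd (k := k) B m ≫ fst _ _ = SpecOver.map (JetRing.const m k B) := lift_fst _ _

lemma specJetRingToProd_snd :
    specJetRingToProd (k := k) B m ≫ snd _ _ = SpecOver.map (JetRing.ofTruncPoly m k B) :=
  lift_snd _ _

instance isIso_specJetRingToProd : IsIso (specJetRingToProd (k := k) B m) :=
  isIso_lift_specOver_map _ _ (JetRing.ofTensor_bijective m k B)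

end FatPoints

/-! ### Truncation of jets -/

namespace JetRing

section Truncation

variable {n m l : ℕ∞} {k B B' A : Type*} [CommRing k] [CommRing B] [CommRing B'] [CommRing A]
  [Algebra k B] [Algebra k B'] [Algebra k A]

variable (k B) in
/-- The truncation map `B[t]/(t^(n+1)) → B[t]/(t^(m+1))`, for `m ≤ n`. -/
noncomputable def trunc (h : m ≤ n) : JetRing n B →ₐ[k] JetRing m B :=
  lift k (mk m k B) fun f hf => ext fun i hi => by
    rw [coeff_mk k hi, coeff_zero hi, hf i (hi.trans h)]

lemma trunc_mk (h : m ≤ n) (f : B⟦X⟧) : trunc k B h (mk n k B f) = mk m k B f := lift_mk _ _ _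

lemma coeff_trunc (h : m ≤ n) {i : ℕ} (hi : (i : ℕ∞) ≤ m) (z : JetRing n B) :
    coeff i (trunc k B h z) = coeff i z := by
  obtain ⟨f, rfl⟩ := mk_surjective n k B z
  rw [trunc_mk, coeff_mk k hi, coeff_mk k (hi.trans h)]

lemma trunc_trunc (h : l ≤ m) (h' : m ≤ n) (z : JetRing n B) :
    trunc k B h (trunc k B h' z) = trunc k B (h.trans h') z :=
  ext fun i hi => by rw [coeff_trunc h hi, coeff_trunc h' (hi.trans h), coeff_trunc _ hi]

lemma trunc_const (h : m ≤ n) (b : B) : trunc k B h (const n k B b) = const m k B b :=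
  ext fun i hi => by rw [coeff_trunc h hi, coeff_const (hi.trans h), coeff_const hi]

lemma map_trunc (h : m ≤ n) (φ : B →ₐ[k] B') (z : JetRing n B) :
    map m φ (trunc k B h z) = trunc k B' h (map n φ z) :=
  ext fun i hi => by
    rw [coeff_map hi, coeff_trunc h hi, coeff_trunc h hi, coeff_map (hi.trans h)]

variable (k) in
lemma ext_trunc {z z' : JetRing n B}
    (h : ∀ (m : ℕ) (hm : (m : ℕ∞) ≤ n), trunc k B hm z = trunc k B hm z') : z = z' :=
  ext fun i hi => by rw [← coeff_trunc (k := k) hi le_rfl, h i hi, coeff_trunc hi le_rfl]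

lemma exists_trunc_eq (z : ∀ m : ℕ, (m : ℕ∞) ≤ n → JetRing m B)
    (hz : ∀ (l m : ℕ) (h : l ≤ m) (hm : (m : ℕ∞) ≤ n),
      trunc k B (by exact_mod_cast h) (z m hm) = z l (le_trans (by exact_mod_cast h) hm)) :
    ∃ w : JetRing n B, ∀ m hm, trunc k B hm w = z m hm := by
  -- Coefficient `i` is already present at level `i`; the default value beyond `n` is never read.
  obtain ⟨w, hw⟩ := exists_coeff_eq n fun i => if hi : (i : ℕ∞) ≤ n then coeff i (z i hi) else 0
  refine ⟨w, fun m hm => ext fun i hi => ?_⟩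
  have him : i ≤ m := by exact_mod_cast hi
  rw [coeff_trunc hm hi, hw i (hi.trans hm), dif_pos (hi.trans hm), ← hz i m him hm,
    coeff_trunc _ le_rfl]

/-- For `n = ∞` this is where an arc, given as a compatible system of jets, becomes a homomorphism
into `B⟦t⟧`. Gluing takes place on local rings, so morphisms out of `Spec B⟦t⟧` never enter. -/
lemma exists_algHom_trunc_eq (f : ∀ m : ℕ, (m : ℕ∞) ≤ n → (A →ₐ[k] JetRing m B))
    (hf : ∀ (l m : ℕ) (h : l ≤ m) (hm : (m : ℕ∞) ≤ n),
      (trunc k B (by exact_mod_cast h)).comp (f m hm) =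
        f l (le_trans (by exact_mod_cast h) hm)) :
    ∃ y : A →ₐ[k] JetRing n B, ∀ m hm, (trunc k B hm).comp y = f m hm := by
  choose y hy using fun a => exists_trunc_eq (k := k) (fun m hm => f m hm a) fun l m h hm =>
    DFunLike.congr_fun (hf l m h hm) a
  refine ⟨AlgHom.ofLinearMap
    { toFun := y
      map_add' := fun a b => ext_trunc k fun m hm => by simp only [hy, map_add]
      map_smul' := fun c a => ext_trunc k fun m hm => by
        simp only [hy, map_smul, RingHom.id_apply] }
    (ext_trunc k fun m hm => by
      change trunc k B hm (y 1) = _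
      simp only [hy, map_one])
    fun a b => ext_trunc k fun m hm => by
      change trunc k B hm (y (a * b)) = trunc k B hm (y a * y b)
      simp only [hy, map_mul], fun m hm => AlgHom.ext fun a => hy a m hm⟩

end Truncation

section TruncPoly

variable {k : Type u} [Field k] {B B' : Type u} [CommRing B] [Algebra k B] [CommRing B']
  [Algebra k B']

lemma ofTruncPoly_mk (m : ℕ) (p : Polynomial k) :
    ofTruncPoly m k B (Ideal.Quotient.mk _ p) = Polynomial.aeval (mk m k B PowerSeries.X) p := rfl

lemma map_comp_ofTruncPoly (m : ℕ) (φ : B →ₐ[k] B') :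
    (map m φ).comp (ofTruncPoly m k B) = ofTruncPoly m k B' := by
  refine AlgHom.ext fun t => ?_
  obtain ⟨p, rfl⟩ := Ideal.Quotient.mk_surjective t
  rw [AlgHom.comp_apply, ofTruncPoly_mk, ofTruncPoly_mk, ← Polynomial.aeval_algHom_apply, map_mk,
    PowerSeries.map_X]

lemma trunc_comp_ofTruncPoly {l m : ℕ} (h : l ≤ m) :
    (trunc k B (by exact_mod_cast h)).comp (ofTruncPoly m k B) =
      (ofTruncPoly l k B).comp (truncPolyMap k h) := by
  refine AlgHom.ext fun t => ?_
  obtain ⟨p, rfl⟩ := Ideal.Quotient.mk_surjective t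
  rw [AlgHom.comp_apply, AlgHom.comp_apply, truncPolyMap_mk, ofTruncPoly_mk, ofTruncPoly_mk,
    ← Polynomial.aeval_algHom_apply, trunc_mk]

end TruncPoly

end JetRing

/-! ### Jets centered at a rational point -/

section JetPoints

attribute [local instance] CategoryTheory.Over.cartesianMonoidalCategory

variable {k : Type u} [Field k] {B B' : Type u} [CommRing B] [Algebra k B] [CommRing B']
  [Algebra k B']

lemma specJetRingToProd_whiskerRight (φ : B →ₐ[k] B') (m : ℕ) :
    specJetRingToProd B' m ≫ (SpecOver.map φ ▷ fatPoint k m) =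
      SpecOver.map (JetRing.map m φ) ≫ specJetRingToProd B m := by
  apply CartesianMonoidalCategory.hom_ext
  · rw [Category.assoc, Category.assoc, whiskerRight_fst, specJetRingToProd_fst, ← Category.assoc,
      specJetRingToProd_fst, ← SpecOver.map_comp, ← SpecOver.map_comp]
    exact congrArg _ (AlgHom.ext fun b => (JetRing.map_const φ b).symm)
  · rw [Category.assoc, Category.assoc, whiskerRight_snd, specJetRingToProd_snd,
      specJetRingToProd_snd, ← JetRing.map_comp_ofTruncPoly m φ, SpecOver.map_comp]
    rfl

lemma specJetRingToProd_whiskerLeft {l m : ℕ} (h : l ≤ m) :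
    specJetRingToProd B l ≫ (SpecOver k B ◁ fatPointMap k h) =
      SpecOver.map (JetRing.trunc k B (by exact_mod_cast h)) ≫ specJetRingToProd B m := by
  apply CartesianMonoidalCategory.hom_ext
  · rw [Category.assoc, Category.assoc, whiskerLeft_fst, specJetRingToProd_fst,
      specJetRingToProd_fst, ← SpecOver.map_comp]
    exact congrArg _ (AlgHom.ext fun b => (JetRing.trunc_const (Nat.cast_le.2 h) b).symm)
  · rw [Category.assoc, Category.assoc, whiskerLeft_snd, specJetRingToProd_snd, ← Category.assoc,
      specJetRingToProd_snd]
    have h1 := congrArg SpecOver.map (JetRing.trunc_comp_ofTruncPoly (k := k) (B := B) h)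
    rw [SpecOver.map_comp, SpecOver.map_comp] at h1
    exact h1.symm

variable {X : Over (Spec (.of k))} {n : ℕ∞}

/-- A jet is given by a homomorphism from a local ring of `X`. -/
def IsJetOf (p : X.left) (γ : (jetArcFunctor X n).obj (op (SpecOver k B)))
    (y : X.left.presheaf.stalk p →ₐ[k] JetRing n B) : Prop :=
  ∀ (m : ℕ) (hm : (m : ℕ∞) ≤ n), specJetRingToProd B m ≫ jetComponent γ m hm =
    SpecOver.toHom p ((JetRing.trunc k B hm).comp y)

namespace IsJetOf

variable {p : X.left} {γ γ' : (jetArcFunctor X n).obj (op (SpecOver k B))}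
    {y y' : X.left.presheaf.stalk p →ₐ[k] JetRing n B}

lemma map (h : IsJetOf p γ y) (φ : B →ₐ[k] B') :
    IsJetOf p ((jetArcFunctor X n).map (SpecOver.map φ).op γ) ((JetRing.map n φ).comp y) := by
  intro m hm
  rw [jetComponent_map, ← Category.assoc, specJetRingToProd_whiskerRight, Category.assoc, h m hm,
    SpecOver.map_toHom]
  exact congrArg _ (AlgHom.ext fun a => JetRing.map_trunc hm φ (y a))

lemma hom_unique (h : IsJetOf p γ y) (h' : IsJetOf p γ y') : y = y' := by
  refine AlgHom.ext fun a => JetRing.ext_trunc k fun m hm => ?_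
  exact DFunLike.congr_fun (SpecOver.toHom_injective p ((h m hm).symm.trans (h' m hm))) a

lemma jet_unique (h : IsJetOf p γ y) (h' : IsJetOf p γ' y) : γ = γ' :=
  jetComponent_ext fun m hm => (cancel_epi _).1 ((h m hm).trans (h' m hm).symm)

variable (y) in
lemma exists_jet : ∃ γ, IsJetOf p γ y := by
  obtain ⟨γ, hγ⟩ := exists_jetComponent_eq n
    (fun m hm => inv (specJetRingToProd B m) ≫
      SpecOver.toHom p ((JetRing.trunc k B hm).comp y)) fun l m h hm => by
    rw [← cancel_epi (specJetRingToProd B l), IsIso.hom_inv_id_assoc, ← Category.assoc,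
      specJetRingToProd_whiskerLeft, Category.assoc, IsIso.hom_inv_id_assoc, SpecOver.map_toHom]
    exact congrArg _ (AlgHom.ext fun a => JetRing.trunc_trunc (Nat.cast_le.2 h) hm (y a))
  exact ⟨γ, fun m hm => by rw [hγ, IsIso.hom_inv_id_assoc]⟩

variable {J : Over (Spec (.of k))} (h : IsJetScheme X n J) (x : Over.mk (𝟙 (Spec (.of k))) ⟶ X)

lemma constMap_iff {y : X.left.presheaf.stalk (pointOf x) →ₐ[k] JetRing n B} :
    IsJetOf (pointOf x) (h.homEquiv (constMap (h.constant x) (SpecOver k B))) y ↔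
      ∀ a ∈ IsLocalRing.maximalIdeal (X.left.presheaf.stalk (pointOf x)), y a = 0 := by
  have h1 : IsJetOf (pointOf x) (h.homEquiv (constMap (h.constant x) (SpecOver k B))) y ↔
      ∀ (m : ℕ) (hm : (m : ℕ∞) ≤ n),
        ∀ a ∈ IsLocalRing.maximalIdeal (X.left.presheaf.stalk (pointOf x)),
          JetRing.trunc k B hm (y a) = 0 := by
    refine forall₂_congr fun m hm => ?_
    rw [jetComponent_homEquiv_constMap, comp_constMap, eq_comm, toHom_eq_constMap_iff]
    rfl
  rw [h1]
  constructor
  · intro hy a ha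
    exact JetRing.ext_trunc k fun m hm => (hy m hm a ha).trans (map_zero _).symm
  · intro hy m hm a ha
    rw [hy a ha, map_zero]

/-- Reducing coefficients modulo `𝔫` is surjective with nilpotent kernel, so each truncation of the
jet factors through the local ring at `x`. These factorizations are unique, hence compatible, and
glue. -/
lemma exists_hom {𝔫 : Ideal B} (h𝔫 : IsNilpotent 𝔫)
    (γ : (jetArcFunctor X n).obj (op (SpecOver k B)))
    (hγ : (jetArcFunctor X n).map (SpecOver.map (Ideal.Quotient.mkₐ k 𝔫)).op γ =
      h.homEquiv (constMap (h.constant x) (SpecOver k (B ⧸ 𝔫)))) :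
    ∃ y : X.left.presheaf.stalk (pointOf x) →ₐ[k] JetRing n B, IsJetOf (pointOf x) γ y ∧
      ∀ a ∈ IsLocalRing.maximalIdeal (X.left.presheaf.stalk (pointOf x)),
        y a ∈ JetRing.coeffIdeal n 𝔫 := by
  have hmem : ∀ (m : ℕ) (z : JetRing m B), JetRing.map m (Ideal.Quotient.mkₐ k 𝔫) z = 0 →
      z ∈ JetRing.coeffIdeal m 𝔫 := fun m z hz i hi => by
    rw [← Ideal.Quotient.eq_zero_iff_mem, ← Ideal.Quotient.mkₐ_eq_mk k, ← JetRing.coeff_map hi, hz,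
      JetRing.coeff_zero hi]
  have hker : ∀ m : ℕ, IsNilpotent (RingHom.ker (JetRing.map m (Ideal.Quotient.mkₐ k 𝔫))) := by
    intro m
    obtain ⟨N, hN⟩ := JetRing.isNilpotent_coeffIdeal (n := m) h𝔫
    exact ⟨N, le_bot_iff.1 ((Ideal.pow_right_mono (hmem m) N).trans hN.le)⟩
  have key : ∀ (m : ℕ) (hm : (m : ℕ∞) ≤ n),
      ∃ f : X.left.presheaf.stalk (pointOf x) →ₐ[k] JetRing m B,
        SpecOver.toHom (pointOf x) f = specJetRingToProd B m ≫ jetComponent γ m hm ∧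
        ∀ a ∈ IsLocalRing.maximalIdeal (X.left.presheaf.stalk (pointOf x)),
          JetRing.map m (Ideal.Quotient.mkₐ k 𝔫) (f a) = 0 := by
    intro m hm
    refine exists_toHom_eq x (JetRing.map_surjective (Ideal.Quotient.mkₐ_surjective k 𝔫))
      (hker m) _ ?_
    rw [← Category.assoc, ← specJetRingToProd_whiskerRight, Category.assoc, ← jetComponent_map, hγ,
      jetComponent_homEquiv_constMap, comp_constMap]
  choose f hf hf0 using key
  obtain ⟨y, hy⟩ := JetRing.exists_algHom_trunc_eq f fun l m hlm hm => by
    apply SpecOver.toHom_injective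
    rw [← SpecOver.map_toHom, hf, hf, ← Category.assoc, ← specJetRingToProd_whiskerLeft hlm,
      Category.assoc, whiskerLeft_fatPointMap_jetComponent]
  refine ⟨y, fun m hm => by rw [hy, hf], fun a ha i hi => ?_⟩
  rw [← JetRing.coeff_trunc (k := k) hi le_rfl]
  refine hmem i _ ?_ i le_rfl
  exact (congrArg _ (DFunLike.congr_fun (hy i hi) a)).trans (hf0 i hi a ha)

end IsJetOf

variable {J : Over (Spec (.of k))} (h : IsJetScheme X n J) (x : Over.mk (𝟙 (Spec (.of k))) ⟶ X)

lemma exists_isJetOf_homEquiv_toHom {𝔫 : Ideal B} (h𝔫 : IsNilpotent 𝔫)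
    (f : {f : J.left.presheaf.stalk (pointOf (h.constant x)) →ₐ[k] B //
      ∀ a ∈ IsLocalRing.maximalIdeal (J.left.presheaf.stalk (pointOf (h.constant x))),
        f a ∈ 𝔫}) :
    ∃ y : {y : X.left.presheaf.stalk (pointOf x) →ₐ[k] JetRing n B //
      ∀ a ∈ IsLocalRing.maximalIdeal (X.left.presheaf.stalk (pointOf x)),
        y a ∈ JetRing.coeffIdeal n 𝔫},
      IsJetOf (pointOf x) (h.homEquiv (SpecOver.toHom _ f.1)) y.1 := by
  obtain ⟨y, hy, hy𝔫⟩ := IsJetOf.exists_hom h x h𝔫 (h.homEquiv (SpecOver.toHom _ f.1)) <| by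
    rw [← h.homEquiv_comp, SpecOver.map_toHom]
    refine congrArg _ ((toHom_eq_constMap_iff _ _).2 fun a ha => ?_)
    exact Ideal.Quotient.eq_zero_iff_mem.2 (f.2 a ha)
  exact ⟨⟨y, hy𝔫⟩, hy⟩

/-- The jet defined by `y` reduces modulo `𝔫` to the constant jet, since both belong to a
homomorphism killing the maximal ideal. The corresponding point of `J` is then an infinitesimal
deformation of the constant one and factors through its local ring. -/
lemma exists_toHom_isJetOf {𝔫 : Ideal B} (h𝔫 : IsNilpotent 𝔫)
    (y : {y : X.left.presheaf.stalk (pointOf x) →ₐ[k] JetRing n B //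
      ∀ a ∈ IsLocalRing.maximalIdeal (X.left.presheaf.stalk (pointOf x)),
        y a ∈ JetRing.coeffIdeal n 𝔫}) :
    ∃ f : {f : J.left.presheaf.stalk (pointOf (h.constant x)) →ₐ[k] B //
      ∀ a ∈ IsLocalRing.maximalIdeal (J.left.presheaf.stalk (pointOf (h.constant x))),
        f a ∈ 𝔫}, IsJetOf (pointOf x) (h.homEquiv (SpecOver.toHom _ f.1)) y.1 := by
  obtain ⟨γ, hγ⟩ := IsJetOf.exists_jet y.1
  have h1 := hγ.map (Ideal.Quotient.mkₐ k 𝔫)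
  have h2 := (IsJetOf.constMap_iff h x (y := (JetRing.map n (Ideal.Quotient.mkₐ k 𝔫)).comp y.1)).2
    fun a ha => JetRing.ext fun i hi => by
      rw [AlgHom.comp_apply, JetRing.coeff_map hi, JetRing.coeff_zero hi]
      exact Ideal.Quotient.eq_zero_iff_mem.2 (y.2 a ha i hi)
  have h3 := h1.jet_unique h2
  obtain ⟨g, rfl⟩ := h.homEquiv.surjective γ
  rw [← h.homEquiv_comp] at h3
  obtain ⟨f, rfl, hf⟩ := exists_toHom_eq (h.constant x) (Ideal.Quotient.mkₐ_surjective k 𝔫)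
    ((congrArg IsNilpotent (Ideal.Quotient.mkₐ_ker k 𝔫)).mpr h𝔫) g (h.homEquiv.injective h3)
  exact ⟨⟨f, fun a ha => Ideal.Quotient.eq_zero_iff_mem.1 (hf a ha)⟩, hγ⟩

/-- The points of the jet scheme near a constant jet are the jets near the given point. -/
noncomputable def jetPointEquiv {𝔫 : Ideal B} (h𝔫 : IsNilpotent 𝔫) :
    {f : J.left.presheaf.stalk (pointOf (h.constant x)) →ₐ[k] B //
      ∀ a ∈ IsLocalRing.maximalIdeal (J.left.presheaf.stalk (pointOf (h.constant x))),
        f a ∈ 𝔫} ≃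
    {y : X.left.presheaf.stalk (pointOf x) →ₐ[k] JetRing n B //
      ∀ a ∈ IsLocalRing.maximalIdeal (X.left.presheaf.stalk (pointOf x)),
        y a ∈ JetRing.coeffIdeal n 𝔫} :=
  Equiv.ofBijective (fun f => (exists_isJetOf_homEquiv_toHom h x h𝔫 f).choose) <| by
    constructor
    · intro f f' hff
      have h1 := (exists_isJetOf_homEquiv_toHom h x h𝔫 f).choose_spec
      have h2 := (exists_isJetOf_homEquiv_toHom h x h𝔫 f').choose_spec
      have h3 := congrArg Subtype.val hff
      simp only at h3
      rw [h3] at h1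
      exact Subtype.ext (SpecOver.toHom_injective _ (h.homEquiv.injective (h1.jet_unique h2)))
    · intro y
      obtain ⟨f, hf⟩ := exists_toHom_isJetOf h x h𝔫 y
      exact ⟨f, Subtype.ext ((exists_isJetOf_homEquiv_toHom h x h𝔫 f).choose_spec.hom_unique hf)⟩

lemma isJetOf_jetPointEquiv {𝔫 : Ideal B} (h𝔫 : IsNilpotent 𝔫)
    (f : {f : J.left.presheaf.stalk (pointOf (h.constant x)) →ₐ[k] B //
      ∀ a ∈ IsLocalRing.maximalIdeal (J.left.presheaf.stalk (pointOf (h.constant x))),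
        f a ∈ 𝔫}) :
    IsJetOf (pointOf x) (h.homEquiv (SpecOver.toHom _ f.1)) (jetPointEquiv h x h𝔫 f).1 :=
  (exists_isJetOf_homEquiv_toHom h x h𝔫 f).choose_spec

open AdicFiltration

/-- The formal neighborhood of the jet scheme at a constant jet represents the jets in the formal
neighborhood of the given point. -/
noncomputable def jetCorrespondence : JetCorrespondence k n
    (filtration (IsLocalRing.maximalIdeal (X.left.presheaf.stalk (pointOf x))))
    (filtration (IsLocalRing.maximalIdeal (J.left.presheaf.stalk (pointOf (h.constant x))))) where
  equiv h𝔫 := (formalPointEquiv h𝔫).trans ((jetPointEquiv h x h𝔫).trans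
    (formalPointEquiv (JetRing.isNilpotent_coeffIdeal h𝔫)).symm)
  equiv_map {B _ _ 𝔫} h𝔫 {B' _ _ 𝔫'} h𝔫' φ hφ z := by
    apply (formalPointEquiv (JetRing.isNilpotent_coeffIdeal h𝔫')).injective
    rw [Equiv.trans_apply, Equiv.trans_apply, Equiv.trans_apply, Equiv.trans_apply,
      Equiv.apply_symm_apply]
    refine Subtype.ext ?_
    have h1 := (isJetOf_jetPointEquiv h x h𝔫 (formalPointEquiv h𝔫 z)).map φ
    rw [← h.homEquiv_comp, SpecOver.map_toHom] at h1
    have h2 := isJetOf_jetPointEquiv h x h𝔫' (formalPointEquiv h𝔫' (z.map φ hφ))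
    -- Naturality holds because the homomorphism belonging to a given jet is unique.
    refine Eq.trans ?_ (h1.hom_unique h2)
    rw [formalPointEquiv_apply, FormalPoint.map_hom, AlgHom.comp_assoc, ← formalPointEquiv_apply
      (JetRing.isNilpotent_coeffIdeal h𝔫), Equiv.apply_symm_apply]

lemma isCompleteFiltration_stalk : IsCompleteFiltration k
    (filtration (IsLocalRing.maximalIdeal (X.left.presheaf.stalk (pointOf x)))) :=
  isCompleteFiltration ((Ideal.ne_top_iff_one _).1 (IsLocalRing.maximalIdeal.isMaximal _).ne_top)
    (exists_sub_algebraMap_mem_maximalIdeal_stalk x)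

lemma CompletedStalk.hasBasis_nhds_zero (p : X.left) :
    (nhds (0 : CompletedStalk X p)).HasBasis (fun _ => True) fun n =>
      (filtration (IsLocalRing.maximalIdeal (X.left.presheaf.stalk p)) n : Set _) := by
  refine (CompletedStalk.hasBasis_nhds X p 0).congr (fun _ => Iff.rfl) fun n _ => ?_
  ext b
  rw [Set.mem_ofPred_eq, sub_zero]
  rfl

end JetPoints

/-! ### Smooth factors of jet schemes and arc spaces -/

theorem theoremA {k : Type u} [Field k] (X : Over (Spec (.of k)))
    (x : Over.mk (𝟙 (Spec (.of k))) ⟶ X) (n : ℕ∞)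
    (J : Over (Spec (.of k))) (h : IsJetScheme X n J) :
    (AdmitsSmoothFactor k (CompletedStalk X (pointOf x)) →
      AdmitsSmoothFactor k (CompletedStalk J (pointOf (IsJetScheme.constant h x)))) ∧
    (CharZero k →
      (AdmitsSmoothFactor k (CompletedStalk X (pointOf x)) ↔
        AdmitsSmoothFactor k (CompletedStalk J (pointOf (IsJetScheme.constant h x))))) := by
  have hX := CompletedStalk.isTopologicalRing X (pointOf x)
  have hJ := CompletedStalk.isTopologicalRing J (pointOf (h.constant x))
  have hforward : AdmitsSmoothFactor k (CompletedStalk X (pointOf x)) →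
      AdmitsSmoothFactor k (CompletedStalk J (pointOf (IsJetScheme.constant h x))) := fun hs => by
    obtain ⟨σ⟩ := nonempty_smoothAction_of_admitsSmoothFactor (isCompleteFiltration_stalk x)
      (CompletedStalk.hasBasis_nhds_zero _) hs
    exact SmoothAction.admitsSmoothFactor (isCompleteFiltration_stalk (h.constant x))
      (CompletedStalk.hasBasis_nhds_zero _) (σ.jets (jetCorrespondence h x))
  refine ⟨hforward, fun hk => ⟨hforward, fun hs => ?_⟩⟩
  obtain ⟨σ⟩ := nonempty_smoothAction_of_admitsSmoothFactor
    (isCompleteFiltration_stalk (h.constant x)) (CompletedStalk.hasBasis_nhds_zero _) hs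
  obtain ⟨σ'⟩ := (jetCorrespondence h x).nonempty_smoothAction (isCompleteFiltration_stalk x) σ
  exact SmoothAction.admitsSmoothFactor (isCompleteFiltration_stalk x)
    (CompletedStalk.hasBasis_nhds_zero _) σ'
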